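/- **Setting.** Let $(X,\mu)$ be a $\sigma$-finite measure space, $H$ a complex Hilbert space and $\mathcal H=L^2(X,\mu;H)$. Let $\tau$ denote the trace, with values in $[0,\infty]$ on positive operators, $\chi_\Omega$ multiplication by the characteristic function of $\Omega$, and $\|\cdot\|_{2,2}$ the operator norm on $\mathcal H$. For a bounded positive operator $P$ on $\mathcal H$ let $$\nu_P(\Omega)=\tau(\chi_\Omega P\chi_\Omega)=\tau(P^{1/2}\chi_\Omega P^{1/2})\qquad(\Omega\subset X\text{ measurable}),$$ which is a measure absolutely continuous with respect to $\mu$; let $D\nu_P=d\nu_P/d\mu$ be its Radon–Nikodym derivative and $D(P)=\|D\nu_P\|_\infty=\sup_\Omega \nu_P(\Omega)/\mu(\Omega)$. **Theorem.** Let $A$ be a positive self-adjoint (possibly unbounded) operator on $\mathcal H$. Suppose that its spectral projections $\Pi_\lambda=\chi_A(]0,\lambda])$ have finite density $F(\lambda)=D(\Pi_\lambda)<\infty$ for all $\lambda$, and that the Stieltjes integral $$G(\lambda)=\int_0^\lambda\frac{dF(u)}{u}$$ converges for all $\lambda$ (here $F=0$ on $]-\infty,0]$ and the integral is over $[0,\lambda]$;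 in particular $F(0^+)=0$). Put $G^{-1}(y)=\sup\{\lambda\ge 0 : G(\lambda)\le y\}\in[0,\infty]$. Let $\rho$ be a bounded positive operator on $\mathcal H$ with $\rho=0$ on $\ker A$. Then $$\int_X G^{-1}\Bigl(\frac{D\nu_\rho(x)}{4\,\|\rho^{1/2}A\rho^{1/2}\|_{2,2}}\Bigr)\,d\nu_\rho(x)\;\le\;4\,\mathcal E(\rho),\qquad \mathcal E(\rho)=\tau(\rho^{1/2}A\rho^{1/2})\in[0,\infty].$$ Moreover $\mathcal E(\rho)=\tau(A^{1/2}\rho A^{1/2})$, and if $A\rho$ is everywhere defined and of trace class, then $\mathcal E(\rho)$ is finite and $\mathcal E(\rho)=\tau(A\rho)$. Here $\rho^{1/2}A\rho^{1/2}$ stands for the quadratic form $f\mapsto\|A^{1/2}\rho^{1/2}f\|^2\in[0,\infty]$, with value $\infty$ where $\rho^{1/2}f\notin\mathrm{dom}\,A^{1/2}$; its norm is the supremum over the unit ball and its trace the sum over a Hilbert basis, either of which may be $\infty$ (with $a/\infty=0$). The trace $\tau(A^{1/2}\rho A^{1/2})$ is the supremum of $\sum_i\|\rho^{1/2}A^{1/2}f_i\|^2$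 over the finite orthonormal families $(f_i)$ in $\mathrm{dom}\,A^{1/2}$. -/

import Mathlib

open MeasureTheory
open scoped ENNReal

noncomputable section

namespace MixedState

/-! ## Operators, traces and quadratic forms on a complex Hilbert space -/

section Hilbert

variable {E : Type*} [NormedAddCommGroup E] [InnerProductSpace ℂ E] [CompleteSpace E]

/-- The positive square root `T^{1/2}` of a bounded positive operator. -/
def opSqrt (T : E →L[ℂ] E) : E →L[ℂ] E := CFC.sqrt T

lemma inner_opSqrt (T : E →L[ℂ] E) (f g : E) :
    inner ℂ f (opSqrt T g) = inner ℂ (opSqrt T f) g :=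
  (((ContinuousLinearMap.nonneg_iff_isPositive _).1 (CFC.sqrt_nonneg T)).isSymmetric f g).symm

lemma opSqrt_mul_self (T : E →L[ℂ] E) (hT : T.IsPositive) : opSqrt T * opSqrt T = T :=
  CFC.sqrt_mul_sqrt_self T ((ContinuousLinearMap.nonneg_iff_isPositive _).2 hT)

variable (E) in
/-- The index set of a fixed Hilbert basis of `E`. -/
def basisIndex : Set E := (exists_hilbertBasis ℂ E).choose

variable (E) in
/-- A fixed Hilbert basis of `E`. -/
def stdBasis : HilbertBasis (basisIndex E) ℂ E := (exists_hilbertBasis ℂ E).choose_spec.choose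

/-- The trace `∑ᵢ q(eᵢ) ∈ [0, ∞]` of a nonnegative quadratic form `q` on `E`. -/
def formTrace (q : E → ℝ≥0∞) : ℝ≥0∞ := ∑' i, q (stdBasis E i)

/-- The norm `sup_{‖f‖ ≤ 1} q(f) ∈ [0, ∞]` of a nonnegative quadratic form `q` on `E`, that is the
operator norm of the associated positive operator. -/
def formNorm (q : E → ℝ≥0∞) : ℝ≥0∞ := ⨆ (f : E) (_ : ‖f‖ ≤ 1), q f

/-- The trace `τ(T) = ∑ᵢ ⟨eᵢ, T eᵢ⟩ ∈ [0, ∞]` of a bounded positive operator. -/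
def trace (T : E →L[ℂ] E) : ℝ≥0∞ :=
  formTrace fun f => ENNReal.ofReal (inner ℂ f (T f)).re

/-- Hilbert--Schmidt operators. -/
def IsHilbertSchmidt (T : E →L[ℂ] E) : Prop := formTrace (fun f => ‖T f‖ₑ ^ 2) ≠ ∞

/-- Trace class operators: the products of two Hilbert--Schmidt operators (equivalently, those with
`τ(|T|) < ∞`). -/
def IsTraceClass (T : E →L[ℂ] E) : Prop :=
  ∃ S R : E →L[ℂ] E, IsHilbertSchmidt S ∧ IsHilbertSchmidt R ∧ T = S * R

/-- Parseval: `∑ᵢ ‖T eᵢ‖² = ∑ᵢ ‖T* eᵢ‖²`. -/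
lemma formTrace_adjoint (T : E →L[ℂ] E) :
    formTrace (fun f => ‖T f‖ₑ ^ 2) = formTrace (fun f => ‖ContinuousLinearMap.adjoint T f‖ₑ ^ 2) := by
  have key : ∀ x : E, ‖x‖ₑ ^ 2 = ∑' i, ‖inner ℂ (stdBasis E i) x‖ₑ ^ 2 := by
    intro x
    have h := (stdBasis E).hasSum_inner_mul_inner x x
    have h2 : HasSum (fun i => ‖inner ℂ (stdBasis E i) x‖ ^ 2) (‖x‖ ^ 2) := by
      have h3 := Complex.hasSum_re h
      convert h3 using 1
      · ext i
        rw [← inner_conj_symm x, mul_comm, Complex.mul_conj, Complex.ofReal_re,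
          Complex.normSq_eq_norm_sq]
      · exact norm_sq_eq_re_inner (𝕜 := ℂ) x
    have h4 : ∀ y : ℂ, ‖y‖ₑ ^ 2 = ENNReal.ofReal (‖y‖ ^ 2) := fun y => by
      rw [ENNReal.ofReal_pow (norm_nonneg _), ofReal_norm]
    simp_rw [h4]
    rw [← ENNReal.ofReal_tsum_of_nonneg (fun i => by positivity) h2.summable, h2.tsum_eq,
      ENNReal.ofReal_pow (norm_nonneg _), ofReal_norm]
  unfold formTrace
  simp_rw [key]
  rw [ENNReal.tsum_comm]
  refine tsum_congr fun i => tsum_congr fun j => ?_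
  rw [ContinuousLinearMap.adjoint_inner_right, ← inner_conj_symm]
  congr 1
  exact RCLike.enorm_conj _

end Hilbert

/-! ## Spectral calculus of a self-adjoint operator -/

/-- The Lebesgue--Stieltjes measure `dF` of a nondecreasing function `F`; it gives `]a, b]` the
mass `F(b+) - F(a+)` and `{a}` the mass `F(a+) - F(a-)`. -/
def stieltjesMeasure (F : ℝ → ℝ) : Measure ℝ :=
  open Classical in if h : Monotone F then h.stieltjesFunction.measure else 0

section Spectral

variable {E : Type*} [NormedAddCommGroup E] [InnerProductSpace ℂ E] [CompleteSpace E]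

/-- A resolution of the identity `(P_t)`, `t ∈ ℝ`: orthogonal projections, nondecreasing and
strongly right continuous in `t`, with strong limits `0` at `-∞` and `1` at `+∞`. -/
structure IsSpectralFamily (P : ℝ → E →L[ℂ] E) : Prop where
  isStarProjection : ∀ t, IsStarProjection (P t)
  mono : ∀ s t, s ≤ t → P s * P t = P s
  rightCont : ∀ t f, ContinuousWithinAt (fun s => P s f) (Set.Ici t) t
  tendsto_atBot : ∀ f, Filter.Tendsto (fun s => P s f) Filter.atBot (nhds 0)
  tendsto_atTop : ∀ f, Filter.Tendsto (fun s => P s f) Filter.atTop (nhds f)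

/-- The scalar spectral measure `d⟨P_t f, f⟩ = d‖P_t f‖²`. -/
def scalarMeasure (P : ℝ → E →L[ℂ] E) (f : E) : Measure ℝ :=
  stieltjesMeasure fun t => ‖P t f‖ ^ 2

/-- `S = ∫ φ(t) dP_t`: the domain of `S` consists of the `f` such that `∫ φ(t)² d⟨P_t f, f⟩ < ∞`,
and `⟨f, S f⟩ = ∫ φ(t) d⟨P_t f, f⟩` there. -/
structure IsSpectralIntegral (P : ℝ → E →L[ℂ] E) (φ : ℝ → ℝ) (S : E →ₗ.[ℂ] E) : Prop where
  mem_domain_iff : ∀ f : E,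
    f ∈ S.domain ↔ ∫⁻ t, ENNReal.ofReal (φ t ^ 2) ∂(scalarMeasure P f) < ∞
  inner_eq : ∀ f : S.domain,
    inner ℂ (f : E) (S f) = ((∫ t, φ t ∂(scalarMeasure P f) : ℝ) : ℂ)

/-- The spectral family `E_t = χ_A(]-∞, t])` of a self-adjoint operator `A`: the resolution of the
identity with `A = ∫ t dE_t`. -/
def spectralFamily (A : E →ₗ.[ℂ] E) : ℝ → E →L[ℂ] E :=
  open Classical in
  if h : ∃ P : ℝ → E →L[ℂ] E, IsSpectralFamily P ∧ IsSpectralIntegral P id A then h.choose else 0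

/-- The operator `φ(A) = ∫ φ(t) dE_t`, for a self-adjoint operator `A`. -/
def funCalc (A : E →ₗ.[ℂ] E) (φ : ℝ → ℝ) : E →ₗ.[ℂ] E :=
  open Classical in
  if h : ∃ S : E →ₗ.[ℂ] E, IsSpectralIntegral (spectralFamily A) φ S then h.choose else ⊥

/-- The square root `A^{1/2}` of a positive self-adjoint operator `A`. -/
def sqrtOp (A : E →ₗ.[ℂ] E) : E →ₗ.[ℂ] E := funCalc A Real.sqrt

/-- The spectral projection `Π_l = χ_A(]0, l])`; it vanishes when `l ≤ 0`. -/
def spectralProj (A : E →ₗ.[ℂ] E) (l : ℝ) : E →L[ℂ] E :=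
  spectralFamily A (max l 0) - spectralFamily A 0

/-- The energy `⟨A f, f⟩ = ‖A^{1/2} f‖² = ∫ t d⟨E_t f, f⟩` of `f`, for `A` positive self-adjoint;
it is `∞` when `f` is not in the domain of `A^{1/2}`. -/
def energy (A : E →ₗ.[ℂ] E) (f : E) : ℝ≥0∞ :=
  ∫⁻ t, ENNReal.ofReal t ∂(scalarMeasure (spectralFamily A) f)

/-- The positive operator `ρ^{1/2} A ρ^{1/2} = (A^{1/2} ρ^{1/2})* (A^{1/2} ρ^{1/2})`, as the quadratic
form `f ↦ ⟨A ρ^{1/2} f, ρ^{1/2} f⟩ = ‖A^{1/2} ρ^{1/2} f‖² ∈ [0, ∞]`. -/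
def sandwichForm (A : E →ₗ.[ℂ] E) (ρ : E →L[ℂ] E) (f : E) : ℝ≥0∞ := energy A (opSqrt ρ f)

/-- The trace `τ(S ρ S)`, for `S` densely defined and self-adjoint and `ρ` bounded and positive: the
supremum of `∑ᵢ ‖ρ^{1/2} S fᵢ‖²` over the finite orthonormal families in the domain of `S`. -/
def sandwichTrace (S : E →ₗ.[ℂ] E) (ρ : E →L[ℂ] E) : ℝ≥0∞ :=
  ⨆ (n : ℕ) (v : Fin n → S.domain) (_ : Orthonormal ℂ fun i => (v i : E)),
    ∑ i, ‖opSqrt ρ (S (v i))‖ₑ ^ 2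

end Spectral

/-! ## Density of an operator on `L²(X, H)` -/

section Density

variable {X : Type*} [MeasurableSpace X] {μ : Measure X}
variable {H : Type*} [NormedAddCommGroup H] [InnerProductSpace ℂ H] [CompleteSpace H]

/-- Multiplication by the characteristic function `χ_Ω` on `L²(X, H)`. -/
def chi (Ω : Set X) (hΩ : MeasurableSet Ω) : Lp H 2 μ →L[ℂ] Lp H 2 μ :=
  LinearMap.mkContinuous
    { toFun := fun f => ((Lp.memLp f).indicator hΩ).toLp (Ω.indicator f)
      map_add' := fun f g => by
        rw [← MemLp.toLp_add]
        refine MemLp.toLp_congr _ _ ?_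
        filter_upwards [Lp.coeFn_add f g] with x hx
        by_cases h : x ∈ Ω
        · simp only [Set.indicator_of_mem h, Pi.add_apply]
          exact hx
        · simp [h]
      map_smul' := fun c f => by
        rw [RingHom.id_apply, ← MemLp.toLp_const_smul]
        refine MemLp.toLp_congr _ _ ?_
        filter_upwards [Lp.coeFn_smul c f] with x hx
        by_cases h : x ∈ Ω
        · simp only [Set.indicator_of_mem h, Pi.smul_apply]
          exact hx
        · simp [h] }
    1 (fun f => by
      rw [one_mul]
      refine Lp.norm_le_norm_of_ae_le ?_
      filter_upwards [((Lp.memLp f).indicator hΩ).coeFn_toLp] with x hx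
      simp only [LinearMap.coe_mk, AddHom.coe_mk, hx]
      by_cases h : x ∈ Ω <;> simp [h])

lemma chi_coeFn (Ω : Set X) (hΩ : MeasurableSet Ω) (f : Lp H 2 μ) :
    chi Ω hΩ f =ᵐ[μ] Ω.indicator f :=
  ((Lp.memLp f).indicator hΩ).coeFn_toLp

lemma inner_chi (Ω : Set X) (hΩ : MeasurableSet Ω) (f g : Lp H 2 μ) :
    inner ℂ f (chi Ω hΩ g) = inner ℂ (chi Ω hΩ f) g := by
  rw [L2.inner_def, L2.inner_def]
  refine integral_congr_ae ?_
  filter_upwards [chi_coeFn Ω hΩ f, chi_coeFn Ω hΩ g] with x h1 h2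
  rw [h1, h2]
  by_cases h : x ∈ Ω <;> simp [h]

lemma ofReal_inner_chi (Ω : Set X) (hΩ : MeasurableSet Ω) (f : Lp H 2 μ) :
    ENNReal.ofReal (inner ℂ f (chi Ω hΩ f)).re = ∫⁻ x in Ω, ‖f x‖ₑ ^ 2 ∂μ := by
  have hint : Integrable (fun x => ‖f x‖ ^ 2) μ := (Lp.memLp f).integrable_norm_pow (by norm_num)
  have h1 : inner ℂ f (chi Ω hΩ f) = ((∫ x in Ω, ‖f x‖ ^ 2 ∂μ : ℝ) : ℂ) := by
    rw [L2.inner_def, ← integral_indicator hΩ, ← integral_complex_ofReal]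
    refine integral_congr_ae ?_
    filter_upwards [chi_coeFn Ω hΩ f] with x h1
    rw [h1]
    by_cases h : x ∈ Ω
    · simp [h, inner_self_eq_norm_sq_to_K]
    · simp [h]
  rw [h1, Complex.ofReal_re, ofReal_integral_eq_lintegral_ofReal hint.integrableOn
    (Filter.Eventually.of_forall fun x => by positivity)]
  refine lintegral_congr fun x => ?_
  rw [ENNReal.ofReal_pow (norm_nonneg _), ofReal_norm]

/-- `τ(P^{1/2} χ_Ω P^{1/2})` is the integral over `Ω` of the pointwise squared norms. -/
lemma trace_sqrt_chi_sqrt (P : Lp H 2 μ →L[ℂ] Lp H 2 μ) (Ω : Set X) (hΩ : MeasurableSet Ω) :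
    trace (opSqrt P * chi Ω hΩ * opSqrt P) =
      formTrace fun f => ∫⁻ x in Ω, ‖(opSqrt P f) x‖ₑ ^ 2 ∂μ := by
  have hs := inner_opSqrt P
  unfold trace
  congr 1
  ext f
  rw [← ofReal_inner_chi Ω hΩ]
  simp only [mul_apply_eq_comp, hs]

/-- The density measure `ν_P(Ω) = τ(P^{1/2} χ_Ω P^{1/2}) = τ(χ_Ω P χ_Ω)` of a bounded positive
operator `P` on `L²(X, H)`. -/
def densityMeasure (P : Lp H 2 μ →L[ℂ] Lp H 2 μ) : Measure X :=
  Measure.ofMeasurable (fun Ω hΩ => trace (opSqrt P * chi Ω hΩ * opSqrt P))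
    (by
      rw [trace_sqrt_chi_sqrt]
      simp [formTrace])
    (by
      intro Ω hΩ hd
      simp only [trace_sqrt_chi_sqrt]
      unfold formTrace
      rw [ENNReal.tsum_comm]
      exact tsum_congr fun i => lintegral_iUnion hΩ hd _)

lemma densityMeasure_apply (P : Lp H 2 μ →L[ℂ] Lp H 2 μ) {Ω : Set X} (hΩ : MeasurableSet Ω) :
    densityMeasure P Ω = trace (opSqrt P * chi Ω hΩ * opSqrt P) :=
  Measure.ofMeasurable_apply Ω hΩ

/-- The two expressions `τ(P^{1/2} χ_Ω P^{1/2})` and `τ(χ_Ω P χ_Ω)` agree. -/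
lemma densityMeasure_apply' (P : Lp H 2 μ →L[ℂ] Lp H 2 μ) (hP : P.IsPositive) {Ω : Set X}
    (hΩ : MeasurableSet Ω) :
    densityMeasure P Ω = trace (chi Ω hΩ * P * chi Ω hΩ) := by
  have hs := inner_opSqrt P
  have hPP := opSqrt_mul_self P hP
  have hidem : ∀ f : Lp H 2 μ, chi Ω hΩ (chi Ω hΩ f) = chi Ω hΩ f := by
    intro f
    refine Lp.ext ?_
    filter_upwards [chi_coeFn Ω hΩ (chi Ω hΩ f), chi_coeFn Ω hΩ f] with x h1 h2
    rw [h1]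
    by_cases h : x ∈ Ω
    · simp [h]
    · simp [h, h2]
  have hsq : ∀ g : Lp H 2 μ, ENNReal.ofReal (inner ℂ g g).re = ‖g‖ₑ ^ 2 := by
    intro g
    have : (inner ℂ g g).re = ‖g‖ ^ 2 := (norm_sq_eq_re_inner (𝕜 := ℂ) g).symm
    rw [this, ENNReal.ofReal_pow (norm_nonneg _), ofReal_norm]
  have hadj : ContinuousLinearMap.adjoint (chi Ω hΩ * opSqrt P) = opSqrt P * chi Ω hΩ := by
    symm
    rw [ContinuousLinearMap.eq_adjoint_iff]
    intro x y
    simp only [mul_apply_eq_comp]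
    rw [← hs, inner_chi]
  rw [densityMeasure_apply P hΩ]
  have h1 : trace (opSqrt P * chi Ω hΩ * opSqrt P)
      = formTrace (fun f => ‖(chi Ω hΩ * opSqrt P : Lp H 2 μ →L[ℂ] Lp H 2 μ) f‖ₑ ^ 2) := by
    unfold trace
    congr 1
    ext f
    rw [← hsq]
    simp only [mul_apply_eq_comp]
    rw [hs, ← inner_chi, hidem]
  have h2 : trace (chi Ω hΩ * P * chi Ω hΩ)
      = formTrace (fun f => ‖(opSqrt P * chi Ω hΩ : Lp H 2 μ →L[ℂ] Lp H 2 μ) f‖ₑ ^ 2) := by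
    unfold trace
    congr 1
    ext f
    rw [← hsq]
    nth_rewrite 1 [← hPP]
    simp only [mul_apply_eq_comp]
    rw [inner_chi, hs]
  rw [h1, h2, formTrace_adjoint, hadj]

lemma densityMeasure_absolutelyContinuous (P : Lp H 2 μ →L[ℂ] Lp H 2 μ) :
    densityMeasure P ≪ μ := by
  refine Measure.AbsolutelyContinuous.mk fun Ω hΩ h => ?_
  rw [densityMeasure_apply P hΩ, trace_sqrt_chi_sqrt]
  have : μ.restrict Ω = 0 := Measure.restrict_eq_zero.2 h
  simp [formTrace, this]

/-- The density function `Dν_P = dν_P / dμ`. -/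
def densityFun (P : Lp H 2 μ →L[ℂ] Lp H 2 μ) : X → ℝ≥0∞ := (densityMeasure P).rnDeriv μ

/-- The density `D(P) = sup_Ω ν_P(Ω) / μ(Ω) ∈ [0, ∞]`, over the measurable `Ω ⊆ X` (with `0 / 0 = 0`).
-/
def density (P : Lp H 2 μ →L[ℂ] Lp H 2 μ) : ℝ≥0∞ :=
  ⨆ (Ω : Set X) (_ : MeasurableSet Ω), densityMeasure P Ω / μ Ω

/-- The spectral density `F(l) = D(Π_l)` of `A`; it vanishes for `l ≤ 0`. -/
def spectralDensity (A : Lp H 2 μ →ₗ.[ℂ] Lp H 2 μ) (l : ℝ) : ℝ≥0∞ := density (spectralProj A l)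

/-- The Stieltjes integral `G(l) = ∫_{[0, l]} dF(u) / u ∈ [0, ∞]`, where `F` vanishes on `]-∞, 0]`.
An atom of `dF` at `0`, of mass `F(0+)`, makes it infinite. -/
def stieltjesG (A : Lp H 2 μ →ₗ.[ℂ] Lp H 2 μ) (l : ℝ) : ℝ≥0∞ :=
  ∫⁻ u in Set.Icc 0 l, (ENNReal.ofReal u)⁻¹
    ∂(stieltjesMeasure fun t => (spectralDensity A t).toReal)

/-- The right continuous inverse `G⁻¹(y) = sup {l ≥ 0 | G(l) ≤ y} ∈ [0, ∞]`. -/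
def invG (A : Lp H 2 μ →ₗ.[ℂ] Lp H 2 μ) (y : ℝ≥0∞) : ℝ≥0∞ :=
  ⨆ (l : ℝ) (_ : 0 ≤ l) (_ : stieltjesG A l ≤ y), ENNReal.ofReal l

end Density

end MixedState

end

noncomputable section

namespace MixedState

open Set Filter Topology

set_option linter.unusedSectionVars false

/-! ## Linear relations between finite measures on the line -/

/-! Write `r = ρ^{1/2}`, `P_t` for the spectral family of `A`, `m_f` for the measure `d‖P_t f‖²`,
`e` for the norm of `r A r`, and `F`, `G` as in the theorem.

The inequality comes from cutting `r` at an energy `l`. The hypothesis on `ker A` gives `P_0 r = 0`,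
so `r = Π_l r + (1 - P_l) r`, and `ν_ρ(Ω)`, the squared Hilbert–Schmidt norm of `χ_Ω r`, is at most
twice that of `χ_Ω Π_l r` plus twice the high energy mass `τ(r (1 - P_l) r)`. For the low part, pass
to the adjoint `r Π_l χ_Ω`. Since `‖r A^{1/2}‖² ≤ e`, Cauchy–Schwarz gives `‖r Π_l f‖² ≤ e ∫_{]0,l]}
dm_f(t) / t` (`enorm_opSqrt_proj_sq_le`). Summed over `f = χ_Ω e_i`, the measures give `]0, s]` the
mass `ν_{Π_s}(Ω) ≤ F(s) μ(Ω)`; writing `1/t = 1/l + ∫_t^l ds/s²`, an integration by parts bounds the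
low part by `e G(l) μ(Ω)` (`hsSq_low_le`). On the set where `Dν_ρ ≥ 4 e G(l)`, twice this is at most
half of `ν_ρ`, hence is absorbed, and the set has `ν_ρ`-mass at most four times the high energy mass
(`densityMeasure_le_highMass`). Integrating over `l > 0`, the layer cake formula turns the left side
into the integral of `G⁻¹` and the right side into `4 𝓔(ρ)`.

For the traces, let `a_n` be the bounded truncation of `A^{1/2}` to `{√t ≤ n}`. Then `𝓔(ρ)` is the
supremum over `n` of the squared Hilbert–Schmidt norms of `r a_n` (`formTrace_sandwichForm`).
Comparison with orthonormal families uses Bessel's inequality one way and a Hilbert basis of the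
spectral subspace `{√t ≤ n}`, contained in the domain of `A^{1/2}`, the other way. If `A ρ = U V`
with `U`, `V` Hilbert–Schmidt, put `D_n = (r + 1/(n+1))⁻¹`: the trace of `D_n ρ A ρ D_n` is a sum of
energies tending to `𝓔(ρ)`, and by cyclicity it also tends to `τ(A ρ)` (`formTrace_eq_diagSum`).

All this needs a spectral family of `A`. The bounded operator `B = (1 + A)⁻¹` supplies one: `P_t`
projects onto the kernel of the positive part of `(1 + t)⁻¹ - B`, the subspace where `B ≥ (1 +
t)⁻¹`, that is `A ≤ t`. Comparing increments shows `B = ∫ (1 + t)⁻¹ dP_t`, from which `A = ∫ t dP_t`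
follows (`exists_spectralFamily`). -/

/-- A linear relation between finite measures on `ℝ` can be checked on the half lines `]-∞, t]`. -/
lemma sum_mul_integral_eq_zero {ι : Type*} [Fintype ι] (c : ι → ℝ) (ν : ι → Measure ℝ)
    [hν : ∀ i, IsFiniteMeasure (ν i)] (h : ∀ t, ∑ i, c i * (ν i).real (Iic t) = 0)
    {φ : ℝ → ℝ} (hi : ∀ i, Integrable φ (ν i)) : ∑ i, c i * ∫ t, φ t ∂(ν i) = 0 := by
  -- Splitting the coefficients into positive and negative parts turns the relation into an equality
  -- of two finite positive measures, which half lines determine.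
  have hm : (∑ i, (c i).toNNReal • ν i) = ∑ i, (-c i).toNNReal • ν i := by
    refine Measure.ext_of_Iic _ _ fun t => ?_
    have hreal : ∀ d : ι → ℝ, (∑ i, (d i).toNNReal • ν i) (Iic t)
        = ENNReal.ofReal (∑ i, (d i).toNNReal * (ν i).real (Iic t)) := by
      intro d
      rw [Measure.finsetSum_apply, ENNReal.ofReal_sum_of_nonneg fun i _ => by positivity]
      refine Finset.sum_congr rfl fun i _ => ?_
      rw [Measure.smul_apply, ENNReal.ofReal_mul (by positivity), ENNReal.ofReal_coe_nnreal,
        ofReal_measureReal]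
      rfl
    rw [hreal, hreal]
    congr 1
    rw [← sub_eq_zero, ← Finset.sum_sub_distrib, ← h t]
    refine Finset.sum_congr rfl fun i _ => ?_
    rw [← sub_mul, Real.coe_toNNReal', Real.coe_toNNReal', max_zero_sub_max_neg_zero_eq_self]
  have hint : ∀ d : ι → ℝ, ∫ t, φ t ∂(∑ i, (d i).toNNReal • ν i)
      = ∑ i, (d i).toNNReal * ∫ t, φ t ∂(ν i) := by
    intro d
    rw [integral_finsetSum_measure fun i _ => (hi i).smul_measure_nnreal]
    refine Finset.sum_congr rfl fun i _ => ?_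
    rw [integral_smul_nnreal_measure]
    rfl
  have h2 := congrArg (fun m => ∫ t, φ t ∂m) hm
  simp only [hint] at h2
  rw [← sub_eq_zero, ← Finset.sum_sub_distrib] at h2
  rw [← h2]
  refine Finset.sum_congr rfl fun i _ => ?_
  rw [← sub_mul, Real.coe_toNNReal', Real.coe_toNNReal', max_zero_sub_max_neg_zero_eq_self]

lemma integrable_of_abs_le {ν : Measure ℝ} [IsFiniteMeasure ν] {φ : ℝ → ℝ} (hφ : Measurable φ)
    {C : ℝ} (hC : ∀ t, |φ t| ≤ C) : Integrable φ ν :=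
  Integrable.of_bound hφ.aestronglyMeasurable C (Eventually.of_forall hC)

/-! ### Projections and scalar measures of a spectral family -/

section Spectral

variable {E : Type*} [NormedAddCommGroup E] [InnerProductSpace ℂ E] [CompleteSpace E]

lemma re_inner_eq_quarter (u v : E) :
    (inner ℂ u v).re = (‖u + v‖ ^ 2 - ‖u - v‖ ^ 2) / 4 := by
  have h1 := norm_add_sq (𝕜 := ℂ) u v
  have h2 := norm_sub_sq (𝕜 := ℂ) u v
  simp only [RCLike.re_to_complex] at h1 h2
  linarith

lemma re_inner_I_smul (u v : E) : (inner ℂ (Complex.I • u) v).re = (inner ℂ u v).im := by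
  simp

namespace IsSpectralFamily

variable {P : ℝ → E →L[ℂ] E}



lemma proj_symm (hP : IsSpectralFamily P) (t : ℝ) (f g : E) : inner ℂ (P t f) g = inner ℂ f (P t g) := by
  have h := (hP.isStarProjection t).isSelfAdjoint
  rw [ContinuousLinearMap.isSelfAdjoint_iff'] at h
  conv_rhs => rw [← h]
  rw [ContinuousLinearMap.adjoint_inner_right]

lemma proj_proj_of_le (hP : IsSpectralFamily P) {s t : ℝ} (h : s ≤ t) (f : E) : P s (P t f) = P s f :=
  congrArg (fun T => T f) (hP.mono s t h)

lemma proj_proj_of_ge (hP : IsSpectralFamily P) {s t : ℝ} (h : t ≤ s) (f : E) : P s (P t f) = P t f := by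
  refine ext_inner_left ℂ fun g => ?_
  rw [← hP.proj_symm, ← hP.proj_symm, hP.proj_proj_of_le h, hP.proj_symm]

lemma proj_proj (hP : IsSpectralFamily P) (s t : ℝ) (f : E) : P s (P t f) = P (min s t) f := by
  rcases le_total s t with h | h
  · rw [min_eq_left h, hP.proj_proj_of_le h]
  · rw [min_eq_right h, hP.proj_proj_of_ge h]

lemma inner_proj (hP : IsSpectralFamily P) (t : ℝ) (f : E) : inner ℂ f (P t f) = ((‖P t f‖ ^ 2 : ℝ) : ℂ) := by
  rw [← hP.proj_proj_of_le le_rfl f, ← hP.proj_symm, inner_self_eq_norm_sq_to_K,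
    hP.proj_proj_of_le le_rfl]
  norm_cast

lemma inner_proj_proj (hP : IsSpectralFamily P) (s t : ℝ) (f g : E) :
    inner ℂ (P s f) (P t g) = inner ℂ f (P (min s t) g) := by
  rw [hP.proj_symm, hP.proj_proj]

lemma norm_proj_le (hP : IsSpectralFamily P) (t : ℝ) (f : E) : ‖P t f‖ ≤ ‖f‖ := by
  have h := (inner_proj hP t f)
  have h2 := norm_inner_le_norm (𝕜 := ℂ) f (P t f)
  rw [h, Complex.norm_real, Real.norm_of_nonneg (by positivity), sq] at h2
  by_contra hc
  push Not at hc
  nlinarith [norm_nonneg f]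

lemma monotone_norm_sq (hP : IsSpectralFamily P) (f : E) : Monotone fun t => ‖P t f‖ ^ 2 := by
  intro s t h
  simp only
  rw [← hP.proj_proj_of_le h]
  have := hP.norm_proj_le s (P t f)
  gcongr

/-- Right continuity of the family makes the right-continuous regularization in `stieltjesMeasure`
harmless, so that `]-∞, t]` receives exactly the mass `‖P t f‖ ^ 2`. -/
lemma rightLim_norm_sq (hP : IsSpectralFamily P) (f : E) (t : ℝ) :
    Function.rightLim (fun t => ‖P t f‖ ^ 2) t = ‖P t f‖ ^ 2 := by
  refine rightLim_eq_of_tendsto ?_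
  have h := ((hP.rightCont t f).mono Ioi_subset_Ici_self).norm.pow 2
  exact h

lemma stieltjesFunction_apply (hP : IsSpectralFamily P) (f : E) (t : ℝ) :
    (hP.monotone_norm_sq f).stieltjesFunction t = ‖P t f‖ ^ 2 := by
  rw [Monotone.stieltjesFunction_eq, hP.rightLim_norm_sq]

lemma scalarMeasure_eq (hP : IsSpectralFamily P) (f : E) :
    scalarMeasure P f = (hP.monotone_norm_sq f).stieltjesFunction.measure := by
  rw [scalarMeasure, stieltjesMeasure, dif_pos (hP.monotone_norm_sq f)]

lemma tendsto_norm_sq_atBot (hP : IsSpectralFamily P) (f : E) : Tendsto (fun t => ‖P t f‖ ^ 2) atBot (𝓝 0) := by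
  simpa using (hP.tendsto_atBot f).norm.pow 2

lemma tendsto_norm_sq_atTop (hP : IsSpectralFamily P) (f : E) : Tendsto (fun t => ‖P t f‖ ^ 2) atTop (𝓝 (‖f‖ ^ 2)) :=
  (hP.tendsto_atTop f).norm.pow 2

lemma tendsto_stieltjes_iff (hP : IsSpectralFamily P) (f : E) (l l' : Filter ℝ) :
    Tendsto (hP.monotone_norm_sq f).stieltjesFunction l l' ↔ Tendsto (fun t => ‖P t f‖ ^ 2) l l' := by
  have : ((hP.monotone_norm_sq f).stieltjesFunction : ℝ → ℝ) = fun t => ‖P t f‖ ^ 2 :=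
    funext (hP.stieltjesFunction_apply f)
  rw [this]

lemma scalarMeasure_Iic (hP : IsSpectralFamily P) (f : E) (t : ℝ) :
    scalarMeasure P f (Iic t) = ENNReal.ofReal (‖P t f‖ ^ 2) := by
  rw [hP.scalarMeasure_eq, StieltjesFunction.measure_Iic (l := 0), hP.stieltjesFunction_apply,
    sub_zero]
  exact (hP.tendsto_stieltjes_iff f _ _).2 <| hP.tendsto_norm_sq_atBot f

lemma scalarMeasure_univ (hP : IsSpectralFamily P) (f : E) :
    scalarMeasure P f univ = ENNReal.ofReal (‖f‖ ^ 2) := by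
  rw [hP.scalarMeasure_eq, StieltjesFunction.measure_univ (l := 0) (u := ‖f‖ ^ 2), sub_zero]
  · exact (hP.tendsto_stieltjes_iff f _ _).2 <| hP.tendsto_norm_sq_atBot f
  · exact (hP.tendsto_stieltjes_iff f _ _).2 <| hP.tendsto_norm_sq_atTop f

lemma isFiniteMeasure (hP : IsSpectralFamily P) (f : E) : IsFiniteMeasure (scalarMeasure P f) :=
  ⟨by rw [hP.scalarMeasure_univ]; exact ENNReal.ofReal_lt_top⟩

lemma real_Iic (hP : IsSpectralFamily P) (f : E) (t : ℝ) : (scalarMeasure P f).real (Iic t) = ‖P t f‖ ^ 2 := by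
  rw [measureReal_def, hP.scalarMeasure_Iic, ENNReal.toReal_ofReal (by positivity)]

lemma real_univ (hP : IsSpectralFamily P) (f : E) : (scalarMeasure P f).real univ = ‖f‖ ^ 2 := by
  rw [measureReal_def, hP.scalarMeasure_univ, ENNReal.toReal_ofReal (by positivity)]

lemma scalarMeasure_Ioi (hP : IsSpectralFamily P) (f : E) (t : ℝ) :
    scalarMeasure P f (Ioi t) = ENNReal.ofReal (‖f - P t f‖ ^ 2) := by
  have := hP.isFiniteMeasure f
  rw [← compl_Iic, measure_compl measurableSet_Iic (measure_ne_top _ _), hP.scalarMeasure_univ,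
    hP.scalarMeasure_Iic, ← ENNReal.ofReal_sub _ (by positivity)]
  congr 1
  have h := norm_sub_sq (𝕜 := ℂ) f (P t f)
  rw [hP.inner_proj] at h
  simp only [RCLike.re_to_complex, Complex.ofReal_re] at h
  linarith

/-- Linear relations between the scalar measures of vectors, in polarized form. -/
lemma sum_polar_eq_zero (hP : IsSpectralFamily P) {ι : Type*} [Fintype ι] (a : ι → ℝ) (y x : ι → E)
    (h : ∀ t, ∑ i, a i * (inner ℂ (P t (y i)) (P t (x i))).re = 0)
    {φ : ℝ → ℝ} (hφ : Measurable φ) {C : ℝ} (hC : ∀ t, |φ t| ≤ C) :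
    ∑ i, a i * (∫ t, φ t ∂(scalarMeasure P (y i + x i))
      - ∫ t, φ t ∂(scalarMeasure P (y i - x i))) = 0 := by
  have hfin := hP.isFiniteMeasure
  have := sum_mul_integral_eq_zero (ι := ι ⊕ ι) (Sum.elim a fun i => -a i)
    (fun k => scalarMeasure P (Sum.elim (fun i => y i + x i) (fun i => y i - x i) k)) (φ := φ)
    (fun t => ?_) (fun i => integrable_of_abs_le hφ hC)
  · rw [Fintype.sum_sum_type] at this
    simp only [Sum.elim_inl, Sum.elim_inr] at this
    rw [← this, ← Finset.sum_add_distrib]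
    exact Finset.sum_congr rfl fun i _ => by ring
  · rw [Fintype.sum_sum_type]
    simp only [Sum.elim_inl, Sum.elim_inr, hP.real_Iic]
    rw [← Finset.sum_add_distrib]
    have h4 : ∑ i, a i * (inner ℂ (P t (y i)) (P t (x i))).re * 4 = 0 := by
      rw [← Finset.sum_mul, h t, zero_mul]
    rw [← h4]
    refine Finset.sum_congr rfl fun i _ => ?_
    rw [re_inner_eq_quarter, map_add, map_sub]
    ring

end IsSpectralFamily
end Spectral

/-! ## Bounded Borel functional calculus of a spectral family -/

section Spectral

variable {E : Type*} [NormedAddCommGroup E] [InnerProductSpace ℂ E] [CompleteSpace E]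

/-- The bounded measurable functions on the line. -/
def IsBddMeas (φ : ℝ → ℝ) : Prop := Measurable φ ∧ ∃ C, ∀ t, |φ t| ≤ C

/-- The real part of the sesquilinear form `⟨y, φ(P) x⟩`. -/
def polarForm (P : ℝ → E →L[ℂ] E) (φ : ℝ → ℝ) (y x : E) : ℝ :=
  (∫ t, φ t ∂(scalarMeasure P (y + x)) - ∫ t, φ t ∂(scalarMeasure P (y - x))) / 4

/-- A bounded operator with quadratic form `∫ φ d⟨P_t f, f⟩`, for `φ` bounded and measurable. -/
def borelCalc (P : ℝ → E →L[ℂ] E) (φ : ℝ → ℝ) : E →L[ℂ] E :=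
  open Classical in
  if h : ∃ T : E →L[ℂ] E, ∀ f, inner ℂ f (T f) = ((∫ t, φ t ∂(scalarMeasure P f) : ℝ) : ℂ)
  then h.choose else 0

namespace IsSpectralFamily

variable {P : ℝ → E →L[ℂ] E}

/-- Source of all the algebra of `polarForm`: a real linear identity has to be checked only for the
forms `Re ⟨P_t y, P_t x⟩`, where it is an identity of inner products. -/
lemma sum_polarForm_eq_zero (hP : IsSpectralFamily P) {ι : Type*} [Fintype ι] (a : ι → ℝ)
    (y x : ι → E) (h : ∀ t, ∑ i, a i * (inner ℂ (P t (y i)) (P t (x i))).re = 0)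
    {φ : ℝ → ℝ} (hφ : IsBddMeas φ) : ∑ i, a i * polarForm P φ (y i) (x i) = 0 := by
  obtain ⟨hm, C, hC⟩ := hφ
  have h4 := hP.sum_polar_eq_zero a y x h hm hC
  have h5 : (∑ i, a i * polarForm P φ (y i) (x i)) * 4 = 0 := by
    rw [← h4, Finset.sum_mul]
    refine Finset.sum_congr rfl fun i _ => ?_
    rw [polarForm]
    ring
  linarith

lemma abs_integral_le (hP : IsSpectralFamily P) {φ : ℝ → ℝ} {C : ℝ} (hC : ∀ t, |φ t| ≤ C) (f : E) :
    |∫ t, φ t ∂(scalarMeasure P f)| ≤ C * ‖f‖ ^ 2 := by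
  have := hP.isFiniteMeasure f
  have h := norm_integral_le_of_norm_le_const (μ := scalarMeasure P f) 
    (f := φ) (C := C) (Eventually.of_forall hC)
  rwa [hP.real_univ, Real.norm_eq_abs] at h

lemma abs_polarForm_le (hP : IsSpectralFamily P) {φ : ℝ → ℝ} {C : ℝ} (hC : ∀ t, |φ t| ≤ C)
    (y x : E) : |polarForm P φ y x| ≤ C / 2 * (‖y‖ ^ 2 + ‖x‖ ^ 2) := by
  have h1 := abs_le.1 (hP.abs_integral_le hC (y + x))
  have h2 := abs_le.1 (hP.abs_integral_le hC (y - x))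
  have h3 := parallelogram_law_with_norm ℂ y x
  have h4 : C * ‖y + x‖ ^ 2 + C * ‖y - x‖ ^ 2 = 2 * C * (‖y‖ ^ 2 + ‖x‖ ^ 2) := by
    rw [← mul_add, h3]; ring
  rw [polarForm, abs_le]
  constructor <;> linarith

lemma polarForm_add_right (hP : IsSpectralFamily P) {φ : ℝ → ℝ} (hφ : IsBddMeas φ) (y x x' : E) :
    polarForm P φ y (x + x') = polarForm P φ y x + polarForm P φ y x' := by
  have := hP.sum_polarForm_eq_zero ![1, -1, -1] ![y, y, y] ![x + x', x, x'] (fun t => by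
    simp [Fin.sum_univ_succ]; ring) hφ
  simp [Fin.sum_univ_succ] at this
  linarith

lemma polarForm_add_left (hP : IsSpectralFamily P) {φ : ℝ → ℝ} (hφ : IsBddMeas φ) (y y' x : E) :
    polarForm P φ (y + y') x = polarForm P φ y x + polarForm P φ y' x := by
  have := hP.sum_polarForm_eq_zero ![1, -1, -1] ![y + y', y, y'] ![x, x, x] (fun t => by
    simp [Fin.sum_univ_succ]; ring) hφ
  simp [Fin.sum_univ_succ] at this
  linarith

/-- Imaginary parts are encoded by `Re ⟨I • y, x⟩ = Im ⟨y, x⟩`, the inner product being conjugate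
linear on the left. -/
lemma polarForm_smul_right (hP : IsSpectralFamily P) {φ : ℝ → ℝ} (hφ : IsBddMeas φ) (c : ℂ)
    (y x : E) : polarForm P φ y (c • x)
      = c.re * polarForm P φ y x - c.im * polarForm P φ (Complex.I • y) x := by
  have := hP.sum_polarForm_eq_zero ![1, -c.re, c.im] ![y, y, Complex.I • y] ![c • x, x, x]
    (fun t => by
      simp [Fin.sum_univ_succ]) hφ
  simp [Fin.sum_univ_succ] at this
  linarith

lemma polarForm_smul_left (hP : IsSpectralFamily P) {φ : ℝ → ℝ} (hφ : IsBddMeas φ) (c : ℂ)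
    (y x : E) : polarForm P φ (c • y) x
      = c.re * polarForm P φ y x + c.im * polarForm P φ (Complex.I • y) x := by
  have := hP.sum_polarForm_eq_zero ![1, -c.re, -c.im] ![c • y, y, Complex.I • y] ![x, x, x]
    (fun t => by
      simp [Fin.sum_univ_succ]; ring) hφ
  simp [Fin.sum_univ_succ] at this
  linarith

lemma polarForm_self (hP : IsSpectralFamily P) {φ : ℝ → ℝ} (hφ : IsBddMeas φ) (x : E) :
    polarForm P φ x x = ∫ t, φ t ∂(scalarMeasure P x) := by
  have hfin := hP.isFiniteMeasure
  obtain ⟨hm, C, hC⟩ := hφ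
  have := sum_mul_integral_eq_zero ![1, -1, -4]
    (fun k : Fin 3 => scalarMeasure P (![x + x, x - x, x] k)) (φ := φ)
    (fun t => ?_) (fun i => integrable_of_abs_le hm hC)
  · simp [Fin.sum_univ_succ] at this
    rw [polarForm, sub_self]
    linarith
  · simp only [hP.real_Iic]
    simp [Fin.sum_univ_succ, ← two_smul ℂ (P t x), norm_smul]
    ring

lemma polarForm_I_self (hP : IsSpectralFamily P) {φ : ℝ → ℝ} (hφ : IsBddMeas φ) (x : E) :
    polarForm P φ (Complex.I • x) x = 0 := by
  have := hP.sum_polarForm_eq_zero ![1] ![Complex.I • x] ![x] (fun t => by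
    simp [← Complex.ofReal_pow]) hφ
  simpa using this

/-- The sesquilinear form with real part `polarForm P φ y x` and imaginary part `polarForm P φ (I •
y) x` is bounded, and the Riesz representation theorem yields the operator. -/
lemma exists_calc (hP : IsSpectralFamily P) {φ : ℝ → ℝ} (hφ : IsBddMeas φ) :
    ∃ T : E →L[ℂ] E, ∀ f, inner ℂ f (T f) = ((∫ t, φ t ∂(scalarMeasure P f) : ℝ) : ℂ) := by
  obtain ⟨C, hC⟩ := hφ.2
  have hC0 : 0 ≤ C := (abs_nonneg _).trans (hC 0)
  have hII : ∀ y : E, Complex.I • Complex.I • y = -y := fun y => by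
    rw [smul_smul, Complex.I_mul_I, neg_one_smul]
  have hneg : ∀ y x, polarForm P φ (-y) x = -polarForm P φ y x := fun y x => by
    have := hP.polarForm_smul_left hφ (-1) y x
    simpa using this
  let B : E →ₗ⋆[ℂ] E →ₗ[ℂ] ℂ := LinearMap.mk₂'ₛₗ (starRingEnd ℂ) (RingHom.id ℂ)
    (fun y x => (⟨polarForm P φ y x, polarForm P φ (Complex.I • y) x⟩ : ℂ))
    (fun y y' x => by
      apply Complex.ext
      · simp [hP.polarForm_add_left hφ]
      · simp [hP.polarForm_add_left hφ])
    (fun c y x => by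
      apply Complex.ext
      · simp [hP.polarForm_smul_left hφ c]
      · simp only [smul_comm Complex.I c y, hP.polarForm_smul_left hφ c, hII, hneg]
        simp)
    (fun y x x' => by
      apply Complex.ext
      · simp [hP.polarForm_add_right hφ]
      · simp [hP.polarForm_add_right hφ])
    (fun c y x => by
      apply Complex.ext
      · simp [hP.polarForm_smul_right hφ c]
      · simp only [hP.polarForm_smul_right hφ c, hII, hneg]
        simp)
  have hB0 : ∀ y x, ‖B y x‖ ≤ C * (‖y‖ ^ 2 + ‖x‖ ^ 2) := by
    intro y x
    refine (Complex.norm_le_abs_re_add_abs_im _).trans ?_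
    have h1 := hP.abs_polarForm_le hC y x
    have h2 := hP.abs_polarForm_le hC (Complex.I • y) x
    rw [norm_smul, Complex.norm_I, one_mul] at h2
    change |polarForm P φ y x| + |polarForm P φ (Complex.I • y) x| ≤ _
    linarith
  have hB : ∀ y x, ‖B y x‖ ≤ 2 * C * ‖y‖ * ‖x‖ := by
    intro y x
    rcases eq_or_ne y 0 with rfl | hy
    · simp
    rcases eq_or_ne x 0 with rfl | hx
    · simp
    have hy' := norm_pos_iff.2 hy
    have hx' := norm_pos_iff.2 hx
    -- The bound by a sum of squares, applied to unit vectors, becomes a bound by the product of the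
    -- norms.
    have h := hB0 (((‖y‖⁻¹ : ℝ) : ℂ) • y) (((‖x‖⁻¹ : ℝ) : ℂ) • x)
    rw [map_smulₛₗ, map_smulₛₗ, LinearMap.smul_apply, RingHom.id_apply, norm_smul, norm_smul, norm_smul, norm_smul,
      RCLike.norm_conj, Complex.norm_real, Complex.norm_real, norm_inv, norm_inv, norm_norm,
      norm_norm, inv_mul_cancel₀ hy'.ne', inv_mul_cancel₀ hx'.ne'] at h
    have h3 : ‖B y x‖ = ‖y‖ * ‖x‖ * (‖x‖⁻¹ * (‖y‖⁻¹ * ‖B y x‖)) := by field_simp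
    rw [h3]
    calc ‖y‖ * ‖x‖ * (‖x‖⁻¹ * (‖y‖⁻¹ * ‖B y x‖)) ≤ ‖y‖ * ‖x‖ * (C * (1 ^ 2 + 1 ^ 2)) := by gcongr
      _ = _ := by ring
  refine ⟨InnerProductSpace.continuousLinearMapOfBilin (B.mkContinuous₂ (2 * C) hB), fun f => ?_⟩
  rw [← inner_conj_symm, InnerProductSpace.continuousLinearMapOfBilin_apply,
    LinearMap.mkContinuous₂_apply]
  change (starRingEnd ℂ) (⟨polarForm P φ f f, polarForm P φ (Complex.I • f) f⟩ : ℂ) = _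
  rw [hP.polarForm_self hφ, hP.polarForm_I_self hφ]
  apply Complex.ext <;> simp

lemma inner_calc_self (hP : IsSpectralFamily P) {φ : ℝ → ℝ} (hφ : IsBddMeas φ) (f : E) :
    inner ℂ f (borelCalc P φ f) = ((∫ t, φ t ∂(scalarMeasure P f) : ℝ) : ℂ) := by
  have h := hP.exists_calc hφ
  rw [borelCalc, dif_pos h]
  exact h.choose_spec f

end IsSpectralFamily
end Spectral

/-! ### Bounded measurable functions -/

namespace IsBddMeas

variable {φ ψ : ℝ → ℝ}

lemma const (c : ℝ) : IsBddMeas fun _ => c := ⟨measurable_const, |c|, fun _ => le_rfl⟩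

lemma mul (hφ : IsBddMeas φ) (hψ : IsBddMeas ψ) : IsBddMeas fun t => φ t * ψ t := by
  obtain ⟨h1, C, hC⟩ := hφ
  obtain ⟨h2, D, hD⟩ := hψ
  refine ⟨h1.mul h2, C * D, fun t => ?_⟩
  rw [abs_mul]
  exact mul_le_mul (hC t) (hD t) (abs_nonneg _) ((abs_nonneg _).trans (hC t))

lemma sub (hφ : IsBddMeas φ) (hψ : IsBddMeas ψ) : IsBddMeas fun t => φ t - ψ t := by
  obtain ⟨h1, C, hC⟩ := hφ
  obtain ⟨h2, D, hD⟩ := hψ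
  exact ⟨h1.sub h2, C + D, fun t => (abs_sub _ _).trans (add_le_add (hC t) (hD t))⟩

lemma indicator (hφ : IsBddMeas φ) {s : Set ℝ} (hs : MeasurableSet s) :
    IsBddMeas (s.indicator φ) := by
  obtain ⟨h1, C, hC⟩ := hφ
  refine ⟨h1.indicator hs, C, fun t => ?_⟩
  by_cases h : t ∈ s
  · simpa [h] using hC t
  · simpa [h] using (abs_nonneg _).trans (hC t)

lemma indicator_one {s : Set ℝ} (hs : MeasurableSet s) :
    IsBddMeas (s.indicator fun _ => 1) := (const 1).indicator hs

lemma integrable (hφ : IsBddMeas φ) (ν : Measure ℝ) [IsFiniteMeasure ν] : Integrable φ ν := by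
  obtain ⟨h1, C, hC⟩ := hφ
  exact integrable_of_abs_le h1 hC

lemma neg (hφ : IsBddMeas φ) : IsBddMeas fun t => -φ t := by
  obtain ⟨h1, C, hC⟩ := hφ
  exact ⟨h1.neg, C, fun t => by rw [abs_neg]; exact hC t⟩

lemma isFiniteMeasure_withDensity (hφ : IsBddMeas φ) (ν : Measure ℝ) [IsFiniteMeasure ν] :
    IsFiniteMeasure (ν.withDensity fun t => ENNReal.ofReal (φ t)) := by
  refine isFiniteMeasure_withDensity_ofReal ?_
  exact (hφ.integrable ν).hasFiniteIntegral

/-- A signed density `ψ` is treated as the difference of the positive measures with densities `ψ⁺`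
and `ψ⁻`, so that `sum_mul_integral_eq_zero` applies to it. -/
lemma integral_withDensity_sub (hφ : IsBddMeas φ) (hψ : IsBddMeas ψ) (ν : Measure ℝ)
    [IsFiniteMeasure ν] :
    ∫ t, φ t ∂(ν.withDensity fun t => ENNReal.ofReal (ψ t))
      - ∫ t, φ t ∂(ν.withDensity fun t => ENNReal.ofReal (-ψ t)) = ∫ t, φ t * ψ t ∂ν := by
  have key : ∀ χ : ℝ → ℝ, Measurable χ → ∫ t, φ t ∂(ν.withDensity fun t => ENNReal.ofReal (χ t))
      = ∫ t, max (χ t) 0 * φ t ∂ν := by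
    intro χ hχ
    rw [integral_withDensity_eq_integral_toReal_smul hχ.ennreal_ofReal
      (Eventually.of_forall fun _ => ENNReal.ofReal_lt_top)]
    refine integral_congr_ae (Eventually.of_forall fun t => ?_)
    simp only [ENNReal.toReal_ofReal', smul_eq_mul]
  have hmax : ∀ {χ : ℝ → ℝ}, IsBddMeas χ → IsBddMeas fun t => max (χ t) 0 := by
    rintro χ ⟨h1, C, hC⟩
    refine ⟨h1.max measurable_const, C, fun t => ?_⟩
    have := hC t
    rw [abs_of_nonneg (le_max_right _ _)]
    exact max_le ((le_abs_self _).trans this) ((abs_nonneg _).trans this)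
  rw [key ψ hψ.1, key (fun t => -ψ t) hψ.1.neg, ← integral_sub (((hmax hψ).mul hφ).integrable ν)
    (((hmax hψ.neg).mul hφ).integrable ν)]
  refine integral_congr_ae (Eventually.of_forall fun t => ?_)
  simp only
  rw [← sub_mul, max_zero_sub_max_neg_zero_eq_self, mul_comm]

end IsBddMeas

/-! ### Multiplicativity of the bounded calculus -/

section Spectral

variable {E : Type*} [NormedAddCommGroup E] [InnerProductSpace ℂ E] [CompleteSpace E]

lemma clm_ext_of_inner_self {S T : E →L[ℂ] E} (h : ∀ f, inner ℂ f (S f) = inner ℂ f (T f)) :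
    S = T := by
  have := (ext_inner_map (S : E →ₗ[ℂ] E) (T : E →ₗ[ℂ] E)).1 fun f => by
    have h2 := congrArg (starRingEnd ℂ) (h f)
    rwa [inner_conj_symm, inner_conj_symm] at h2
  exact ContinuousLinearMap.coe_injective this

namespace IsSpectralFamily

variable {P : ℝ → E →L[ℂ] E} {φ ψ : ℝ → ℝ}

lemma calc_symm (hP : IsSpectralFamily P) (hφ : IsBddMeas φ) (f g : E) :
    inner ℂ (borelCalc P φ f) g = inner ℂ f (borelCalc P φ g) := by
  have h : LinearMap.IsSymmetric (borelCalc P φ : E →ₗ[ℂ] E) := by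
    rw [LinearMap.isSymmetric_iff_inner_map_self_real]
    intro v
    rw [inner_conj_symm]
    have h2 := hP.inner_calc_self hφ v
    rw [ContinuousLinearMap.coe_coe, ← inner_conj_symm (borelCalc P φ v) v, h2, Complex.conj_ofReal]
  exact h f g

lemma re_inner_calc (hP : IsSpectralFamily P) (hφ : IsBddMeas φ) (g f : E) :
    (inner ℂ g (borelCalc P φ f)).re = polarForm P φ g f := by
  have h1 := congrArg Complex.re (hP.inner_calc_self hφ (g + f))
  have h2 := congrArg Complex.re (hP.inner_calc_self hφ (g - f))
  have h3 : (inner ℂ f (borelCalc P φ g)).re = (inner ℂ g (borelCalc P φ f)).re := by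
    rw [← hP.calc_symm hφ, ← inner_conj_symm, Complex.conj_re]
  simp only [map_add, map_sub, inner_add_left, inner_add_right, inner_sub_left, inner_sub_right,
    Complex.add_re, Complex.sub_re, Complex.ofReal_re] at h1 h2
  rw [polarForm]
  linarith

lemma im_inner_calc (hP : IsSpectralFamily P) (hφ : IsBddMeas φ) (g f : E) :
    (inner ℂ g (borelCalc P φ f)).im = polarForm P φ (Complex.I • g) f := by
  rw [← hP.re_inner_calc hφ, re_inner_I_smul]

lemma calc_indicator_Iic (hP : IsSpectralFamily P) (t : ℝ) :
    borelCalc P ((Iic t).indicator fun _ => 1) = P t := by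
  refine clm_ext_of_inner_self fun f => ?_
  rw [hP.inner_calc_self (IsBddMeas.indicator_one measurableSet_Iic), hP.inner_proj,
    integral_indicator_const _ measurableSet_Iic, hP.real_Iic, smul_eq_mul, mul_one]

lemma calc_one (hP : IsSpectralFamily P) : borelCalc P (fun _ => 1) = 1 := by
  refine clm_ext_of_inner_self fun f => ?_
  rw [hP.inner_calc_self (IsBddMeas.const 1), integral_const, hP.real_univ]
  simp

/-- Multiplicativity when one factor is `P t`: the polarized measure of `f` and `P t f` is the
restriction of `m_f` to `]-∞, t]`, because `Re ⟨P_s f, P_s P_t f⟩ = ‖P_{min s t} f‖²`. -/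
lemma inner_calc_proj (hP : IsSpectralFamily P) (hψ : IsBddMeas ψ) (f : E) (t : ℝ) :
    inner ℂ f (borelCalc P ψ (P t f)) = ((∫ s in Iic t, ψ s ∂(scalarMeasure P f) : ℝ) : ℂ) := by
  have hfin := hP.isFiniteMeasure
  apply Complex.ext
  · rw [hP.re_inner_calc hψ, Complex.ofReal_re, polarForm]
    have := sum_mul_integral_eq_zero ![1, -1, -4]
      ![scalarMeasure P (f + P t f), scalarMeasure P (f - P t f), (scalarMeasure P f).restrict (Iic t)]
      (φ := ψ) (hν := fun i => by fin_cases i <;> dsimp <;> infer_instance) (fun s => ?_)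
      (fun i => by fin_cases i <;> dsimp <;> exact hψ.integrable _)
    · simp [Fin.sum_univ_succ] at this
      linarith
    · simp only [Fin.sum_univ_succ, Fin.isValue, Matrix.cons_val_zero, Matrix.cons_val_succ,
        Finset.univ_eq_empty, Finset.sum_empty, hP.real_Iic]
      have h := re_inner_eq_quarter (P s f) (P s (P t f))
      rw [hP.proj_symm, hP.proj_proj_of_le le_rfl, hP.proj_proj, hP.inner_proj, Complex.ofReal_re] at h
      rw [measureReal_restrict_apply measurableSet_Iic, Iic_inter_Iic, hP.real_Iic, map_add, map_sub,
        hP.proj_proj]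
      linarith
  · rw [hP.im_inner_calc hψ, Complex.ofReal_im]
    have := hP.sum_polarForm_eq_zero ![1] ![Complex.I • f] ![P t f] (fun s => by
      simp [hP.inner_proj_proj, hP.proj_proj, hP.inner_proj]
      rw [← Complex.ofReal_pow, Complex.ofReal_im]) hψ
    simpa using this

lemma inner_proj_calc (hP : IsSpectralFamily P) (hψ : IsBddMeas ψ) (f : E) (t : ℝ) :
    inner ℂ (P t f) (P t (borelCalc P ψ f))
      = ((∫ s in Iic t, ψ s ∂(scalarMeasure P f) : ℝ) : ℂ) := by
  rw [← hP.proj_symm, hP.proj_proj_of_le le_rfl, ← hP.calc_symm hψ, ← inner_conj_symm,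
    hP.inner_calc_proj hψ, Complex.conj_ofReal]

/-- By `inner_proj_calc` the polarized measure of `f` and `ψ(P) f` has density `ψ` with respect to
`m_f`; integrating `φ` against it gives `∫ φ ψ dm_f`. The coefficients `±4` are those of the
polarization identity. -/
lemma calc_calc (hP : IsSpectralFamily P) (hφ : IsBddMeas φ) (hψ : IsBddMeas ψ) (f : E) :
    borelCalc P φ (borelCalc P ψ f) = borelCalc P (fun t => φ t * ψ t) f := by
  have hfin := hP.isFiniteMeasure
  suffices h : borelCalc P φ * borelCalc P ψ = borelCalc P (fun t => φ t * ψ t) from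
    congrArg (fun T => T f) h
  refine clm_ext_of_inner_self fun f => ?_
  rw [hP.inner_calc_self (hφ.mul hψ), mul_apply_eq_comp]
  apply Complex.ext
  · rw [hP.re_inner_calc hφ, Complex.ofReal_re, polarForm]
    have hf1 := hψ.isFiniteMeasure_withDensity (scalarMeasure P f)
    have hf2 := hψ.neg.isFiniteMeasure_withDensity (scalarMeasure P f)
    have := sum_mul_integral_eq_zero ![1, -1, -4, 4]
      ![scalarMeasure P (f + borelCalc P ψ f), scalarMeasure P (f - borelCalc P ψ f),
        (scalarMeasure P f).withDensity fun t => ENNReal.ofReal (ψ t),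
        (scalarMeasure P f).withDensity fun t => ENNReal.ofReal (-ψ t)]
      (φ := φ) (hν := fun i => by fin_cases i <;> dsimp <;> infer_instance) (fun s => ?_)
      (fun i => by fin_cases i <;> dsimp <;> exact hφ.integrable _)
    · simp [Fin.sum_univ_succ] at this
      rw [← hφ.integral_withDensity_sub hψ]
      linarith
    · simp only [Fin.sum_univ_succ, Fin.isValue, Matrix.cons_val_zero, Matrix.cons_val_succ,
        Finset.univ_eq_empty, Finset.sum_empty, hP.real_Iic]
      have h := re_inner_eq_quarter (P s f) (P s (borelCalc P ψ f))
      rw [hP.inner_proj_calc hψ, Complex.ofReal_re] at h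
      have h2 := (IsBddMeas.indicator_one (measurableSet_Iic (a := s))).integral_withDensity_sub hψ
        (scalarMeasure P f)
      rw [integral_indicator_const _ measurableSet_Iic, integral_indicator_const _ measurableSet_Iic,
        smul_eq_mul, mul_one, smul_eq_mul, mul_one] at h2
      have h3 : (fun t => (Iic s).indicator (fun _ => (1 : ℝ)) t * ψ t) = (Iic s).indicator ψ := by
        ext t
        by_cases h : t ∈ Iic s <;> simp [h]
      rw [h3, integral_indicator measurableSet_Iic] at h2
      rw [map_add, map_sub]
      linarith
  · rw [hP.im_inner_calc hφ, Complex.ofReal_im]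
    have := hP.sum_polarForm_eq_zero ![1] ![Complex.I • f] ![borelCalc P ψ f] (fun s => by
      simp [hP.inner_proj_calc hψ]) hφ
    simpa using this

lemma proj_calc (hP : IsSpectralFamily P) (hφ : IsBddMeas φ) (t : ℝ) (f : E) :
    P t (borelCalc P φ f) = borelCalc P ((Iic t).indicator φ) f := by
  rw [← hP.calc_indicator_Iic t, hP.calc_calc (IsBddMeas.indicator_one measurableSet_Iic) hφ]
  congr 2
  ext s
  by_cases h : s ∈ Iic t <;> simp [h]

lemma calc_sub (hP : IsSpectralFamily P) (hφ : IsBddMeas φ) (hψ : IsBddMeas ψ) :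
    borelCalc P (fun t => φ t - ψ t) = borelCalc P φ - borelCalc P ψ := by
  have hfin := hP.isFiniteMeasure
  refine clm_ext_of_inner_self fun f => ?_
  rw [hP.inner_calc_self (hφ.sub hψ), sub_apply, inner_sub_right,
    hP.inner_calc_self hφ, hP.inner_calc_self hψ, integral_sub (hφ.integrable _) (hψ.integrable _),
    Complex.ofReal_sub]

lemma norm_sq_calc (hP : IsSpectralFamily P) (hφ : IsBddMeas φ) (f : E) :
    ‖borelCalc P φ f‖ ^ 2 = ∫ t, φ t ^ 2 ∂(scalarMeasure P f) := by
  have h : inner ℂ (borelCalc P φ f) (borelCalc P φ f) = ((‖borelCalc P φ f‖ ^ 2 : ℝ) : ℂ) := by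
    rw [inner_self_eq_norm_sq_to_K]
    norm_cast
  rw [hP.calc_symm hφ, hP.calc_calc hφ hφ, hP.inner_calc_self (hφ.mul hφ)] at h
  simp only [sq (φ _)]
  exact_mod_cast h.symm

lemma enorm_sq_calc (hP : IsSpectralFamily P) (hφ : IsBddMeas φ) (f : E) :
    ‖borelCalc P φ f‖ₑ ^ 2 = ∫⁻ t, ENNReal.ofReal (φ t ^ 2) ∂(scalarMeasure P f) := by
  have hfin := hP.isFiniteMeasure
  rw [← ofReal_norm, ← ENNReal.ofReal_pow (norm_nonneg _), hP.norm_sq_calc hφ,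
    ofReal_integral_eq_lintegral_ofReal]
  · simpa only [sq] using (hφ.mul hφ).integrable _
  · exact Eventually.of_forall fun t => sq_nonneg _

lemma scalarMeasure_calc (hP : IsSpectralFamily P) (hφ : IsBddMeas φ) (f : E) :
    scalarMeasure P (borelCalc P φ f)
      = (scalarMeasure P f).withDensity fun t => ENNReal.ofReal (φ t ^ 2) := by
  have hfin := hP.isFiniteMeasure
  refine Measure.ext_of_Iic _ _ fun t => ?_
  rw [hP.scalarMeasure_Iic, hP.proj_calc hφ, ENNReal.ofReal_pow (norm_nonneg _), ofReal_norm,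
    hP.enorm_sq_calc (hφ.indicator measurableSet_Iic), withDensity_apply _ measurableSet_Iic,
    ← lintegral_indicator measurableSet_Iic]
  refine lintegral_congr fun s => ?_
  by_cases h : s ∈ Iic t <;> simp [h]

end IsSpectralFamily
end Spectral

/-! ## Unbounded functions of a spectral family -/

/-- The truncation of `φ` to `{|φ| ≤ n}`. -/
def trunc (φ : ℝ → ℝ) (n : ℕ) : ℝ → ℝ := {t | |φ t| ≤ n}.indicator φ

/-- The indicator function of `{|φ| ≤ n}`. -/
def truncOne (φ : ℝ → ℝ) (n : ℕ) : ℝ → ℝ := {t | |φ t| ≤ n}.indicator fun _ => 1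

section trunc

variable {φ : ℝ → ℝ}

lemma measurableSet_abs_le (hφ : Measurable φ) (n : ℕ) : MeasurableSet {t | |φ t| ≤ n} :=
  measurableSet_le hφ.abs measurable_const

lemma trunc_of_le {n : ℕ} {t : ℝ} (h : |φ t| ≤ n) : trunc φ n t = φ t :=
  indicator_of_mem (s := {t | |φ t| ≤ n}) h φ

lemma trunc_of_lt {n : ℕ} {t : ℝ} (h : n < |φ t|) : trunc φ n t = 0 :=
  indicator_of_notMem (s := {t | |φ t| ≤ n}) (not_le.2 h) φ

lemma truncOne_of_le {n : ℕ} {t : ℝ} (h : |φ t| ≤ n) : truncOne φ n t = 1 :=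
  indicator_of_mem (s := {t | |φ t| ≤ n}) h fun _ => 1

lemma truncOne_of_lt {n : ℕ} {t : ℝ} (h : n < |φ t|) : truncOne φ n t = 0 :=
  indicator_of_notMem (s := {t | |φ t| ≤ n}) (not_le.2 h) fun _ => 1

lemma isBddMeas_trunc (hφ : Measurable φ) (n : ℕ) : IsBddMeas (trunc φ n) := by
  refine ⟨hφ.indicator (measurableSet_abs_le hφ n), n, fun t => ?_⟩
  rcases le_or_gt |φ t| n with h | h
  · rwa [trunc_of_le h]
  · rw [trunc_of_lt h, abs_zero]
    positivity

lemma isBddMeas_truncOne (hφ : Measurable φ) (n : ℕ) : IsBddMeas (truncOne φ n) :=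
  IsBddMeas.indicator_one (measurableSet_abs_le hφ n)

lemma abs_trunc_le (n : ℕ) (t : ℝ) : |trunc φ n t| ≤ |φ t| := by
  rcases le_or_gt |φ t| n with h | h
  · rw [trunc_of_le h]
  · rw [trunc_of_lt h, abs_zero]
    positivity

lemma trunc_eventuallyEq (t : ℝ) : ∀ᶠ n in atTop, trunc φ n t = φ t := by
  obtain ⟨N, hN⟩ := exists_nat_ge |φ t|
  filter_upwards [eventually_ge_atTop N] with n hn
  exact trunc_of_le (hN.trans (by exact_mod_cast hn))

lemma truncOne_eventuallyEq (t : ℝ) : ∀ᶠ n in atTop, truncOne φ n t = 1 := by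
  obtain ⟨N, hN⟩ := exists_nat_ge |φ t|
  filter_upwards [eventually_ge_atTop N] with n hn
  exact truncOne_of_le (hN.trans (by exact_mod_cast hn))

lemma tendsto_trunc (t : ℝ) : Tendsto (fun n => trunc φ n t) atTop (𝓝 (φ t)) :=
  tendsto_const_nhds.congr' ((trunc_eventuallyEq t).mono fun _ h => h.symm)

lemma tendsto_truncOne (t : ℝ) : Tendsto (fun n => truncOne φ n t) atTop (𝓝 1) :=
  tendsto_const_nhds.congr' ((truncOne_eventuallyEq t).mono fun _ h => h.symm)

lemma trunc_mul_truncOne {m n : ℕ} (h : n ≤ m) (t : ℝ) :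
    trunc φ m t * truncOne φ n t = trunc φ n t := by
  rcases le_or_gt |φ t| n with h' | h'
  · rw [trunc_of_le h', truncOne_of_le h', trunc_of_le (h'.trans (by exact_mod_cast h)), mul_one]
  · rw [trunc_of_lt h', truncOne_of_lt h', mul_zero]

end trunc

section Spectral

variable {E : Type*} [NormedAddCommGroup E] [InnerProductSpace ℂ E] [CompleteSpace E]

/-- The operator `∫ φ(t) dP_t`, for `φ` measurable. -/
def spectralIntegral (P : ℝ → E →L[ℂ] E) (φ : ℝ → ℝ) : E →ₗ.[ℂ] E where
  domain :=
    { carrier := {f | ∃ g, Tendsto (fun n => borelCalc P (trunc φ n) f) atTop (𝓝 g)}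
      add_mem' := by
        rintro f g ⟨f', hf⟩ ⟨g', hg⟩
        exact ⟨f' + g', by simpa using hf.add hg⟩
      zero_mem' := ⟨0, by simp⟩
      smul_mem' := by
        rintro c f ⟨f', hf⟩
        exact ⟨c • f', by simpa using hf.const_smul c⟩ }
  toFun :=
    { toFun := fun f => f.2.choose
      map_add' := fun f g => by
        refine tendsto_nhds_unique (f + g).2.choose_spec ?_
        simpa using f.2.choose_spec.add g.2.choose_spec
      map_smul' := fun c f => by
        refine tendsto_nhds_unique (c • f).2.choose_spec ?_
        simpa using f.2.choose_spec.const_smul c }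

namespace IsSpectralFamily

variable {P : ℝ → E →L[ℂ] E} {φ ψ : ℝ → ℝ}

lemma tendsto_spectralIntegral (f : (spectralIntegral P φ).domain) :
    Tendsto (fun n => borelCalc P (trunc φ n) f) atTop (𝓝 (spectralIntegral P φ f)) :=
  f.2.choose_spec

lemma spectralIntegral_of_tendsto {f g : E}
    (h : Tendsto (fun n => borelCalc P (trunc φ n) f) atTop (𝓝 g)) :
    ∃ hf : f ∈ (spectralIntegral P φ).domain, spectralIntegral P φ ⟨f, hf⟩ = g :=
  ⟨⟨g, h⟩, tendsto_nhds_unique (tendsto_spectralIntegral (⟨f, ⟨g, h⟩⟩ : (spectralIntegral P φ).domain)) h⟩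

/-- Dominated convergence for the bounded functional calculus. -/
lemma tendsto_calc (hP : IsSpectralFamily P) {F : ℕ → ℝ → ℝ} (hF : ∀ n, IsBddMeas (F n))
    (hψ : IsBddMeas ψ) {C : ℝ} (hC : ∀ n t, |F n t| ≤ C)
    (h : ∀ t, Tendsto (fun n => F n t) atTop (𝓝 (ψ t))) (f : E) :
    Tendsto (fun n => borelCalc P (F n) f) atTop (𝓝 (borelCalc P ψ f)) := by
  have hfin := hP.isFiniteMeasure f
  obtain ⟨D, hD⟩ := hψ.2
  rw [tendsto_iff_norm_sub_tendsto_zero]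
  have h2 : Tendsto (fun n => ‖borelCalc P (F n) f - borelCalc P ψ f‖ ^ 2) atTop (𝓝 0) := by
    simp only [← sub_apply, ← hP.calc_sub (hF _) hψ, hP.norm_sq_calc ((hF _).sub hψ)]
    rw [← integral_zero ℝ ℝ (μ := scalarMeasure P f)]
    refine tendsto_integral_of_dominated_convergence (fun _ => (C + D) ^ 2)
      (fun n => (((hF n).1.sub hψ.1).pow_const 2).aestronglyMeasurable)
      (integrable_const _) (fun n => Eventually.of_forall fun t => ?_)
      (Eventually.of_forall fun t => ?_)
    · rw [Real.norm_of_nonneg (sq_nonneg _), ← sq_abs]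
      have := (abs_sub (F n t) (ψ t)).trans (add_le_add (hC n t) (hD t))
      gcongr
    · simpa using ((h t).sub_const (ψ t)).pow 2
  simpa using h2.sqrt

lemma tendsto_truncOne (hP : IsSpectralFamily P) (hφ : Measurable φ) (f : E) :
    Tendsto (fun n => borelCalc P (truncOne φ n) f) atTop (𝓝 f) := by
  have := hP.tendsto_calc (isBddMeas_truncOne hφ) (IsBddMeas.const 1) (C := 1)
    (fun n t => by
      rcases le_or_gt |φ t| n with h | h
      · rw [truncOne_of_le h, abs_one]
      · rw [truncOne_of_lt h]; simp)
    (fun t => MixedState.tendsto_truncOne t) f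
  rwa [hP.calc_one] at this

lemma calc_trunc_truncOne (hP : IsSpectralFamily P) (hφ : Measurable φ) {m n : ℕ} (h : n ≤ m)
    (f : E) : borelCalc P (trunc φ m) (borelCalc P (truncOne φ n) f) = borelCalc P (trunc φ n) f := by
  rw [hP.calc_calc (isBddMeas_trunc hφ m) (isBddMeas_truncOne hφ n)]
  simp only [trunc_mul_truncOne h]

lemma spectralIntegral_truncOne (hP : IsSpectralFamily P) (hφ : Measurable φ) (n : ℕ) (f : E) :
    ∃ hf : borelCalc P (truncOne φ n) f ∈ (spectralIntegral P φ).domain,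
      spectralIntegral P φ ⟨borelCalc P (truncOne φ n) f, hf⟩ = borelCalc P (trunc φ n) f := by
  refine spectralIntegral_of_tendsto (tendsto_const_nhds.congr' ?_)
  filter_upwards [eventually_ge_atTop n] with m hm
  exact (hP.calc_trunc_truncOne hφ hm f).symm

lemma dense_spectralIntegral (hP : IsSpectralFamily P) (hφ : Measurable φ) :
    Dense ((spectralIntegral P φ).domain : Set E) := fun f =>
  mem_closure_of_tendsto (hP.tendsto_truncOne hφ f)
    (Eventually.of_forall fun n => (hP.spectralIntegral_truncOne hφ n f).1)

/-- Monotone convergence, as the squared truncations increase to `φ²`. It presents a possibly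
infinite energy as a supremum over bounded operators. -/
lemma iSup_enorm_sq_trunc (hP : IsSpectralFamily P) (hφ : Measurable φ) (f : E) :
    ⨆ n, ‖borelCalc P (trunc φ n) f‖ₑ ^ 2
      = ∫⁻ t, ENNReal.ofReal (φ t ^ 2) ∂(scalarMeasure P f) := by
  simp only [hP.enorm_sq_calc (isBddMeas_trunc hφ _)]
  have hmono : ∀ t, Monotone fun n => ENNReal.ofReal (trunc φ n t ^ 2) := by
    intro t m n hmn
    simp only
    rw [← trunc_mul_truncOne hmn t]
    refine ENNReal.ofReal_le_ofReal ?_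
    rcases le_or_gt |φ t| m with h | h
    · rw [truncOne_of_le h, mul_one]
    · rw [truncOne_of_lt h, mul_zero, zero_pow two_ne_zero]
      positivity
  rw [← lintegral_iSup (fun n => ((isBddMeas_trunc hφ n).1.pow_const 2).ennreal_ofReal)
    (fun m n h t => hmono t h)]
  refine lintegral_congr fun t => ?_
  exact iSup_eq_of_tendsto (hmono t)
    (ENNReal.tendsto_ofReal ((tendsto_trunc t).pow 2))

lemma monotone_enorm_sq_trunc (hP : IsSpectralFamily P) (hφ : Measurable φ) (f : E) :
    Monotone fun n => ‖borelCalc P (trunc φ n) f‖ₑ ^ 2 := by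
  intro m n hmn
  simp only [hP.enorm_sq_calc (isBddMeas_trunc hφ _)]
  refine lintegral_mono fun t => ENNReal.ofReal_le_ofReal ?_
  rw [← trunc_mul_truncOne hmn t]
  rcases le_or_gt |φ t| m with h | h
  · rw [truncOne_of_le h, mul_one]
  · rw [truncOne_of_lt h, mul_zero, zero_pow two_ne_zero]
    positivity

lemma integrable_sq (hφ : Measurable φ) {f : E}
    (hf : ∫⁻ t, ENNReal.ofReal (φ t ^ 2) ∂(scalarMeasure P f) < ∞) :
    Integrable (fun t => φ t ^ 2) (scalarMeasure P f) := by
  refine ⟨(hφ.pow_const 2).aestronglyMeasurable, ?_⟩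
  rwa [hasFiniteIntegral_iff_ofReal (Eventually.of_forall fun t => sq_nonneg _)]

lemma integrable_of_sq (hP : IsSpectralFamily P) (hφ : Measurable φ) {f : E}
    (hf : ∫⁻ t, ENNReal.ofReal (φ t ^ 2) ∂(scalarMeasure P f) < ∞) :
    Integrable φ (scalarMeasure P f) := by
  have hfin := hP.isFiniteMeasure f
  have h : MemLp φ 2 (scalarMeasure P f) :=
    (memLp_two_iff_integrable_sq hφ.aestronglyMeasurable).2 (integrable_sq hφ hf)
  exact h.integrable (by norm_num)

lemma mem_domain_spectralIntegral (hP : IsSpectralFamily P) (hφ : Measurable φ) (f : E) :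
    f ∈ (spectralIntegral P φ).domain ↔
      ∫⁻ t, ENNReal.ofReal (φ t ^ 2) ∂(scalarMeasure P f) < ∞ := by
  constructor
  · rintro ⟨g, hg⟩
    rw [← hP.iSup_enorm_sq_trunc hφ f,
      iSup_eq_of_tendsto (hP.monotone_enorm_sq_trunc hφ f) (ENNReal.Tendsto.pow hg.enorm)]
    exact ENNReal.pow_lt_top enorm_lt_top
  · intro hf
    have hi := integrable_sq hφ hf
    have hfin := hP.isFiniteMeasure f
    -- Two truncations of index at least `N` differ only where `|φ| > N`, and there by at most
    -- `|φ|`; the tail of `∫ φ²` therefore controls the Cauchy property.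
    let b : ℕ → ℝ := fun N => √(∫ t, {t | |φ t| ≤ N}ᶜ.indicator (fun t => φ t ^ 2) t ∂(scalarMeasure P f))
    refine cauchySeq_tendsto_of_complete (cauchySeq_of_le_tendsto_0 b (fun n m N hn hm => ?_) ?_)
    · rw [dist_eq_norm, ← sub_apply, ← hP.calc_sub (isBddMeas_trunc hφ _) (isBddMeas_trunc hφ _)]
      refine Real.le_sqrt_of_sq_le ?_
      have hs := (isBddMeas_trunc hφ n).sub (isBddMeas_trunc hφ m)
      rw [hP.norm_sq_calc hs]
      refine integral_mono ?_ (hi.indicator (measurableSet_abs_le hφ N).compl) fun t => ?_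
      · simpa only [sq] using (hs.mul hs).integrable _
      · simp only
        by_cases h : |φ t| ≤ N
        · have h1 : |φ t| ≤ n := h.trans (by exact_mod_cast hn)
          have h2 : |φ t| ≤ m := h.trans (by exact_mod_cast hm)
          rw [trunc_of_le h1, trunc_of_le h2, sub_self]
          simp [h]
        · rw [indicator_of_mem (show t ∈ {t | |φ t| ≤ N}ᶜ from h)]
          rcases le_or_gt |φ t| n with h1 | h1 <;> rcases le_or_gt |φ t| m with h2 | h2
          · rw [trunc_of_le h1, trunc_of_le h2, sub_self, zero_pow two_ne_zero]; positivity
          · rw [trunc_of_le h1, trunc_of_lt h2, sub_zero]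
          · rw [trunc_of_lt h1, trunc_of_le h2, zero_sub, neg_sq]
          · rw [trunc_of_lt h1, trunc_of_lt h2, sub_self, zero_pow two_ne_zero]; positivity
    · rw [← Real.sqrt_zero, ← integral_zero ℝ ℝ (μ := scalarMeasure P f)]
      refine Tendsto.sqrt (tendsto_integral_of_dominated_convergence (fun t => φ t ^ 2)
        (fun n => ((hφ.pow_const 2).indicator (measurableSet_abs_le hφ n).compl).aestronglyMeasurable)
        hi (fun n => Eventually.of_forall fun t => ?_) (Eventually.of_forall fun t => ?_))
      · rw [Real.norm_of_nonneg (indicator_nonneg (fun t _ => sq_nonneg _) _)]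
        exact indicator_le_self' (fun t _ => sq_nonneg _) _
      · refine tendsto_const_nhds.congr' ?_
        obtain ⟨N, hN⟩ := exists_nat_ge |φ t|
        filter_upwards [eventually_ge_atTop N] with n hn
        have : |φ t| ≤ n := hN.trans (by exact_mod_cast hn)
        simp [this]

lemma isSpectralIntegral (hP : IsSpectralFamily P) (hφ : Measurable φ) :
    IsSpectralIntegral P φ (spectralIntegral P φ) where
  mem_domain_iff := hP.mem_domain_spectralIntegral hφ
  inner_eq f := by
    have hi := hP.integrable_of_sq hφ ((hP.mem_domain_spectralIntegral hφ f).1 f.2)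
    refine tendsto_nhds_unique (Tendsto.inner tendsto_const_nhds (tendsto_spectralIntegral f)) ?_
    simp only [hP.inner_calc_self (isBddMeas_trunc hφ _)]
    refine (Complex.continuous_ofReal.tendsto _).comp ?_
    refine tendsto_integral_of_dominated_convergence (fun t => |φ t|)
      (fun n => (isBddMeas_trunc hφ n).1.aestronglyMeasurable) hi.abs
      (fun n => Eventually.of_forall fun t => ?_) (Eventually.of_forall fun t => tendsto_trunc t)
    exact abs_trunc_le n t

end IsSpectralFamily

/-- Polarization: a linear map on a dense subspace with vanishing quadratic form vanishes. -/
lemma eq_zero_of_inner_self {p : Submodule ℂ E} (hp : Dense (p : Set E)) (D : p →ₗ[ℂ] E)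
    (h : ∀ f : p, inner ℂ (f : E) (D f) = 0) : D = 0 := by
  have h2 : ∀ f g : p, inner ℂ (f : E) (D g) = 0 := by
    intro f g
    have h3 := h (f + g)
    have h4 := h (f + Complex.I • g)
    simp only [map_add, map_smul, Submodule.coe_add, Submodule.coe_smul, inner_add_left,
      inner_add_right, inner_smul_left, inner_smul_right, h, Complex.conj_I] at h3 h4
    have h5 : (2 * Complex.I) * inner ℂ (f : E) (D g) = 0 := by linear_combination h4 + Complex.I * h3
    simpa using h5
  ext g
  exact hp.eq_zero_of_inner_right ℂ fun f hf => h2 ⟨f, hf⟩ g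

/-- Domain and quadratic form determine the operator by polarization, so the choice made in
`funCalc` is immaterial once some densely defined spectral integral exists. -/
lemma IsSpectralIntegral.unique {P : ℝ → E →L[ℂ] E} {φ : ℝ → ℝ} {S S' : E →ₗ.[ℂ] E}
    (hS : IsSpectralIntegral P φ S) (hS' : IsSpectralIntegral P φ S')
    (hd : Dense (S.domain : Set E)) : S = S' := by
  have hdom : S.domain = S'.domain := by
    ext f
    rw [hS.mem_domain_iff, hS'.mem_domain_iff]
  have key : ∀ (T : S.domain →ₗ[ℂ] E), (∀ f : S.domain,
      inner ℂ (f : E) (T f) = ((∫ t, φ t ∂(scalarMeasure P f) : ℝ) : ℂ)) → S.toFun = T := by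
    intro T hT
    refine sub_eq_zero.1 (eq_zero_of_inner_self hd _ fun f => ?_)
    rw [LinearMap.sub_apply, inner_sub_right, hT f]
    exact sub_eq_zero.2 (hS.inner_eq f)
  obtain ⟨d, T⟩ := S'
  dsimp only at hdom
  subst hdom
  obtain ⟨d, T'⟩ := S
  congr 1
  exact key T hS'.inner_eq

end Spectral

/-! ## The resolvent of a positive self-adjoint operator -/

section Resolvent

variable {E : Type*} [NormedAddCommGroup E] [InnerProductSpace ℂ E] [CompleteSpace E]

lemma re_inner_self_eq (f : E) : (inner ℂ f f).re = ‖f‖ ^ 2 :=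
  (norm_sq_eq_re_inner (𝕜 := ℂ) f).symm

lemma inner_symm_of_isSelfAdjoint {A : E →ₗ.[ℂ] E} (hA : IsSelfAdjoint A) (f g : A.domain) :
    inner ℂ (A f) (g : E) = inner ℂ (f : E) (A g) := by
  have h := LinearPMap.adjoint_isFormalAdjoint hA.dense_domain
  rw [LinearPMap.isSelfAdjoint_def.1 hA] at h
  exact h f g

/-- Because `‖f‖² ≤ Re ⟨f, (1 + A) f⟩`. This makes `1 + A` injective with closed range, and its
inverse a contraction. -/
lemma norm_le_norm_add_apply {A : E →ₗ.[ℂ] E} (hpos : ∀ f : A.domain, 0 ≤ (inner ℂ (f : E) (A f)).re)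
    (f : A.domain) : ‖(f : E)‖ ≤ ‖(f : E) + A f‖ := by
  have h1 : ‖(f : E)‖ ^ 2 ≤ (inner ℂ (f : E) ((f : E) + A f)).re := by
    rw [inner_add_right, Complex.add_re, re_inner_self_eq]
    linarith [hpos f]
  have h2 := (Complex.re_le_norm _).trans (norm_inner_le_norm (𝕜 := ℂ) (f : E) ((f : E) + A f))
  by_contra hc
  push Not at hc
  nlinarith [norm_nonneg (f : E), norm_nonneg ((f : E) + A f)]

/-- `1 + A`, as a linear map on the domain of `A`. -/
def oneAdd (A : E →ₗ.[ℂ] E) : A.domain →ₗ[ℂ] E := A.domain.subtype + A.toFun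

lemma oneAdd_apply (A : E →ₗ.[ℂ] E) (f : A.domain) : oneAdd A f = (f : E) + A f := rfl

lemma oneAdd_injective {A : E →ₗ.[ℂ] E} (hpos : ∀ f : A.domain, 0 ≤ (inner ℂ (f : E) (A f)).re) :
    Function.Injective (oneAdd A) := by
  refine (injective_iff_map_eq_zero _).2 fun f hf => ?_
  have h := norm_le_norm_add_apply hpos f
  rw [← oneAdd_apply, hf, norm_zero] at h
  exact Subtype.ext (norm_le_zero_iff.1 h)

lemma isClosed_range_oneAdd {A : E →ₗ.[ℂ] E} (hA : IsSelfAdjoint A)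
    (hpos : ∀ f : A.domain, 0 ≤ (inner ℂ (f : E) (A f)).re) :
    IsClosed (LinearMap.range (oneAdd A) : Set E) := by
  refine isClosed_of_closure_subset fun y hy => ?_
  obtain ⟨u, hu, hlim⟩ := mem_closure_iff_seq_limit.1 hy
  choose v hv using hu
  have hc : CauchySeq fun n => (v n : E) := by
    have huc := hlim.cauchySeq
    rw [Metric.cauchySeq_iff'] at huc ⊢
    intro ε hε
    obtain ⟨N, hN⟩ := huc ε hε
    refine ⟨N, fun n hn => lt_of_le_of_lt ?_ (hN n hn)⟩
    rw [dist_eq_norm, dist_eq_norm, ← hv, ← hv, ← map_sub]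
    exact norm_le_norm_add_apply hpos (v n - v N)
  obtain ⟨x, hx⟩ := cauchySeq_tendsto_of_complete hc
  have hAv : Tendsto (fun n => A (v n)) atTop (𝓝 (y - x)) := by
    refine (hlim.sub hx).congr fun n => ?_
    rw [← hv, oneAdd_apply, add_sub_cancel_left]
  have hmem : (x, y - x) ∈ A.graph := by
    refine IsClosed.mem_of_tendsto (f := fun n => ((v n : E), A (v n))) hA.isClosed
      (hx.prodMk_nhds hAv) (Eventually.of_forall fun n => ?_)
    exact A.mem_graph (v n)
  obtain ⟨z, hz1, hz2⟩ := (LinearPMap.mem_graph_iff A).1 hmem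
  refine ⟨z, ?_⟩
  rw [oneAdd_apply, hz2, hz1]
  simp

/-- A vector `z` orthogonal to the range lies in the domain of the adjoint, which is that of `A`;
testing against `z` itself gives `‖z‖² + ⟨z, A z⟩ = 0`. -/
lemma oneAdd_surjective {A : E →ₗ.[ℂ] E} (hA : IsSelfAdjoint A)
    (hpos : ∀ f : A.domain, 0 ≤ (inner ℂ (f : E) (A f)).re) :
    Function.Surjective (oneAdd A) := by
  rw [← LinearMap.range_eq_top]
  have := (isClosed_range_oneAdd hA hpos).completeSpace_coe
  have : CompleteSpace (LinearMap.range (oneAdd A)) := this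
  rw [← Submodule.orthogonal_eq_bot_iff, Submodule.eq_bot_iff]
  intro z hz
  have hz' : ∀ f : A.domain, inner ℂ z ((f : E) + A f) = 0 := fun f =>
    (Submodule.mem_orthogonal' _ z).1 hz _ ⟨f, rfl⟩
  have hdom : z ∈ A.domain := by
    have h : z ∈ (LinearPMap.adjoint A).domain := by
      refine LinearPMap.mem_adjoint_domain_of_exists z ⟨-z, fun f => ?_⟩
      have := hz' f
      rw [inner_add_right] at this
      rw [inner_neg_left]
      linear_combination -this
    rwa [LinearPMap.isSelfAdjoint_def.1 hA] at h
  have h := congrArg Complex.re (hz' ⟨z, hdom⟩)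
  rw [inner_add_right, Complex.add_re, re_inner_self_eq, Complex.zero_re] at h
  have h2 := hpos ⟨z, hdom⟩
  simp only at h h2
  have : ‖z‖ ^ 2 = 0 := le_antisymm (by linarith) (sq_nonneg _)
  exact norm_eq_zero.1 (pow_eq_zero_iff two_ne_zero |>.1 this)

lemma exists_resolvent {A : E →ₗ.[ℂ] E} (hA : IsSelfAdjoint A)
    (hpos : ∀ f : A.domain, 0 ≤ (inner ℂ (f : E) (A f)).re) :
    ∃ B : E →L[ℂ] E, B.IsPositive ∧ (∀ f, (inner ℂ f (B f)).re ≤ ‖f‖ ^ 2) ∧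
      (∀ g, ∃ h : B g ∈ A.domain, A ⟨B g, h⟩ = g - B g) ∧
      ∀ f : A.domain, B ((f : E) + A f) = f := by
  let e := LinearEquiv.ofBijective (oneAdd A) ⟨oneAdd_injective hpos, oneAdd_surjective hA hpos⟩
  have he : ∀ g, ((e.symm g : A.domain) : E) + A (e.symm g) = g := fun g => e.apply_symm_apply g
  have hnorm : ∀ g, ‖((e.symm g : A.domain) : E)‖ ≤ ‖g‖ := fun g => by
    have := norm_le_norm_add_apply hpos (e.symm g)
    rwa [he] at this
  let B : E →L[ℂ] E := (A.domain.subtype ∘ₗ e.symm.toLinearMap).mkContinuous 1 fun g => by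
    rw [one_mul]
    exact hnorm g
  have hB : ∀ g, B g = (e.symm g : A.domain) := fun g => rfl
  have hsymm : ∀ f g, inner ℂ (B f) g = inner ℂ f (B g) := by
    intro f g
    rw [hB, hB]
    conv_lhs => rw [← he g]
    conv_rhs => rw [← he f]
    rw [inner_add_left, inner_add_right, inner_symm_of_isSelfAdjoint hA]
  have hform : ∀ f, (inner ℂ f (B f)).re = ‖B f‖ ^ 2 + (inner ℂ (B f) (A (e.symm f))).re := by
    intro f
    have h : inner ℂ f (B f) = inner ℂ (((e.symm f : A.domain) : E) + A (e.symm f)) (B f) := by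
      rw [he f]
    rw [h, inner_add_left, hB, Complex.add_re, re_inner_self_eq, inner_symm_of_isSelfAdjoint hA]
  refine ⟨B, ?_, fun f => ?_, fun g => ⟨(e.symm g).2, ?_⟩, fun f => ?_⟩
  · rw [ContinuousLinearMap.isPositive_def]
    refine ⟨fun f g => hsymm f g, fun f => ?_⟩
    rw [ContinuousLinearMap.reApplyInnerSelf_apply, RCLike.re_to_complex, hsymm, hform]
    have := hpos (e.symm f)
    rw [hB]
    positivity
  · refine (Complex.re_le_norm _).trans ((norm_inner_le_norm _ _).trans ?_)
    rw [sq]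
    exact mul_le_mul_of_nonneg_left (hnorm f) (norm_nonneg _)
  · rw [eq_sub_iff_add_eq']
    exact he g
  · rw [hB]
    exact congrArg _ (e.symm_apply_apply f)

end Resolvent

/-! ## Spectral subspaces of a bounded positive operator -/

section SpectralSubspace

variable {E : Type*} [NormedAddCommGroup E] [InnerProductSpace ℂ E] [CompleteSpace E]

lemma re_inner_le_of_le {S T : E →L[ℂ] E} (h : S ≤ T) (f : E) :
    (inner ℂ f (S f)).re ≤ (inner ℂ f (T f)).re := by
  have h2 := ((ContinuousLinearMap.le_def S T).1 h).re_inner_nonneg_right f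
  rw [sub_apply, inner_sub_right, RCLike.re_to_complex, Complex.sub_re] at h2
  linarith

lemma norm_opSqrt_sq {T : E →L[ℂ] E} (hT : T.IsPositive) (f : E) :
    ‖opSqrt T f‖ ^ 2 = (inner ℂ f (T f)).re := by
  conv_rhs => rw [← opSqrt_mul_self T hT]
  rw [mul_apply_eq_comp, inner_opSqrt, re_inner_self_eq]

/-- Since `⟨f, T f⟩ = ‖T^{1/2} f‖²`. Kernels of positive operators, hence the subspaces
`specSubspace`, can thus be compared through quadratic forms. -/
lemma apply_eq_zero_of_re_inner {T : E →L[ℂ] E} (hT : 0 ≤ T) {f : E}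
    (h : (inner ℂ f (T f)).re ≤ 0) : T f = 0 := by
  have hT' := (ContinuousLinearMap.nonneg_iff_isPositive _).1 hT
  rw [← norm_opSqrt_sq hT'] at h
  have h2 : opSqrt T f = 0 := by
    have := le_antisymm h (sq_nonneg _)
    exact norm_eq_zero.1 (pow_eq_zero_iff two_ne_zero |>.1 this)
  rw [← opSqrt_mul_self T hT', mul_apply_eq_comp, h2, map_zero]

variable {B : E →L[ℂ] E}

/-- The positive part `(c - B)^+`. -/
def posPart (B : E →L[ℂ] E) (c : ℝ) : E →L[ℂ] E := cfc (fun x : ℝ => max (c - x) 0) B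

/-- The negative part `(c - B)^-`. -/
def negPart (B : E →L[ℂ] E) (c : ℝ) : E →L[ℂ] E := cfc (fun x : ℝ => max (x - c) 0) B

lemma posPart_nonneg (B : E →L[ℂ] E) (c : ℝ) : 0 ≤ posPart B c :=
  cfc_nonneg fun _ _ => le_max_right _ _

lemma negPart_nonneg (B : E →L[ℂ] E) (c : ℝ) : 0 ≤ negPart B c :=
  cfc_nonneg fun _ _ => le_max_right _ _

lemma posPart_sub_negPart (hB : IsSelfAdjoint B) (c : ℝ) (f : E) :
    posPart B c f - negPart B c f = (c : ℂ) • f - B f := by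
  have h : posPart B c - negPart B c = algebraMap ℝ (E →L[ℂ] E) c - B := by
    have h1 := cfc_sub (a := B) (f := fun x : ℝ => max (c - x) 0) (g := fun x : ℝ => max (x - c) 0)
    have h2 := cfc_sub (a := B) (f := fun _ : ℝ => c) (g := fun x : ℝ => x)
    rw [cfc_const c B, cfc_id' ℝ B] at h2
    rw [posPart, negPart, ← h1, ← h2]
    congr 1
    ext x
    have := max_zero_sub_max_neg_zero_eq_self (c - x)
    rwa [neg_sub] at this
  have h2 := congrArg (fun T => T f) h
  simpa [Algebra.algebraMap_eq_smul_one] using h2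

lemma posPart_negPart (B : E →L[ℂ] E) (c : ℝ) (f : E) : posPart B c (negPart B c f) = 0 := by
  have h : posPart B c * negPart B c = 0 := by
    have h1 := cfc_mul (a := B) (f := fun x : ℝ => max (c - x) 0) (g := fun x : ℝ => max (x - c) 0)
    rw [posPart, negPart, ← h1, ← cfc_const_zero ℝ B]
    congr 1
    ext x
    rcases le_total c x with h | h
    · rw [max_eq_right (by linarith), zero_mul]
    · rw [max_eq_right (a := x - c) (by linarith), mul_zero]
  exact congrArg (fun T => T f) h

lemma posPart_mono (B : E →L[ℂ] E) {c d : ℝ} (h : c ≤ d) : posPart B c ≤ posPart B d :=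
  cfc_mono fun x _ => max_le_max_right 0 (by linarith)

lemma posPart_le (hB : IsSelfAdjoint B) {c d : ℝ} (h : c ≤ d) :
    posPart B d ≤ posPart B c + algebraMap ℝ (E →L[ℂ] E) (d - c) := by
  have h1 := cfc_add_const (a := B) (d - c) (fun x : ℝ => max (c - x) 0)
  rw [posPart, posPart, ← h1]
  refine cfc_mono fun x _ => max_le ?_ ?_
  · linarith [le_max_left (c - x) 0]
  · linarith [le_max_right (c - x) 0]

lemma posPart_commute (hB : IsSelfAdjoint B) (c : ℝ) (f : E) :
    posPart B c (B f) = B (posPart B c f) := by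
  have h : Commute (posPart B c) B := by
    have := cfc_commute_cfc (fun x : ℝ => max (c - x) 0) (fun x => x) B
    rwa [cfc_id' ℝ B] at this
  exact congrArg (fun T => T f) h.eq

/-- The spectral subspace of `B` for `[c, ∞[`. -/
def specSubspace (B : E →L[ℂ] E) (c : ℝ) : Submodule ℂ E := (posPart B c).ker

instance (B : E →L[ℂ] E) (c : ℝ) : CompleteSpace (specSubspace B c) :=
  ContinuousLinearMap.completeSpace_ker _

lemma mem_specSubspace {c : ℝ} {f : E} : f ∈ specSubspace B c ↔ posPart B c f = 0 := Iff.rfl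

lemma specSubspace_anti (B : E →L[ℂ] E) {c d : ℝ} (h : c ≤ d) :
    specSubspace B d ≤ specSubspace B c := fun f hf => by
  refine apply_eq_zero_of_re_inner (posPart_nonneg B c) ((re_inner_le_of_le (posPart_mono B h) f).trans ?_)
  rw [mem_specSubspace.1 hf]
  simp

/-- Left continuity in the level, from `(c - B)⁺ ≤ (d - B)⁺ + (c - d)`. The decreasing change of
variable `levelFun` turns it into right continuity in `t`. -/
lemma mem_specSubspace_of_forall_lt (hB : IsSelfAdjoint B) {c : ℝ} {f : E}
    (h : ∀ d < c, f ∈ specSubspace B d) : f ∈ specSubspace B c := by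
  refine apply_eq_zero_of_re_inner (posPart_nonneg B c) ?_
  have h2 : ∀ d < c, (inner ℂ f (posPart B c f)).re ≤ (c - d) * ‖f‖ ^ 2 := by
    intro d hd
    have := re_inner_le_of_le (posPart_le hB hd.le) f
    rw [add_apply, mem_specSubspace.1 (h d hd), zero_add, Algebra.algebraMap_eq_smul_one] at this
    refine this.trans (le_of_eq ?_)
    rw [smul_apply, one_apply_eq_self, ← Complex.coe_smul, inner_smul_right,
      Complex.re_ofReal_mul, re_inner_self_eq]
  refine le_of_tendsto_of_tendsto (f := fun _ => _) (g := fun d => (c - d) * ‖f‖ ^ 2) (b := 𝓝[<] c)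
    tendsto_const_nhds ?_ (eventually_mem_nhdsWithin.mono h2)
  have : Tendsto (fun d => (c - d) * ‖f‖ ^ 2) (𝓝 c) (𝓝 ((c - c) * ‖f‖ ^ 2)) := by
    apply Continuous.tendsto
    fun_prop
  rw [sub_self, zero_mul] at this
  exact this.mono_left nhdsWithin_le_nhds

lemma le_re_inner_of_mem (hB : IsSelfAdjoint B) {c : ℝ} {f : E} (h : f ∈ specSubspace B c) :
    c * ‖f‖ ^ 2 ≤ (inner ℂ f (B f)).re := by
  have h2 := congrArg (fun y => (inner ℂ f y).re) (posPart_sub_negPart hB c f)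
  have h3 := ((ContinuousLinearMap.nonneg_iff_isPositive _).1 (negPart_nonneg B c)).re_inner_nonneg_right f
  simp only [mem_specSubspace.1 h, inner_sub_right, inner_smul_right, Complex.sub_re,
    Complex.re_ofReal_mul, re_inner_self_eq, inner_zero_right, Complex.zero_re] at h2
  rw [RCLike.re_to_complex] at h3
  linarith

/-- The range of `(c - B)⁻` lies in the kernel of `(c - B)⁺`, so `(c - B)⁻` contributes nothing on
the orthogonal complement and `⟨f, (c - B) f⟩ = ⟨f, (c - B)⁺ f⟩ ≥ 0`. -/
lemma re_inner_le_of_mem_orthogonal (hB : IsSelfAdjoint B) {c : ℝ} {f : E}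
    (h : f ∈ (specSubspace B c)ᗮ) : (inner ℂ f (B f)).re ≤ c * ‖f‖ ^ 2 := by
  have h2 := congrArg (fun y => (inner ℂ f y).re) (posPart_sub_negPart hB c f)
  have h3 := ((ContinuousLinearMap.nonneg_iff_isPositive _).1 (posPart_nonneg B c)).re_inner_nonneg_right f
  have h4 : inner ℂ f (negPart B c f) = 0 :=
    (Submodule.mem_orthogonal' _ f).1 h _ (posPart_negPart B c f)
  simp only [inner_sub_right, inner_smul_right, Complex.sub_re, h4,
    Complex.re_ofReal_mul, re_inner_self_eq, Complex.zero_re] at h2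
  rw [RCLike.re_to_complex] at h3
  linarith

lemma specSubspace_eq_bot (hB : IsSelfAdjoint B) (hB1 : ∀ f, (inner ℂ f (B f)).re ≤ ‖f‖ ^ 2) {c : ℝ}
    (hc : 1 < c) : specSubspace B c = ⊥ := by
  refine (Submodule.eq_bot_iff _).2 fun f hf => ?_
  have h1 := le_re_inner_of_mem hB hf
  have h2 := hB1 f
  have h3 : ‖f‖ ^ 2 = 0 := by nlinarith [sq_nonneg ‖f‖]
  exact norm_eq_zero.1 (pow_eq_zero_iff two_ne_zero |>.1 h3)

/-- `B` preserves the subspace since it commutes with `posPart B c`, and preserves its orthogonal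
complement since it is self-adjoint. -/
lemma starProjection_commute (hB : IsSelfAdjoint B) (c : ℝ) (f : E) :
    (specSubspace B c).starProjection (B f) = B ((specSubspace B c).starProjection f) := by
  refine (Submodule.eq_starProjection_of_mem_of_inner_eq_zero (K := specSubspace B c) ?_ ?_)
  · rw [mem_specSubspace, posPart_commute hB, mem_specSubspace.1 (Submodule.starProjection_apply_mem _ _),
      map_zero]
  · intro w hw
    rw [← map_sub, ← ContinuousLinearMap.adjoint_inner_right,
      ContinuousLinearMap.isSelfAdjoint_iff'.1 hB]
    refine Submodule.starProjection_inner_eq_zero _ _ ?_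
    rw [mem_specSubspace, posPart_commute hB, mem_specSubspace.1 hw, map_zero]

/-- A continuous strictly decreasing extension of `t ↦ (1 + t)⁻¹` to the line, with values `> 1` on
the negative half line. -/
def levelFun (t : ℝ) : ℝ := (1 + max t 0)⁻¹ + max (-t) 0

lemma levelFun_of_nonneg {t : ℝ} (h : 0 ≤ t) : levelFun t = (1 + t)⁻¹ := by
  rw [levelFun, max_eq_left h, max_eq_right (by linarith), add_zero]

lemma levelFun_of_neg {t : ℝ} (h : t < 0) : levelFun t = 1 - t := by
  rw [levelFun, max_eq_right h.le, max_eq_left (by linarith)]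
  norm_num
  ring

lemma levelFun_strictAnti : StrictAnti levelFun := by
  intro s t h
  rcases lt_or_ge t 0 with ht | ht
  · rw [levelFun_of_neg ht, levelFun_of_neg (h.trans ht)]
    linarith
  · rw [levelFun_of_nonneg ht]
    rcases lt_or_ge s 0 with hs | hs
    · rw [levelFun_of_neg hs]
      have : (1 + t)⁻¹ ≤ 1 := inv_le_one_of_one_le₀ (by linarith)
      linarith
    · rw [levelFun_of_nonneg hs]
      exact inv_strictAnti₀ (by linarith) (by linarith)

lemma levelFun_continuous : Continuous levelFun := by
  unfold levelFun
  refine Continuous.add (Continuous.inv₀ (by fun_prop) fun t => ?_) (by fun_prop)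
  positivity

/-- The spectral family of `B⁻¹ - 1`. -/
def resolventFamily (B : E →L[ℂ] E) (t : ℝ) : E →L[ℂ] E :=
  (specSubspace B (levelFun t)).starProjection

lemma resolventFamily_of_neg (hB : IsSelfAdjoint B) (hB1 : ∀ f, (inner ℂ f (B f)).re ≤ ‖f‖ ^ 2)
    {t : ℝ} (ht : t < 0) : resolventFamily B t = 0 := by
  rw [resolventFamily]
  have h := specSubspace_eq_bot hB hB1 (c := levelFun t) (by rw [levelFun_of_neg ht]; linarith)
  ext f
  have := Submodule.starProjection_apply_mem (specSubspace B (levelFun t)) f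
  exact (Submodule.mem_bot ℂ).1 (h.le this)

lemma resolventFamily_mono (B : E →L[ℂ] E) {s t : ℝ} (h : s ≤ t) :
    resolventFamily B s * resolventFamily B t = resolventFamily B s :=
  Submodule.starProjection_comp_starProjection_of_le
    (specSubspace_anti B (levelFun_strictAnti.antitone h))

/-- A vector `g` orthogonal to all the subspaces has `⟨g, B g⟩ ≤ ‖g‖² / (1 + t)` for every `t ≥ 0`,
so `B g = 0` and injectivity of `B` gives `g = 0`. -/
lemma tendsto_resolventFamily_atTop (hB : IsSelfAdjoint B) (hpos : 0 ≤ B)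
    (hinj : ∀ f, B f = 0 → f = 0) (f : E) :
    Tendsto (fun t => resolventFamily B t f) atTop (𝓝 f) := by
  refine Submodule.starProjection_tendsto_self (fun t => specSubspace B (levelFun t))
    (fun s t h => specSubspace_anti B (levelFun_strictAnti.antitone h)) f ?_
  rw [top_le_iff, Submodule.topologicalClosure_eq_top_iff, ← Submodule.iInf_orthogonal]
  refine (Submodule.eq_bot_iff _).2 fun g hg => hinj g (apply_eq_zero_of_re_inner hpos ?_)
  have h1 : ∀ t : ℝ, 0 ≤ t → (inner ℂ g (B g)).re ≤ (1 + t)⁻¹ * ‖g‖ ^ 2 := fun t ht => by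
    have := re_inner_le_of_mem_orthogonal hB ((Submodule.mem_iInf _).1 hg t)
    rwa [levelFun_of_nonneg ht] at this
  refine le_of_tendsto_of_tendsto (f := fun _ => _) (g := fun t : ℝ => (1 + t)⁻¹ * ‖g‖ ^ 2)
    (b := atTop) tendsto_const_nhds ?_ ((eventually_ge_atTop 0).mono h1)
  have : Tendsto (fun t : ℝ => (1 + t)⁻¹) atTop (𝓝 0) :=
    tendsto_inv_atTop_zero.comp (tendsto_atTop_add_const_left _ _ tendsto_id)
  simpa using this.mul_const (‖g‖ ^ 2)

/-- The orthogonal complements increase along the sequence, and their closed span is the complement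
of the intersection of the subspaces, which left continuity in the level identifies. -/
lemma tendsto_resolventFamily_seq (hB : IsSelfAdjoint B) (t : ℝ) (f : E) :
    Tendsto (fun n : ℕ => resolventFamily B (t + 1 / ((n : ℝ) + 1)) f) atTop
      (𝓝 (resolventFamily B t f)) := by
  let U : ℕ → Submodule ℂ E := fun n => specSubspace B (levelFun (t + 1 / ((n : ℝ) + 1)))
  have hU : Monotone fun n => (U n)ᗮ := by
    intro m n h
    refine Submodule.orthogonal_le (specSubspace_anti B (levelFun_strictAnti.antitone ?_))
    have := Nat.one_div_le_one_div (α := ℝ) h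
    linarith
  have hcl : (⨆ n, (U n)ᗮ).topologicalClosure = (specSubspace B (levelFun t))ᗮ := by
    rw [← Submodule.orthogonal_orthogonal_eq_closure, ← Submodule.iInf_orthogonal]
    congr 1
    refine le_antisymm (fun g hg => ?_) (le_iInf fun n => ?_)
    · refine mem_specSubspace_of_forall_lt hB fun d hd => ?_
      have hlim : Tendsto (fun n : ℕ => levelFun (t + 1 / ((n : ℝ) + 1))) atTop (𝓝 (levelFun t)) := by
        refine (levelFun_continuous.tendsto t).comp ?_
        simpa using (tendsto_one_div_add_atTop_nhds_zero_nat (𝕜 := ℝ)).const_add t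
      obtain ⟨n, hn⟩ := (hlim.eventually (eventually_gt_nhds hd)).exists
      have := (Submodule.mem_iInf _).1 hg n
      rw [Submodule.orthogonal_orthogonal] at this
      exact specSubspace_anti B hn.le this
    · rw [Submodule.orthogonal_orthogonal]
      refine specSubspace_anti B (levelFun_strictAnti.antitone ?_)
      have : (0 : ℝ) < 1 / ((n : ℝ) + 1) := Nat.one_div_pos_of_nat
      linarith
  have h := Submodule.starProjection_tendsto_closure_iSup (fun n => (U n)ᗮ) hU f
  simp only [hcl, Submodule.starProjection_orthogonal_val] at h
  have h2 := (tendsto_const_nhds (x := f)).sub h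
  simp only [sub_sub_cancel] at h2
  exact h2

/-- As `P_s - P_r = P_s (P_t - P_r)` for `r ≤ s ≤ t`. It promotes convergence along a sequence to
right continuity. -/
lemma norm_resolventFamily_sub_le (B : E →L[ℂ] E) {r s t : ℝ} (hrs : r ≤ s) (hst : s ≤ t) (f : E) :
    ‖resolventFamily B s f - resolventFamily B r f‖ ≤ ‖resolventFamily B t f - resolventFamily B r f‖ := by
  have h : resolventFamily B s f - resolventFamily B r f
      = resolventFamily B s (resolventFamily B t f - resolventFamily B r f) := by
    have h1 := congrArg (fun T => T f) (resolventFamily_mono B hst)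
    have h2 : resolventFamily B s (resolventFamily B r f) = resolventFamily B r f := by
      refine Submodule.starProjection_eq_self_iff.2 ?_
      exact specSubspace_anti B (levelFun_strictAnti.antitone hrs) (Submodule.starProjection_apply_mem _ _)
    rw [map_sub, h2]
    congr 1
    exact h1.symm
  rw [h]
  exact Submodule.norm_starProjection_apply_le _ _

lemma isSpectralFamily_resolventFamily (hpos : 0 ≤ B)
    (hB1 : ∀ f, (inner ℂ f (B f)).re ≤ ‖f‖ ^ 2) (hinj : ∀ f, B f = 0 → f = 0) :
    IsSpectralFamily (resolventFamily B) where
  isStarProjection t := isStarProjection_starProjection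
  mono s t h := resolventFamily_mono B h
  rightCont t f := by
    have hB : IsSelfAdjoint B := IsSelfAdjoint.of_nonneg hpos
    rw [Metric.continuousWithinAt_iff]
    intro ε hε
    have h := tendsto_resolventFamily_seq hB t f
    obtain ⟨n, hn⟩ := (Metric.tendsto_nhds.1 h ε hε).exists
    refine ⟨1 / ((n : ℝ) + 1), Nat.one_div_pos_of_nat, fun {s} hs hd => ?_⟩
    refine lt_of_le_of_lt ?_ hn
    rw [dist_eq_norm, dist_eq_norm]
    refine norm_resolventFamily_sub_le B hs ?_ f
    rw [Real.dist_eq] at hd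
    linarith [le_abs_self (s - t)]
  tendsto_atBot f := by
    refine tendsto_const_nhds.congr' ?_
    filter_upwards [eventually_lt_atBot 0] with t ht
    rw [resolventFamily_of_neg (IsSelfAdjoint.of_nonneg hpos) hB1 ht, zero_apply]
  tendsto_atTop := tendsto_resolventFamily_atTop (IsSelfAdjoint.of_nonneg hpos) hpos hinj

end SpectralSubspace

/-! ## The spectral theorem for positive self-adjoint operators -/

/-- A function whose increments are bounded by `(y - x) (v y - v x)`, with `v` nondecreasing, is
constant. -/
lemma eq_of_abs_sub_le_mul {h v : ℝ → ℝ}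
    (hh : ∀ x y, 0 ≤ x → x ≤ y → |h y - h x| ≤ (y - x) * (v y - v x)) {y : ℝ} (hy : 0 ≤ y) :
    h y = h 0 := by
  -- Cut `[0, y]` into `N` pieces of length `y / N`: the increments of `v` telescope, leaving a
  -- bound that tends to `0`.
  have key : ∀ N : ℕ, 0 < N → |h y - h 0| ≤ y / N * (v y - v 0) := by
    intro N hN
    have hN' : (0 : ℝ) < N := by exact_mod_cast hN
    have ind : ∀ k : ℕ, |h (k * (y / N)) - h 0| ≤ y / N * (v (k * (y / N)) - v 0) := by
      intro k
      induction k with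
      | zero => simp
      | succ k ih =>
        have h0 : 0 ≤ y / N := by positivity
        have h1 := hh (k * (y / N)) ((k + 1 : ℕ) * (y / N)) (by positivity) (by push_cast; nlinarith)
        have h2 : ((k + 1 : ℕ) : ℝ) * (y / N) - k * (y / N) = y / N := by push_cast; ring
        rw [h2] at h1
        have h3 := abs_sub_le (h ((k + 1 : ℕ) * (y / N))) (h (k * (y / N))) (h 0)
        linarith
    have := ind N
    rwa [mul_div_cancel₀ _ hN'.ne'] at this
  have hlim : Tendsto (fun N : ℕ => y / N * (v y - v 0)) atTop (𝓝 0) := by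
    simpa using (tendsto_const_div_atTop_nhds_zero_nat y).mul_const (v y - v 0)
  have : |h y - h 0| ≤ 0 :=
    ge_of_tendsto hlim ((eventually_gt_atTop 0).mono fun N hN => key N hN)
  exact sub_eq_zero.1 (abs_nonpos_iff.1 this)

section SpectralTheorem

variable {E : Type*} [NormedAddCommGroup E] [InnerProductSpace ℂ E] [CompleteSpace E]

/-- The function `(1 + t)⁻¹`, extended by `1` to the negative half line. -/
def resolventFun (t : ℝ) : ℝ := (1 + max t 0)⁻¹

lemma resolventFun_pos (t : ℝ) : 0 < resolventFun t := by
  unfold resolventFun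
  positivity

lemma resolventFun_le_one (t : ℝ) : resolventFun t ≤ 1 :=
  inv_le_one_of_one_le₀ (by linarith [le_max_right t 0])

lemma isBddMeas_resolventFun : IsBddMeas resolventFun := by
  refine ⟨by unfold resolventFun; fun_prop, 1, fun t => ?_⟩
  rw [abs_of_pos (resolventFun_pos t)]
  exact resolventFun_le_one t

lemma resolventFun_anti : Antitone resolventFun := by
  intro s t h
  unfold resolventFun
  gcongr

lemma resolventFun_of_nonneg {t : ℝ} (h : 0 ≤ t) : resolventFun t = (1 + t)⁻¹ := by
  rw [resolventFun, max_eq_left h]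

lemma IsSpectralFamily.scalarMeasure_Iio_zero {P : ℝ → E →L[ℂ] E} (hP : IsSpectralFamily P)
    (h : ∀ t < 0, P t = 0) (f : E) : ∀ᵐ t ∂(scalarMeasure P f), 0 ≤ t := by
  have h0 : scalarMeasure P f (Iio 0) = 0 := by
    have : Iio (0 : ℝ) = ⋃ n : ℕ, Iic (-(1 / ((n : ℝ) + 1))) := by
      ext t
      simp only [mem_Iio, mem_iUnion, mem_Iic]
      constructor
      · intro ht
        obtain ⟨n, hn⟩ := exists_nat_one_div_lt (neg_pos.2 ht)
        exact ⟨n, by linarith⟩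
      · rintro ⟨n, hn⟩
        have : (0 : ℝ) < 1 / ((n : ℝ) + 1) := Nat.one_div_pos_of_nat
        linarith
    rw [this, measure_iUnion_null_iff]
    intro n
    have hn : -(1 / ((n : ℝ) + 1)) < 0 := neg_lt_zero.2 Nat.one_div_pos_of_nat
    rw [hP.scalarMeasure_Iic, h _ hn]
    simp
  rw [ae_iff]
  simp only [not_le]
  exact h0

variable {B : E →L[ℂ] E}

lemma resolventFamily_incr_bounds (hB : IsSelfAdjoint B) {x y : ℝ} (h : x ≤ y) (f : E) :
    levelFun y * ‖resolventFamily B y f - resolventFamily B x f‖ ^ 2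
      ≤ (inner ℂ (resolventFamily B y f - resolventFamily B x f)
          (B (resolventFamily B y f - resolventFamily B x f))).re ∧
    (inner ℂ (resolventFamily B y f - resolventFamily B x f)
          (B (resolventFamily B y f - resolventFamily B x f))).re
      ≤ levelFun x * ‖resolventFamily B y f - resolventFamily B x f‖ ^ 2 := by
  constructor
  · refine le_re_inner_of_mem hB (sub_mem (Submodule.starProjection_apply_mem _ _) ?_)
    exact specSubspace_anti B (levelFun_strictAnti.antitone h) (Submodule.starProjection_apply_mem _ _)
  · refine re_inner_le_of_mem_orthogonal hB ?_
    have h1 : resolventFamily B x (resolventFamily B y f) = resolventFamily B x f :=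
      congrArg (fun T => T f) (resolventFamily_mono B h)
    rw [← h1]
    exact Submodule.sub_starProjection_mem_orthogonal _

/-- Both `⟨P_t f, B P_t f⟩` and `∫_{]-∞,t]} (1 + s)⁻¹ dm_f` have increments over `]x, y]`, `0 ≤ x ≤
y`, between `(1 + y)⁻¹ m_f(]x, y])` and `(1 + x)⁻¹ m_f(]x, y])`. By `eq_of_abs_sub_le_mul` their
difference `h` is constant on the positive half line; it vanishes at `0`, and `t → ∞` gives the
claim. -/
lemma resolventFamily_eq_calc (hpos : 0 ≤ B)
    (hB1 : ∀ f, (inner ℂ f (B f)).re ≤ ‖f‖ ^ 2) (hinj : ∀ f, B f = 0 → f = 0) :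
    B = borelCalc (resolventFamily B) resolventFun := by
  have hB : IsSelfAdjoint B := IsSelfAdjoint.of_nonneg hpos
  have hP := isSpectralFamily_resolventFamily hpos hB1 hinj
  have hneg : ∀ t < 0, resolventFamily B t = 0 := fun t ht => resolventFamily_of_neg hB hB1 ht
  set P := resolventFamily B with hPdef
  have hcomm : ∀ t f, P t (B f) = B (P t f) := fun t f => starProjection_commute hB _ f
  have hsymm : ∀ f g, inner ℂ (B f) g = inner ℂ f (B g) := fun f g => by
    rw [← ContinuousLinearMap.adjoint_inner_right, ContinuousLinearMap.isSelfAdjoint_iff'.1 hB]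
  refine clm_ext_of_inner_self fun f => ?_
  have hfin := hP.isFiniteMeasure f
  rw [hP.inner_calc_self isBddMeas_resolventFun]
  apply Complex.ext
  swap
  · rw [Complex.ofReal_im, ← Complex.conj_eq_iff_im, inner_conj_symm, hsymm]
  rw [Complex.ofReal_re]
  have hint := isBddMeas_resolventFun.integrable (scalarMeasure P f)
  let h : ℝ → ℝ := fun t => (inner ℂ (P t f) (B (P t f))).re
    - ∫ s in Iic t, resolventFun s ∂(scalarMeasure P f)
  have hincr : ∀ x y, x ≤ y → ‖P y f - P x f‖ ^ 2 = (scalarMeasure P f).real (Ioc x y) := by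
    intro x y hxy
    rw [← Iic_sdiff_Iic, measureReal_sdiff (Iic_subset_Iic.2 hxy) measurableSet_Iic, hP.real_Iic,
      hP.real_Iic]
    have := norm_sub_sq (𝕜 := ℂ) (P y f) (P x f)
    rw [hP.inner_proj_proj, min_eq_right hxy, hP.inner_proj, RCLike.re_to_complex,
      Complex.ofReal_re] at this
    linarith
  have hstep : ∀ x y, 0 ≤ x → x ≤ y →
      |h y - h x| ≤ (y - x) * (‖P y f‖ ^ 2 - ‖P x f‖ ^ 2) := by
    intro x y hx hxy
    have hb := resolventFamily_incr_bounds hB hxy f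
    rw [← hPdef, hincr x y hxy, levelFun_of_nonneg hx, levelFun_of_nonneg (hx.trans hxy)] at hb
    have hm : (scalarMeasure P f).real (Ioc x y) = ‖P y f‖ ^ 2 - ‖P x f‖ ^ 2 := by
      rw [← Iic_sdiff_Iic, measureReal_sdiff (Iic_subset_Iic.2 hxy) measurableSet_Iic, hP.real_Iic,
        hP.real_Iic]
    have hq : (inner ℂ (P y f - P x f) (B (P y f - P x f))).re
        = (inner ℂ (P y f) (B (P y f))).re - (inner ℂ (P x f) (B (P x f))).re := by
      have e1 : inner ℂ (P y f) (B (P x f)) = inner ℂ (P x f) (B (P x f)) := by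
        simp only [← hcomm, hP.inner_proj_proj, min_eq_right hxy, min_self]
      have e2 : inner ℂ (P x f) (B (P y f)) = inner ℂ (P x f) (B (P x f)) := by
        simp only [← hcomm, hP.inner_proj_proj, min_eq_left hxy, min_self]
      rw [map_sub, inner_sub_left, inner_sub_right, inner_sub_right, e1, e2]
      simp
    have hI : ∫ s in Iic y, resolventFun s ∂(scalarMeasure P f)
        = ∫ s in Iic x, resolventFun s ∂(scalarMeasure P f)
          + ∫ s in Ioc x y, resolventFun s ∂(scalarMeasure P f) := by
      rw [← Iic_union_Ioc_eq_Iic hxy, setIntegral_union (Iic_disjoint_Ioc le_rfl) measurableSet_Ioc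
        hint.integrableOn hint.integrableOn]
    have hI1 : (1 + y)⁻¹ * (scalarMeasure P f).real (Ioc x y)
        ≤ ∫ s in Ioc x y, resolventFun s ∂(scalarMeasure P f) := by
      refine setIntegral_ge_of_const_le_real measurableSet_Ioc (measure_ne_top _ _) (fun s hs => ?_)
        hint.integrableOn
      rw [← resolventFun_of_nonneg (hx.trans hxy)]
      exact resolventFun_anti hs.2
    have hI2 : ∫ s in Ioc x y, resolventFun s ∂(scalarMeasure P f)
        ≤ (1 + x)⁻¹ * (scalarMeasure P f).real (Ioc x y) := by
      refine (setIntegral_mono_on hint.integrableOn (g := fun _ => (1 + x)⁻¹)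
        (integrable_const _).integrableOn measurableSet_Ioc fun s hs => ?_).trans_eq ?_
      · rw [← resolventFun_of_nonneg hx]
        exact resolventFun_anti hs.1.le
      · rw [setIntegral_const, smul_eq_mul, mul_comm]
    have hc : (1 + x)⁻¹ - (1 + y)⁻¹ ≤ y - x := by
      have hx1 : 0 < 1 + x := by linarith
      have hy1 : 0 < 1 + y := by linarith
      rw [inv_sub_inv hx1.ne' hy1.ne', div_le_iff₀ (by positivity)]
      nlinarith [mul_nonneg hx (hx.trans hxy)]
    have hm0 : 0 ≤ (scalarMeasure P f).real (Ioc x y) := measureReal_nonneg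
    have : |h y - h x| ≤ ((1 + x)⁻¹ - (1 + y)⁻¹) * (scalarMeasure P f).real (Ioc x y) := by
      simp only [h]
      rw [abs_le]
      constructor <;> nlinarith
    rw [← hm]
    exact this.trans (mul_le_mul_of_nonneg_right hc hm0)
  have hconst : ∀ y, 0 ≤ y → h y = h 0 := fun y hy => eq_of_abs_sub_le_mul hstep hy
  -- On `]-∞, 0]` the integrand is `1`, and `B` has form equal to `‖·‖²` on the range of `P 0`,
  -- being at least `1` there and at most `1` everywhere.
  have hzero : h 0 = 0 := by
    have h1 : ∫ s in Iic 0, resolventFun s ∂(scalarMeasure P f) = ‖P 0 f‖ ^ 2 := by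
      rw [← hP.real_Iic, setIntegral_congr_fun (g := fun _ => (1 : ℝ)) measurableSet_Iic]
      · simp
      · intro s hs
        simp [resolventFun, max_eq_right (show s ≤ 0 from hs)]
    have h2 := le_re_inner_of_mem hB (Submodule.starProjection_apply_mem (specSubspace B (levelFun 0)) f)
    have h3 := hB1 (P 0 f)
    change levelFun 0 * ‖P 0 f‖ ^ 2 ≤ (inner ℂ (P 0 f) (B (P 0 f))).re at h2
    rw [levelFun_of_nonneg le_rfl, add_zero, inv_one, one_mul] at h2
    simp only [h, h1]
    linarith
  have hlim : Tendsto h atTop (𝓝 ((inner ℂ f (B f)).re - ∫ t, resolventFun t ∂(scalarMeasure P f))) := by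
    refine Tendsto.sub ?_ ?_
    · have h1 := hP.tendsto_atTop f
      exact (Complex.continuous_re.tendsto _).comp (h1.inner ((B.continuous.tendsto _).comp h1))
    · have h1 := tendsto_setIntegral_of_monotone (μ := scalarMeasure P f) (f := resolventFun)
        (s := fun t : ℝ => Iic t) (fun t => measurableSet_Iic) (fun s t h => Iic_subset_Iic.2 h)
        hint.integrableOn
      rwa [iUnion_Iic, setIntegral_univ] at h1
  have := tendsto_nhds_unique hlim (tendsto_const_nhds.congr' (f₁ := fun _ => (0 : ℝ)) ?_)
  · linarith
  · filter_upwards [eventually_ge_atTop 0] with t ht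
    rw [hconst t ht, hzero]

/-- The spectral theorem for positive self-adjoint operators. -/
theorem exists_spectralFamily {A : E →ₗ.[ℂ] E} (hA : IsSelfAdjoint A)
    (hpos : ∀ f : A.domain, 0 ≤ (inner ℂ (f : E) (A f)).re) :
    ∃ P : ℝ → E →L[ℂ] E, IsSpectralFamily P ∧ IsSpectralIntegral P id A := by
  obtain ⟨B, hBpos, hB1, hBA, hAB⟩ := exists_resolvent hA hpos
  have hB0 : 0 ≤ B := (ContinuousLinearMap.nonneg_iff_isPositive _).2 hBpos
  have hB : IsSelfAdjoint B := hBpos.isSelfAdjoint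
  have hinj : ∀ f, B f = 0 → f = 0 := by
    intro f hf
    obtain ⟨h, h2⟩ := hBA f
    have h3 : (⟨B f, h⟩ : A.domain) = 0 := Subtype.ext hf
    rw [h3, LinearPMap.map_zero, hf, sub_zero] at h2
    exact h2.symm
  have hP := isSpectralFamily_resolventFamily hB0 hB1 hinj
  have hcalc := resolventFamily_eq_calc hB0 hB1 hinj
  have hneg : ∀ t < 0, resolventFamily B t = 0 := fun t ht => resolventFamily_of_neg hB hB1 ht
  set P := resolventFamily B
  have hae := hP.scalarMeasure_Iio_zero hneg
  have hmeas : ∀ g, scalarMeasure P (B g)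
      = (scalarMeasure P g).withDensity fun t => ENNReal.ofReal (resolventFun t ^ 2) := fun g => by
    rw [← hP.scalarMeasure_calc isBddMeas_resolventFun, ← hcalc]
  have hr2 : Measurable fun t => ENNReal.ofReal (resolventFun t ^ 2) :=
    (isBddMeas_resolventFun.1.pow_const 2).ennreal_ofReal
  have hfin := hP.isFiniteMeasure
  refine ⟨P, hP, ⟨fun f => ⟨fun hf => ?_, fun hf => ?_⟩, fun f => ?_⟩⟩
  -- With `f = B g`, the measure `m_f` has density `(1 + t)⁻²` with respect to `m_g`, and `t² (1 +
  -- t)⁻² ≤ 1`.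
  · obtain ⟨g, hg⟩ : ∃ g, g = f + A ⟨f, hf⟩ := ⟨_, rfl⟩
    have hfB : f = B g := by rw [hg, hAB ⟨f, hf⟩]
    rw [hfB, hmeas, lintegral_withDensity_eq_lintegral_mul _ hr2 (by fun_prop)]
    refine lt_of_le_of_lt (b := ∫⁻ _, 1 ∂(scalarMeasure P g)) (lintegral_mono_ae ?_) ?_
    · filter_upwards [hae g] with t ht
      rw [Pi.mul_apply, ← ENNReal.ofReal_mul (sq_nonneg _), ← mul_pow, id, ← ENNReal.ofReal_one,
        resolventFun_of_nonneg ht]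
      refine ENNReal.ofReal_le_ofReal (pow_le_one₀ (by positivity) ?_)
      rw [inv_mul_le_iff₀ (by linarith)]
      linarith
    · rw [lintegral_one]
      exact measure_lt_top _ _
  -- Conversely let `g = φ(P) f`, where `φ(t) = t` almost everywhere. The functions `(1 + t⁺)⁻¹ (1 +
  -- trunc φ n t)` tend boundedly to `1`, so `f = B (f + g)`, which lies in the range of `B` and
  -- hence in the domain.
  · let φ : ℝ → ℝ := fun t => max t 0
    have hφ : Measurable φ := by fun_prop
    have hdom : f ∈ (spectralIntegral P φ).domain := by
      rw [hP.mem_domain_spectralIntegral hφ]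
      refine lt_of_le_of_lt (lintegral_mono_ae ?_) hf
      filter_upwards [hae f] with t ht
      simp only [φ, max_eq_left ht, id, le_refl]
    have hlim := IsSpectralFamily.tendsto_spectralIntegral (P := P) (φ := φ) ⟨f, hdom⟩
    obtain ⟨g, hg⟩ : ∃ g, spectralIntegral P φ ⟨f, hdom⟩ = g := ⟨_, rfl⟩
    rw [hg] at hlim
    have hle : ∀ (n : ℕ) t, 0 ≤ trunc φ n t ∧ trunc φ n t ≤ max t 0 := by
      intro n t
      rcases le_or_gt |φ t| n with h | h
      · rw [trunc_of_le h]
        exact ⟨le_max_right _ _, le_rfl⟩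
      · rw [trunc_of_lt h]
        exact ⟨le_rfl, le_max_right _ _⟩
    have hF : ∀ n, IsBddMeas fun t => resolventFun t * (1 - (0 - trunc φ n t)) := fun n =>
      isBddMeas_resolventFun.mul ((IsBddMeas.const 1).sub ((IsBddMeas.const 0).sub (isBddMeas_trunc hφ n)))
    have hcl := hP.tendsto_calc (ψ := fun _ => 1) hF (IsBddMeas.const 1) (C := 1) (fun n t => by
        have h1 := hle n t
        have h2 : 0 < 1 + max t 0 := by positivity
        rw [resolventFun, abs_of_nonneg (mul_nonneg (by positivity) (by linarith)),
          inv_mul_le_iff₀ h2]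
        linarith) (fun t => by
        have h1 := (((tendsto_trunc (φ := φ) t).const_sub 0).const_sub 1).const_mul (resolventFun t)
        have h2 : resolventFun t * (1 - (0 - φ t)) = 1 := by
          have h2 : 0 < 1 + max t 0 := by positivity
          rw [resolventFun, sub_eq_add_neg, neg_sub, sub_zero, inv_mul_cancel₀ h2.ne']
        rwa [h2] at h1) f
    have hF2 : ∀ n, borelCalc P (fun t => resolventFun t * (1 - (0 - trunc φ n t))) f
        = B (f + borelCalc P (trunc φ n) f) := by
      intro n
      have h1 := (IsBddMeas.const 0).sub (isBddMeas_trunc hφ n)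
      have h0 : borelCalc P (fun _ => 0) = 0 := by
        have := hP.calc_sub (IsBddMeas.const 1) (IsBddMeas.const 1)
        simpa using this
      conv_rhs => rw [hcalc]
      rw [← hP.calc_calc isBddMeas_resolventFun ((IsBddMeas.const 1).sub h1),
        hP.calc_sub (IsBddMeas.const 1) h1, hP.calc_sub (IsBddMeas.const 0) (isBddMeas_trunc hφ n),
        hP.calc_one, h0]
      simp
    simp only [hF2] at hcl
    rw [hP.calc_one, one_apply_eq_self] at hcl
    have hcl2 := (B.continuous.tendsto _).comp (hlim.const_add f)
    have := tendsto_nhds_unique hcl hcl2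
    obtain ⟨h, -⟩ := hBA (f + g)
    rwa [← this] at h
  -- With `b = (1 + t)⁻¹` and `f = B g`, `⟨f, A f⟩ = ⟨B g, g - B g⟩ = ∫ b (1 - b) dm_g`, and `b (1 -
  -- b) = t b²` is the density needed for `∫ t dm_f`.
  · have hAf : A f = ((f : E) + A f) - (f : E) := by abel
    obtain ⟨g, hg⟩ : ∃ g, g = (f : E) + A f := ⟨_, rfl⟩
    have hfB : (f : E) = B g := by rw [hg, hAB]
    rw [hAf, ← hg, hfB, hmeas, integral_withDensity_eq_integral_toReal_smul hr2
      (Eventually.of_forall fun _ => ENNReal.ofReal_lt_top)]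
    have h1 : inner ℂ (B g) (g - B g)
        = inner ℂ g (borelCalc P (fun t => resolventFun t * (1 - resolventFun t)) g) := by
      have h2 := (IsBddMeas.const 1).sub isBddMeas_resolventFun
      rw [← hP.calc_calc isBddMeas_resolventFun h2, hP.calc_sub (IsBddMeas.const 1) isBddMeas_resolventFun,
        hP.calc_one, ← hcalc, ← ContinuousLinearMap.adjoint_inner_left,
        ContinuousLinearMap.isSelfAdjoint_iff'.1 hB]
      rfl
    rw [h1, hP.inner_calc_self (isBddMeas_resolventFun.mul ((IsBddMeas.const 1).sub isBddMeas_resolventFun))]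
    congr 1
    refine integral_congr_ae ?_
    filter_upwards [hae g] with t ht
    rw [ENNReal.toReal_ofReal (sq_nonneg _), smul_eq_mul, id, resolventFun_of_nonneg ht]
    have : (1 + t) ≠ 0 := by positivity
    field_simp
    ring

/-- Existence makes the choice in `spectralFamily` meaningful. The sequel uses only these two
properties, so uniqueness of the family is not required. -/
lemma isSpectralFamily_spectralFamily {A : E →ₗ.[ℂ] E} (hA : IsSelfAdjoint A)
    (hpos : ∀ f : A.domain, 0 ≤ (inner ℂ (f : E) (A f)).re) :
    IsSpectralFamily (spectralFamily A) ∧ IsSpectralIntegral (spectralFamily A) id A := by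
  have h := exists_spectralFamily hA hpos
  rw [spectralFamily, dif_pos h]
  exact h.choose_spec

end SpectralTheorem

/-! ## Positivity, kernel and energy -/

section Positivity

variable {E : Type*} [NormedAddCommGroup E] [InnerProductSpace ℂ E] [CompleteSpace E]
variable {P : ℝ → E →L[ℂ] E} {A : E →ₗ.[ℂ] E}

lemma IsSpectralFamily.ae_mem_of_calc_indicator (hP : IsSpectralFamily P) {s : Set ℝ}
    (hs : MeasurableSet s) (f : E) :
    ∀ᵐ t ∂(scalarMeasure P (borelCalc P (s.indicator fun _ => 1) f)), t ∈ s := by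
  have h1 := IsBddMeas.indicator_one hs
  rw [hP.scalarMeasure_calc h1, ae_withDensity_iff (h1.1.pow_const 2).ennreal_ofReal]
  refine Eventually.of_forall fun t ht => ?_
  by_contra hc
  simp [hc] at ht

lemma IsSpectralFamily.calc_indicator_Ioc (hP : IsSpectralFamily P) {s t : ℝ} (h : s ≤ t) :
    borelCalc P ((Ioc s t).indicator fun _ => 1) = P t - P s := by
  rw [← hP.calc_indicator_Iic t, ← hP.calc_indicator_Iic s,
    ← hP.calc_sub (IsBddMeas.indicator_one measurableSet_Iic) (IsBddMeas.indicator_one measurableSet_Iic)]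
  congr 1
  ext u
  by_cases h1 : u ≤ s
  · simp [h1, h1.trans h]
  · by_cases h2 : u ≤ t
    · simp [h1, h2, not_le.1 h1]
    · simp [h1, h2]

/-- For `s < t < 0` the vector `g = P_t f - P_s f` has spectral measure carried by `]s, t]`, so `0 ≤
⟨g, A g⟩ ≤ t ‖g‖²` forces `g = 0`; then `s → -∞`. -/
lemma proj_eq_zero_of_neg (hP : IsSpectralFamily P) (hPA : IsSpectralIntegral P id A)
    (hpos : ∀ f : A.domain, 0 ≤ (inner ℂ (f : E) (A f)).re) {t : ℝ} (ht : t < 0) : P t = 0 := by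
  have hfin := hP.isFiniteMeasure
  ext f
  have key : ∀ s < t, P s f = P t f := by
    intro s hs
    obtain ⟨g, hg⟩ : ∃ g, g = P t f - P s f := ⟨_, rfl⟩
    have hae : ∀ᵐ u ∂(scalarMeasure P g), u ∈ Ioc s t := by
      have := hP.ae_mem_of_calc_indicator (measurableSet_Ioc (a := s) (b := t)) f
      rwa [hP.calc_indicator_Ioc hs.le, sub_apply, ← hg] at this
    have hbd : ∀ᵐ u ∂(scalarMeasure P g), u ^ 2 ≤ s ^ 2 := by
      filter_upwards [hae] with u hu
      nlinarith [hu.1, hu.2]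
    have hdom : g ∈ A.domain := by
      rw [hPA.mem_domain_iff]
      refine lt_of_le_of_lt (lintegral_mono_ae (g := fun _ => ENNReal.ofReal (s ^ 2)) ?_) ?_
      · filter_upwards [hbd] with u hu
        exact ENNReal.ofReal_le_ofReal hu
      · rw [lintegral_const]
        exact ENNReal.mul_lt_top ENNReal.ofReal_lt_top (measure_lt_top _ _)
    have h1 := hpos ⟨g, hdom⟩
    rw [hPA.inner_eq, Complex.ofReal_re] at h1
    have h2 : ∫ u, id u ∂(scalarMeasure P g) ≤ ∫ _, t ∂(scalarMeasure P g) := by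
      refine integral_mono_ae (Integrable.of_bound (C := |s|) measurable_id.aestronglyMeasurable ?_)
        (integrable_const _) ?_
      · filter_upwards [hbd] with u hu
        exact sq_le_sq.1 hu
      · filter_upwards [hae] with u hu
        exact hu.2
    rw [integral_const, hP.real_univ, smul_eq_mul] at h2
    have h3 : ‖g‖ ^ 2 = 0 := by nlinarith [sq_nonneg ‖g‖]
    have h4 := norm_eq_zero.1 (pow_eq_zero_iff two_ne_zero |>.1 h3)
    rw [hg, sub_eq_zero] at h4
    exact h4.symm
  refine tendsto_nhds_unique (tendsto_const_nhds.congr' ?_) (hP.tendsto_atBot f)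
  filter_upwards [eventually_lt_atBot t] with s hs
  exact (key s hs).symm

lemma eq_zero_of_inner_self_eq_zero (hA : IsSelfAdjoint A)
    (hpos : ∀ f : A.domain, 0 ≤ (inner ℂ (f : E) (A f)).re) {f : A.domain}
    (h : (inner ℂ (f : E) (A f)).re = 0) : A f = 0 := by
  have key : ∀ g : A.domain, (inner ℂ (g : E) (A f)).re = 0 := by
    intro g
    have h1 : ∀ c : ℝ, 0 ≤ 2 * c * (inner ℂ (g : E) (A f)).re + c ^ 2 * (inner ℂ (g : E) (A g)).re := by
      intro c
      have h2 := hpos (f + (c : ℂ) • g)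
      have h3 : (inner ℂ (f : E) (A g)).re = (inner ℂ (g : E) (A f)).re := by
        rw [← inner_symm_of_isSelfAdjoint hA, ← inner_conj_symm, Complex.conj_re]
      rw [LinearPMap.map_add, LinearPMap.map_smul, Submodule.coe_add, Submodule.coe_smul,
        inner_add_left, inner_add_right, inner_add_right, inner_smul_left, inner_smul_left,
        inner_smul_right, inner_smul_right, Complex.conj_ofReal] at h2
      simp only [Complex.add_re, Complex.re_ofReal_mul, h, h3] at h2
      linarith
    have hg := hpos g
    obtain ⟨a, ha⟩ : ∃ a, a = (inner ℂ (g : E) (A f)).re := ⟨_, rfl⟩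
    obtain ⟨q, hq⟩ : ∃ q, q = (inner ℂ (g : E) (A g)).re := ⟨_, rfl⟩
    rw [← ha, ← hq] at h1
    rw [← hq] at hg
    rw [← ha]
    -- Near the minimum of `2 c a + c² q`; the denominator `q + 1` avoids dividing by `q = 0`, and
    -- the value is still negative unless `a = 0`.
    have h4 := h1 (-(a / (q + 1)))
    have h5 : 2 * -(a / (q + 1)) * a + (-(a / (q + 1))) ^ 2 * q
        = -(a ^ 2 * (q + 2) / (q + 1) ^ 2) := by
      field_simp
      ring
    rw [h5] at h4
    by_contra hne
    have : 0 < a ^ 2 * (q + 2) / (q + 1) ^ 2 := by positivity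
    linarith
  refine hA.dense_domain.eq_zero_of_inner_right ℂ fun g hg => ?_
  apply Complex.ext
  · exact key ⟨g, hg⟩
  · have := key (Complex.I • ⟨g, hg⟩)
    rw [Submodule.coe_smul, re_inner_I_smul] at this
    exact this

/-- The spectral measure of `P 0 f` is carried by `{0}`, so its energy vanishes. This is how the
hypothesis on `ker A` becomes `P_0 ρ^{1/2} = 0`. -/
lemma proj_zero_mem_ker (hA : IsSelfAdjoint A) (hP : IsSpectralFamily P)
    (hPA : IsSpectralIntegral P id A)
    (hpos : ∀ f : A.domain, 0 ≤ (inner ℂ (f : E) (A f)).re) (f : E) :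
    ∃ h : P 0 f ∈ A.domain, A ⟨P 0 f, h⟩ = 0 := by
  have hae : ∀ᵐ u ∂(scalarMeasure P (P 0 f)), u = 0 := by
    have h1 := hP.ae_mem_of_calc_indicator (measurableSet_Iic (a := (0 : ℝ))) f
    rw [hP.calc_indicator_Iic] at h1
    filter_upwards [h1, hP.scalarMeasure_Iio_zero (fun t ht => proj_eq_zero_of_neg hP hPA hpos ht) (P 0 f)]
      with u hu1 hu2
    exact le_antisymm hu1 hu2
  have hdom : P 0 f ∈ A.domain := by
    rw [hPA.mem_domain_iff, lintegral_congr_ae (g := fun _ => 0)]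
    · simp
    · filter_upwards [hae] with u hu
      simp [hu]
  refine ⟨hdom, eq_zero_of_inner_self_eq_zero hA hpos ?_⟩
  rw [hPA.inner_eq, Complex.ofReal_re, integral_congr_ae (g := fun _ => 0)]
  · simp
  · filter_upwards [hae] with u hu
    simp [hu]

lemma opSqrt_proj_zero (hA : IsSelfAdjoint A) (hP : IsSpectralFamily P)
    (hPA : IsSpectralIntegral P id A) (hpos : ∀ f : A.domain, 0 ≤ (inner ℂ (f : E) (A f)).re)
    {ρ : E →L[ℂ] E} (hρ : ρ.IsPositive) (hker : ∀ f : A.domain, A f = 0 → ρ (f : E) = 0) (f : E) :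
    opSqrt ρ (P 0 f) = 0 := by
  obtain ⟨h1, h2⟩ := proj_zero_mem_ker hA hP hPA hpos f
  have h3 := norm_opSqrt_sq hρ (P 0 f)
  rw [hker ⟨_, h1⟩ h2, inner_zero_right, Complex.zero_re] at h3
  exact norm_eq_zero.1 (pow_eq_zero_iff two_ne_zero |>.1 h3)

lemma proj_zero_opSqrt (hA : IsSelfAdjoint A) (hP : IsSpectralFamily P)
    (hPA : IsSpectralIntegral P id A) (hpos : ∀ f : A.domain, 0 ≤ (inner ℂ (f : E) (A f)).re)
    {ρ : E →L[ℂ] E} (hρ : ρ.IsPositive) (hker : ∀ f : A.domain, A f = 0 → ρ (f : E) = 0) (f : E) :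
    P 0 (opSqrt ρ f) = 0 := by
  refine ext_inner_left ℂ fun g => ?_
  rw [← hP.proj_symm, inner_opSqrt, opSqrt_proj_zero hA hP hPA hpos hρ hker, inner_zero_left,
    inner_zero_right]

lemma energy_eq_iSup (hP : IsSpectralFamily (spectralFamily A)) (f : E) :
    energy A f = ⨆ n, ‖borelCalc (spectralFamily A) (trunc Real.sqrt n) f‖ₑ ^ 2 := by
  rw [hP.iSup_enorm_sq_trunc Real.continuous_sqrt.measurable, energy]
  refine lintegral_congr fun t => ?_
  rcases le_total 0 t with h | h
  · rw [Real.sq_sqrt h]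
  · rw [Real.sqrt_eq_zero_of_nonpos h, ENNReal.ofReal_of_nonpos h]
    simp

end Positivity

/-! ## Hilbert--Schmidt norms -/

section HilbertSchmidt

variable {E : Type*} [NormedAddCommGroup E] [InnerProductSpace ℂ E] [CompleteSpace E]

/-- The square of the Hilbert--Schmidt norm. -/
def hsSq (T : E →L[ℂ] E) : ℝ≥0∞ := formTrace fun f => ‖T f‖ₑ ^ 2

lemma hsSq_adjoint (T : E →L[ℂ] E) : hsSq (ContinuousLinearMap.adjoint T) = hsSq T :=
  (formTrace_adjoint T).symm

lemma adjoint_opSqrt (T : E →L[ℂ] E) : ContinuousLinearMap.adjoint (opSqrt T) = opSqrt T := by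
  symm
  rw [ContinuousLinearMap.eq_adjoint_iff]
  exact fun x y => (inner_opSqrt T x y).symm

lemma adjoint_mul (S T : E →L[ℂ] E) : ContinuousLinearMap.adjoint (S * T)
    = ContinuousLinearMap.adjoint T * ContinuousLinearMap.adjoint S :=
  ContinuousLinearMap.adjoint_comp S T

lemma hsSq_mul_le {S : E →L[ℂ] E} (hS : ∀ f, ‖S f‖ ≤ ‖f‖) (T : E →L[ℂ] E) :
    hsSq (S * T) ≤ hsSq T := by
  refine ENNReal.tsum_le_tsum fun i => ?_
  simp only [mul_apply_eq_comp]
  gcongr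
  exact enorm_le_iff_norm_le.2 (hS _)

/-- Parseval's identity. -/
lemma enorm_sq_eq_tsum {ι : Type*} (b : HilbertBasis ι ℂ E) (x : E) :
    ‖x‖ₑ ^ 2 = ∑' i, ‖inner ℂ (b i) x‖ₑ ^ 2 := by
  have h2 : HasSum (fun i => ‖inner ℂ (b i) x‖ ^ 2) (‖x‖ ^ 2) := by
    have h3 := Complex.hasSum_re (b.hasSum_inner_mul_inner x x)
    convert h3 using 1
    · ext i
      rw [← inner_conj_symm x, mul_comm, Complex.mul_conj, Complex.ofReal_re,
        Complex.normSq_eq_norm_sq]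
    · exact norm_sq_eq_re_inner (𝕜 := ℂ) x
  have h4 : ∀ y : ℂ, ‖y‖ₑ ^ 2 = ENNReal.ofReal (‖y‖ ^ 2) := fun y => by
    rw [ENNReal.ofReal_pow (norm_nonneg _), ofReal_norm]
  simp_rw [h4]
  rw [← ENNReal.ofReal_tsum_of_nonneg (fun i => by positivity) h2.summable, h2.tsum_eq,
    ENNReal.ofReal_pow (norm_nonneg _), ofReal_norm]

lemma enorm_inner_comm (x y : E) : ‖inner ℂ x y‖ₑ = ‖inner ℂ y x‖ₑ := by
  rw [← inner_conj_symm]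
  exact RCLike.enorm_conj _

lemma enorm_apply_sq_le (T : E →L[ℂ] E) (f : E) : ‖T f‖ₑ ^ 2 ≤ hsSq T * ‖f‖ₑ ^ 2 := by
  rw [enorm_sq_eq_tsum (stdBasis E) (T f), ← hsSq_adjoint, hsSq, formTrace, ← ENNReal.tsum_mul_right]
  refine ENNReal.tsum_le_tsum fun i => ?_
  rw [← ContinuousLinearMap.adjoint_inner_left, ← mul_pow]
  gcongr
  rw [← ofReal_norm, ← ofReal_norm, ← ofReal_norm, ← ENNReal.ofReal_mul (norm_nonneg _)]
  exact ENNReal.ofReal_le_ofReal (norm_inner_le_norm _ _)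

end HilbertSchmidt

/-! ## Stieltjes integrals of `1 / t` -/

/-- `∫_t^l ds / s² = 1/t - 1/l`, with `t` appearing only in an indicator so that Tonelli's theorem
can be applied. -/
lemma inv_eq_add_lintegral {t l : ℝ} (ht : 0 < t) (hl : t ≤ l) :
    (ENNReal.ofReal t)⁻¹ = ENNReal.ofReal l⁻¹
      + ∫⁻ s in Ioc 0 l, ENNReal.ofReal (s ^ 2)⁻¹ * (Ici t).indicator 1 s := by
  have h1 : ∫⁻ s in Ioc 0 l, ENNReal.ofReal (s ^ 2)⁻¹ * (Ici t).indicator 1 s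
      = ∫⁻ s in Icc t l, ENNReal.ofReal (s ^ 2)⁻¹ := by
    rw [← lintegral_indicator measurableSet_Ioc, ← lintegral_indicator measurableSet_Icc]
    refine lintegral_congr fun s => ?_
    by_cases h1 : t ≤ s
    · by_cases h2 : s ≤ l
      · simp [h1, h2, ht.trans_le h1]
      · simp [h2]
    · by_cases h2 : 0 < s ∧ s ≤ l <;> simp [h1, indicator, h2]
  have h2 : ∫ s in t..l, (s ^ 2)⁻¹ = t⁻¹ - l⁻¹ := by
    have h := integral_zpow (a := t) (b := l) (n := -2) (Or.inr ⟨by norm_num, by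
      rw [uIcc_of_le hl]
      exact fun h => absurd h.1 (not_le.2 ht)⟩)
    have h0 : ∀ s : ℝ, s ^ (-2 : ℤ) = (s ^ 2)⁻¹ := fun s => by
      rw [zpow_neg]; norm_cast
    simp only [h0] at h
    rw [h]
    norm_num
    ring
  have hint : IntegrableOn (fun s : ℝ => (s ^ 2)⁻¹) (Icc t l) := by
    refine ContinuousOn.integrableOn_Icc (ContinuousOn.inv₀ (by fun_prop) fun s hs => ?_)
    exact pow_ne_zero 2 (ht.trans_le hs.1).ne'
  rw [h1, ← ofReal_integral_eq_lintegral_ofReal hint (Eventually.of_forall fun s => by positivity),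
    integral_Icc_eq_integral_Ioc, ← intervalIntegral.integral_of_le hl, h2,
    ← ENNReal.ofReal_add (inv_nonneg.2 (ht.le.trans hl)) (sub_nonneg.2 (inv_anti₀ ht hl)),
    add_sub_cancel, ENNReal.ofReal_inv_of_pos ht]

/-- Integration by parts: the right side involves `m` only through the masses of the intervals `]0,
s]`, so bounds on those masses bound the integral of `1/t`. -/
lemma lintegral_inv_eq (m : Measure ℝ) [SFinite m] (l : ℝ) :
    ∫⁻ t in Ioc 0 l, (ENNReal.ofReal t)⁻¹ ∂m = ENNReal.ofReal l⁻¹ * m (Ioc 0 l)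
      + ∫⁻ s in Ioc 0 l, ENNReal.ofReal (s ^ 2)⁻¹ * m (Ioc 0 s) := by
  have hmeas : Measurable fun p : ℝ × ℝ => ENNReal.ofReal (p.2 ^ 2)⁻¹ * (Ici p.1).indicator 1 p.2 := by
    have h1 : (fun p : ℝ × ℝ => (Ici p.1).indicator (1 : ℝ → ℝ≥0∞) p.2)
        = {p : ℝ × ℝ | p.1 ≤ p.2}.indicator 1 := by
      ext p
      simp [indicator]
    have h2 : Measurable fun p : ℝ × ℝ => (Ici p.1).indicator (1 : ℝ → ℝ≥0∞) p.2 := by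
      rw [h1]
      exact measurable_one.indicator (measurableSet_le measurable_fst measurable_snd)
    exact Measurable.mul (by fun_prop) h2
  calc ∫⁻ t in Ioc 0 l, (ENNReal.ofReal t)⁻¹ ∂m
      = ∫⁻ t in Ioc 0 l, (ENNReal.ofReal l⁻¹
        + ∫⁻ s in Ioc 0 l, ENNReal.ofReal (s ^ 2)⁻¹ * (Ici t).indicator 1 s) ∂m :=
        setLIntegral_congr_fun measurableSet_Ioc fun t ht => inv_eq_add_lintegral ht.1 ht.2
    _ = ENNReal.ofReal l⁻¹ * m (Ioc 0 l)
        + ∫⁻ t in Ioc 0 l, ∫⁻ s in Ioc 0 l, ENNReal.ofReal (s ^ 2)⁻¹ * (Ici t).indicator 1 s ∂volume ∂m := by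
        rw [lintegral_add_left measurable_const, setLIntegral_const]
    _ = _ := by
        congr 1
        rw [lintegral_lintegral_swap hmeas.aemeasurable]
        refine setLIntegral_congr_fun measurableSet_Ioc fun s hs => ?_
        have h3 : ∀ t : ℝ, (Ici t).indicator (1 : ℝ → ℝ≥0∞) s = (Iic s).indicator 1 t := fun t => by
          simp [indicator]
        simp only [h3]
        rw [lintegral_const_mul _ (measurable_one.indicator measurableSet_Iic),
          lintegral_indicator_one measurableSet_Iic, Measure.restrict_apply measurableSet_Iic,
          inter_comm, Ioc_inter_Iic, min_eq_right hs.2]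

/-- The index set may be uncountable, as for a Hilbert basis of a non-separable space; only finite
sums are exchanged, and this direction costs nothing. -/
lemma ENNReal_tsum_lintegral_le {ι α : Type*} [MeasurableSpace α] (m : Measure α)
    {F : ι → α → ℝ≥0∞} (hF : ∀ i, Measurable (F i)) :
    ∑' i, ∫⁻ a, F i a ∂m ≤ ∫⁻ a, ∑' i, F i a ∂m := by
  rw [ENNReal.tsum_eq_iSup_sum]
  refine iSup_le fun s => ?_
  rw [← lintegral_finsetSum s fun i _ => hF i]
  exact lintegral_mono fun a => ENNReal.sum_le_tsum s

/-! ## Low energies -/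

section LowEnergy

variable {E : Type*} [NormedAddCommGroup E] [InnerProductSpace ℂ E] [CompleteSpace E]
variable {A : E →ₗ.[ℂ] E}

lemma energy_smul (hP : IsSpectralFamily (spectralFamily A)) (c : ℂ) (f : E) :
    energy A (c • f) = ‖c‖ₑ ^ 2 * energy A f := by
  rw [energy_eq_iSup hP, energy_eq_iSup hP, ENNReal.mul_iSup]
  simp only [map_smul, enorm_smul, mul_pow]

lemma sandwichForm_le (hP : IsSpectralFamily (spectralFamily A)) (ρ : E →L[ℂ] E) (f : E) :
    sandwichForm A ρ f ≤ formNorm (sandwichForm A ρ) * ‖f‖ₑ ^ 2 := by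
  rcases eq_or_ne f 0 with rfl | hf
  · have h := energy_smul hP 0 (0 : E)
    simp [sandwichForm] at h ⊢
    exact h
  have hf' := norm_pos_iff.2 hf
  have h1 : sandwichForm A ρ (((‖f‖⁻¹ : ℝ) : ℂ) • f) ≤ formNorm (sandwichForm A ρ) := by
    refine le_iSup₂ (f := fun (g : E) (_ : ‖g‖ ≤ 1) => sandwichForm A ρ g) _ ?_
    rw [norm_smul, Complex.norm_real, norm_inv, norm_norm, inv_mul_cancel₀ hf'.ne']
  have h2 : sandwichForm A ρ f
      = ‖((‖f‖ : ℝ) : ℂ)‖ₑ ^ 2 * sandwichForm A ρ (((‖f‖⁻¹ : ℝ) : ℂ) • f) := by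
    rw [sandwichForm, sandwichForm, ← energy_smul hP, ← map_smul, smul_smul, ← Complex.ofReal_mul,
      mul_inv_cancel₀ hf'.ne', Complex.ofReal_one, one_smul]
  have h3 : ‖((‖f‖ : ℝ) : ℂ)‖ₑ = ‖f‖ₑ := by
    rw [← ofReal_norm, Complex.norm_real, norm_norm, ofReal_norm]
  rw [h2, h3, mul_comm]
  gcongr

/-- Operator norms are at most Hilbert–Schmidt norms, applied to each truncation. Finite energy
thereby makes the norm finite. -/
lemma formNorm_le_formTrace (hP : IsSpectralFamily (spectralFamily A)) (ρ : E →L[ℂ] E) :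
    formNorm (sandwichForm A ρ) ≤ formTrace (sandwichForm A ρ) := by
  refine iSup₂_le fun f hf => ?_
  rw [sandwichForm, energy_eq_iSup hP]
  refine iSup_le fun n => ?_
  have h1 := enorm_apply_sq_le (borelCalc (spectralFamily A) (trunc Real.sqrt n) * opSqrt ρ) f
  have h2 : ‖f‖ₑ ^ 2 ≤ 1 := by
    refine pow_le_one₀ zero_le ?_
    rw [← ofReal_norm, ← ENNReal.ofReal_one]
    exact ENNReal.ofReal_le_ofReal hf
  rw [mul_apply_eq_comp] at h1
  refine h1.trans ((mul_le_of_le_one_right zero_le h2).trans ?_)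
  refine ENNReal.tsum_le_tsum fun i => ?_
  simp only [mul_apply_eq_comp]
  rw [sandwichForm, energy_eq_iSup hP]
  exact le_iSup (fun n => ‖borelCalc (spectralFamily A) (trunc Real.sqrt n) _‖ₑ ^ 2) n

lemma enorm_le_of_sq_le_mul {h : E} {e J a b : ℝ≥0∞}
    (h1 : ‖h‖ₑ ^ 2 ≤ a * b) (h2 : a ^ 2 ≤ e * ‖h‖ₑ ^ 2) (h3 : b ^ 2 ≤ J) : ‖h‖ₑ ^ 2 ≤ e * J := by
  rcases eq_or_ne ‖h‖ₑ 0 with h0 | h0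
  · simp [h0]
  have h4 : ‖h‖ₑ ^ 2 * ‖h‖ₑ ^ 2 ≤ ‖h‖ₑ ^ 2 * (e * J) := by
    calc ‖h‖ₑ ^ 2 * ‖h‖ₑ ^ 2 ≤ (a * b) * (a * b) := by gcongr
      _ = a ^ 2 * b ^ 2 := by ring
      _ ≤ (e * ‖h‖ₑ ^ 2) * J := by gcongr
      _ = _ := by ring
  exact (ENNReal.mul_le_mul_iff_right (pow_ne_zero 2 h0) (ENNReal.pow_ne_top enorm_ne_top)).1 h4

/-- Spectral Cauchy--Schwarz inequality. -/
lemma enorm_opSqrt_proj_sq_le (hP : IsSpectralFamily (spectralFamily A)) (ρ : E →L[ℂ] E)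
    {l : ℝ} (hl : 0 < l) (f : E) :
    ‖opSqrt ρ (spectralFamily A l f - spectralFamily A 0 f)‖ₑ ^ 2
      ≤ formNorm (sandwichForm A ρ)
        * ∫⁻ t in Ioc 0 l, (ENNReal.ofReal t)⁻¹ ∂(scalarMeasure (spectralFamily A) f) := by
  set P := spectralFamily A
  -- Away from `0` the function `1/√t` is bounded and the calculus applies; the limit `a → 0` uses
  -- right continuity of the family at `0`.
  have hcut : ∀ a, 0 < a → a ≤ l → ‖opSqrt ρ (P l f - P a f)‖ₑ ^ 2 ≤ formNorm (sandwichForm A ρ)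
      * ∫⁻ t in Ioc 0 l, (ENNReal.ofReal t)⁻¹ ∂(scalarMeasure P f) := by
    intro a ha hal
    let φ : ℝ → ℝ := (Ioc a l).indicator Real.sqrt
    let ψ : ℝ → ℝ := (Ioc a l).indicator fun t => (√t)⁻¹
    have hφ : IsBddMeas φ := by
      refine ⟨Real.continuous_sqrt.measurable.indicator measurableSet_Ioc, √l, fun t => ?_⟩
      by_cases h : t ∈ Ioc a l
      · simp only [φ, indicator_of_mem h, abs_of_nonneg (Real.sqrt_nonneg t)]
        exact Real.sqrt_le_sqrt h.2
      · simp only [φ, indicator_of_notMem h, abs_zero]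
        exact Real.sqrt_nonneg _
    have hψ : IsBddMeas ψ := by
      refine ⟨Real.continuous_sqrt.measurable.inv.indicator measurableSet_Ioc, (√a)⁻¹, fun t => ?_⟩
      by_cases h : t ∈ Ioc a l
      · simp only [ψ, indicator_of_mem h, abs_of_nonneg (inv_nonneg.2 (Real.sqrt_nonneg t))]
        exact inv_anti₀ (Real.sqrt_pos.2 ha) (Real.sqrt_le_sqrt h.1.le)
      · simp only [ψ, indicator_of_notMem h, abs_zero]
        positivity
    have hφψ : (fun t => φ t * ψ t) = (Ioc a l).indicator fun _ => 1 := by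
      ext t
      by_cases h : t ∈ Ioc a l
      · simp only [φ, ψ, indicator_of_mem h]
        exact mul_inv_cancel₀ (Real.sqrt_pos.2 (ha.trans h.1)).ne'
      · simp only [φ, ψ, indicator_of_notMem h, mul_zero]
    obtain ⟨h, hh⟩ : ∃ h, h = opSqrt ρ (P l f - P a f) := ⟨_, rfl⟩
    -- Insert `√t · (1/√t) = 1` on `]a, l]`: `‖h‖²` is the inner product of `φ(P) ρ^{1/2} h` and
    -- `ψ(P) f`. The first factor is bounded by `e^{1/2} ‖h‖`, `e` the norm of `sandwichForm A ρ`,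
    -- and `‖h‖` is then cancelled.
    have hsq : ‖h‖ ^ 2 ≤ ‖borelCalc P φ (opSqrt ρ h)‖ * ‖borelCalc P ψ f‖ := by
      have e1 : inner ℂ h h = inner ℂ (borelCalc P φ (opSqrt ρ h)) (borelCalc P ψ f) := by
        rw [hP.calc_symm hφ, hP.calc_calc hφ hψ, hφψ, hP.calc_indicator_Ioc hal, sub_apply,
          ← inner_opSqrt, ← hh]
      rw [← re_inner_self_eq, e1]
      exact (Complex.re_le_norm _).trans (norm_inner_le_norm _ _)
    rw [← hh]
    refine enorm_le_of_sq_le_mul (a := ‖borelCalc P φ (opSqrt ρ h)‖ₑ) (b := ‖borelCalc P ψ f‖ₑ)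
      ?_ ?_ ?_
    · rw [← ofReal_norm, ← ofReal_norm, ← ofReal_norm, ← ENNReal.ofReal_mul (norm_nonneg _),
        ← ENNReal.ofReal_pow (norm_nonneg _)]
      exact ENNReal.ofReal_le_ofReal hsq
    · refine le_trans ?_ (sandwichForm_le hP ρ h)
      rw [hP.enorm_sq_calc hφ, sandwichForm, energy]
      refine lintegral_mono fun t => ?_
      by_cases h : t ∈ Ioc a l
      · simp only [φ, indicator_of_mem h, Real.sq_sqrt (ha.le.trans h.1.le), le_refl]
      · simp [φ, indicator_of_notMem h]
    · rw [hP.enorm_sq_calc hψ, ← lintegral_indicator measurableSet_Ioc]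
      refine lintegral_mono fun t => ?_
      by_cases h : t ∈ Ioc a l
      · have ht : 0 < t := ha.trans h.1
        simp only [ψ, indicator_of_mem h, indicator_of_mem (show t ∈ Ioc 0 l from ⟨ht, h.2⟩), inv_pow,
          Real.sq_sqrt ht.le, ENNReal.ofReal_inv_of_pos ht, le_refl]
      · simp [ψ, indicator_of_notMem h]
  have hlim : Tendsto (fun a => ‖opSqrt ρ (P l f - P a f)‖ₑ ^ 2) (𝓝[>] 0)
      (𝓝 (‖opSqrt ρ (P l f - P 0 f)‖ₑ ^ 2)) := by
    have h1 : Tendsto (fun a => P a f) (𝓝[>] 0) (𝓝 (P 0 f)) :=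
      (hP.rightCont 0 f).mono Ioi_subset_Ici_self
    exact ENNReal.Tendsto.pow (((opSqrt ρ).continuous.tendsto _).comp (h1.const_sub (P l f))).enorm
  refine le_of_tendsto hlim ?_
  filter_upwards [Ioc_mem_nhdsGT hl] with a ha
  exact hcut a ha.1 ha.2

lemma IsSpectralFamily.scalarMeasure_Ioc {P : ℝ → E →L[ℂ] E} (hP : IsSpectralFamily P) (f : E)
    {s t : ℝ} (h : s ≤ t) : scalarMeasure P f (Ioc s t) = ‖P t f - P s f‖ₑ ^ 2 := by
  have hfin := hP.isFiniteMeasure f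
  rw [← Iic_sdiff_Iic, measure_sdiff (Iic_subset_Iic.2 h) measurableSet_Iic.nullMeasurableSet
    (measure_ne_top _ _), hP.scalarMeasure_Iic, hP.scalarMeasure_Iic,
    ← ENNReal.ofReal_sub _ (by positivity), ← ofReal_norm, ← ENNReal.ofReal_pow (norm_nonneg _)]
  congr 1
  have := norm_sub_sq (𝕜 := ℂ) (P t f) (P s f)
  rw [hP.inner_proj_proj, min_eq_right h, hP.inner_proj, RCLike.re_to_complex,
    Complex.ofReal_re] at this
  linarith

end LowEnergy

/-! ## Densities of the spectral projections -/

section DensityBounds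

variable {X : Type*} [MeasurableSpace X] {μ : Measure X}
variable {H : Type*} [NormedAddCommGroup H] [InnerProductSpace ℂ H] [CompleteSpace H]
variable {A : Lp H 2 μ →ₗ.[ℂ] Lp H 2 μ}

lemma adjoint_chi (Ω : Set X) (hΩ : MeasurableSet Ω) :
    ContinuousLinearMap.adjoint (chi Ω hΩ : Lp H 2 μ →L[ℂ] Lp H 2 μ) = chi Ω hΩ := by
  symm
  rw [ContinuousLinearMap.eq_adjoint_iff]
  exact fun x y => (inner_chi Ω hΩ x y).symm

lemma norm_chi_le (Ω : Set X) (hΩ : MeasurableSet Ω) (f : Lp H 2 μ) : ‖chi Ω hΩ f‖ ≤ ‖f‖ := by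
  refine Lp.norm_le_norm_of_ae_le ?_
  filter_upwards [chi_coeFn Ω hΩ f] with x hx
  rw [hx]
  by_cases h : x ∈ Ω <;> simp [h]

lemma chi_chi (Ω : Set X) (hΩ : MeasurableSet Ω) (f : Lp H 2 μ) :
    chi Ω hΩ (chi Ω hΩ f) = chi Ω hΩ f := by
  refine Lp.ext ?_
  filter_upwards [chi_coeFn Ω hΩ (chi Ω hΩ f), chi_coeFn Ω hΩ f] with x h1 h2
  rw [h1]
  by_cases h : x ∈ Ω
  · simp [h]
  · simp [h, h2]

lemma ofReal_re_inner_self {E : Type*} [NormedAddCommGroup E] [InnerProductSpace ℂ E] (g : E) :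
    ENNReal.ofReal (inner ℂ g g).re = ‖g‖ₑ ^ 2 := by
  have : (inner ℂ g g).re = ‖g‖ ^ 2 := (norm_sq_eq_re_inner (𝕜 := ℂ) g).symm
  rw [this, ENNReal.ofReal_pow (norm_nonneg _), ofReal_norm]

lemma densityMeasure_eq_hsSq (P : Lp H 2 μ →L[ℂ] Lp H 2 μ) {Ω : Set X} (hΩ : MeasurableSet Ω) :
    densityMeasure P Ω = hsSq (chi Ω hΩ * opSqrt P) := by
  rw [densityMeasure_apply P hΩ, trace, hsSq]
  congr 1
  ext f
  rw [← ofReal_re_inner_self]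
  simp only [mul_apply_eq_comp]
  rw [inner_opSqrt, ← inner_chi, chi_chi]

lemma spectralProj_apply (l : ℝ) (f : Lp H 2 μ) :
    spectralProj A l f = spectralFamily A (max l 0) f - spectralFamily A 0 f := rfl

lemma inner_spectralProj (hP : IsSpectralFamily (spectralFamily A)) (l : ℝ) (f g : Lp H 2 μ) :
    inner ℂ (spectralProj A l f) (spectralProj A l g) = inner ℂ f (spectralProj A l g) := by
  have h0 : (0 : ℝ) ≤ max l 0 := le_max_right _ _
  simp only [spectralProj_apply, inner_sub_left, inner_sub_right, hP.inner_proj_proj, min_self,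
    min_eq_left h0, min_eq_right h0]
  ring

lemma spectralProj_symm (hP : IsSpectralFamily (spectralFamily A)) (l : ℝ) (f g : Lp H 2 μ) :
    inner ℂ (spectralProj A l f) g = inner ℂ f (spectralProj A l g) := by
  simp only [spectralProj_apply, inner_sub_left, inner_sub_right, hP.proj_symm]

lemma spectralProj_isPositive (hP : IsSpectralFamily (spectralFamily A)) (l : ℝ) :
    (spectralProj A l).IsPositive := by
  refine ContinuousLinearMap.isPositive_def.2 ⟨fun f g => spectralProj_symm hP l f g, fun f => ?_⟩
  rw [ContinuousLinearMap.reApplyInnerSelf_apply, RCLike.re_to_complex, spectralProj_symm hP,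
    ← inner_spectralProj hP, re_inner_self_eq]
  positivity

/-- Each diagonal entry of `χ_Ω Π_l χ_Ω` is `‖Π_l χ_Ω e_i‖²`, the mass of `]0, l]`. This links the
density `F` with the scalar measures in which `1/t` is integrated. -/
lemma densityMeasure_spectralProj (hP : IsSpectralFamily (spectralFamily A)) (l : ℝ) {Ω : Set X}
    (hΩ : MeasurableSet Ω) :
    densityMeasure (spectralProj A l) Ω = ∑' i, scalarMeasure (spectralFamily A)
      (chi Ω hΩ (stdBasis (Lp H 2 μ) i)) (Ioc 0 (max l 0)) := by
  rw [densityMeasure_apply' _ (spectralProj_isPositive hP l) hΩ, trace, formTrace]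
  refine tsum_congr fun i => ?_
  simp only [mul_apply_eq_comp]
  rw [inner_chi, ← inner_spectralProj hP, ofReal_re_inner_self,
    hP.scalarMeasure_Ioc _ (le_max_right _ _), spectralProj_apply]

lemma densityMeasure_spectralProj_mono (hP : IsSpectralFamily (spectralFamily A)) {l m : ℝ}
    (h : l ≤ m) {Ω : Set X} (hΩ : MeasurableSet Ω) :
    densityMeasure (spectralProj A l) Ω ≤ densityMeasure (spectralProj A m) Ω := by
  rw [densityMeasure_spectralProj hP _ hΩ, densityMeasure_spectralProj hP _ hΩ]
  exact ENNReal.tsum_le_tsum fun i => measure_mono (Ioc_subset_Ioc_right (max_le_max_right 0 h))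

lemma spectralDensity_mono (hP : IsSpectralFamily (spectralFamily A)) :
    Monotone (spectralDensity A) := by
  intro l m h
  refine iSup₂_mono fun Ω hΩ => ?_
  have := densityMeasure_spectralProj_mono hP h hΩ
  gcongr

lemma spectralDensity_of_nonpos (hP : IsSpectralFamily (spectralFamily A)) {l : ℝ} (h : l ≤ 0) :
    spectralDensity A l = 0 := by
  refine le_antisymm (iSup₂_le fun Ω hΩ => ?_) zero_le
  rw [densityMeasure_spectralProj hP _ hΩ, max_eq_right h]
  simp

lemma densityMeasure_le_density_mul (P : Lp H 2 μ →L[ℂ] Lp H 2 μ) {Ω : Set X} (hΩ : MeasurableSet Ω)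
    (hμ : μ Ω ≠ ∞) : densityMeasure P Ω ≤ density P * μ Ω := by
  rcases eq_or_ne (μ Ω) 0 with h0 | h0
  · rw [densityMeasure_absolutelyContinuous P h0]
    exact zero_le
  · rw [← ENNReal.div_le_iff h0 hμ]
    exact le_iSup₂ (f := fun (Ω : Set X) (_ : MeasurableSet Ω) => densityMeasure P Ω / μ Ω) Ω hΩ

/-- The Stieltjes measure `dF` of the spectral density. -/
def densityStieltjes (A : Lp H 2 μ →ₗ.[ℂ] Lp H 2 μ) : Measure ℝ :=
  stieltjesMeasure fun t => (spectralDensity A t).toReal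

lemma toReal_spectralDensity_mono (hP : IsSpectralFamily (spectralFamily A))
    (hF : ∀ l : ℝ, spectralDensity A l ≠ ∞) : Monotone fun t => (spectralDensity A t).toReal :=
  fun _ m h => ENNReal.toReal_mono (hF m) (spectralDensity_mono hP h)

lemma densityStieltjes_eq (hP : IsSpectralFamily (spectralFamily A))
    (hF : ∀ l : ℝ, spectralDensity A l ≠ ∞) :
    densityStieltjes A = (toReal_spectralDensity_mono hP hF).stieltjesFunction.measure := by
  rw [densityStieltjes, stieltjesMeasure, dif_pos (toReal_spectralDensity_mono hP hF)]

/-- Right continuity of `F` is not needed: `[0, s]` has mass `F(s+) - F(0-)`, where `F(s+) ≥ F(s)`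
and `F(0-) = 0`. -/
lemma spectralDensity_le_Icc (hP : IsSpectralFamily (spectralFamily A))
    (hF : ∀ l : ℝ, spectralDensity A l ≠ ∞) (s : ℝ) :
    spectralDensity A s ≤ densityStieltjes A (Icc 0 s) := by
  have hm := toReal_spectralDensity_mono hP hF
  have h0 : Function.leftLim hm.stieltjesFunction 0 = 0 := by
    refine leftLim_eq_of_tendsto (tendsto_const_nhds.congr' ?_)
    filter_upwards [self_mem_nhdsWithin] with t ht
    rw [Monotone.stieltjesFunction_eq]
    symm
    refine rightLim_eq_of_tendsto (tendsto_const_nhds.congr' ?_)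
    filter_upwards [Ioo_mem_nhdsGT (show t < 0 from ht)] with u hu
    rw [spectralDensity_of_nonpos hP hu.2.le, ENNReal.toReal_zero]
  rw [densityStieltjes_eq hP hF, StieltjesFunction.measure_Icc, h0, sub_zero,
    Monotone.stieltjesFunction_eq, ← ENNReal.ofReal_toReal (hF s)]
  exact ENNReal.ofReal_le_ofReal (hm.le_rightLim le_rfl)

/-- An atom at `0` would give `G(0) = ∞`, since `0⁻¹ = ∞` in `[0, ∞]`. -/
lemma densityStieltjes_zero (hG : ∀ l : ℝ, stieltjesG A l ≠ ∞) : densityStieltjes A {0} = 0 := by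
  by_contra hne
  refine hG 0 (top_unique ?_)
  rw [stieltjesG, Icc_self, lintegral_singleton]
  change ∞ ≤ _ * densityStieltjes A {0}
  rw [ENNReal.ofReal_zero, ENNReal.inv_zero, ENNReal.top_mul hne]

lemma spectralDensity_le_Ioc (hP : IsSpectralFamily (spectralFamily A))
    (hF : ∀ l : ℝ, spectralDensity A l ≠ ∞) (hG : ∀ l : ℝ, stieltjesG A l ≠ ∞) {s : ℝ} (hs : 0 < s) :
    spectralDensity A s ≤ densityStieltjes A (Ioc 0 s) := by
  refine (spectralDensity_le_Icc hP hF s).trans ?_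
  rw [← Ioc_union_left hs.le]
  refine (measure_union_le _ _).trans ?_
  rw [densityStieltjes_zero hG, add_zero]

lemma low_density_le_stieltjesG (hP : IsSpectralFamily (spectralFamily A))
    (hF : ∀ l : ℝ, spectralDensity A l ≠ ∞) (hG : ∀ l : ℝ, stieltjesG A l ≠ ∞) {l : ℝ} (hl : 0 < l) :
    ENNReal.ofReal l⁻¹ * spectralDensity A l
      + ∫⁻ s in Ioc 0 l, ENNReal.ofReal (s ^ 2)⁻¹ * spectralDensity A s ≤ stieltjesG A l := by
  have : SFinite (densityStieltjes A) := by
    rw [densityStieltjes_eq hP hF]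
    infer_instance
  have h1 : ∫⁻ t in Ioc 0 l, (ENNReal.ofReal t)⁻¹ ∂(densityStieltjes A) ≤ stieltjesG A l :=
    lintegral_mono_set Ioc_subset_Icc_self
  refine le_trans ?_ h1
  rw [lintegral_inv_eq]
  gcongr ?_ + ?_
  · gcongr
    exact spectralDensity_le_Ioc hP hF hG hl
  · refine setLIntegral_mono' measurableSet_Ioc fun s hs => ?_
    gcongr
    exact spectralDensity_le_Ioc hP hF hG hs.1

lemma measurable_scalarMeasure_Ioc {E : Type*} [NormedAddCommGroup E] [InnerProductSpace ℂ E]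
    [CompleteSpace E] (P : ℝ → E →L[ℂ] E) (f : E) : Measurable fun s => scalarMeasure P f (Ioc 0 s) := by
  refine Monotone.measurable fun s t h => measure_mono (Ioc_subset_Ioc_right h)

/-- The density of the low energy part of `ρ` is at most `‖ρ^{1/2} A ρ^{1/2}‖ G(l)`. -/
lemma hsSq_low_le (hP : IsSpectralFamily (spectralFamily A))
    (hF : ∀ l : ℝ, spectralDensity A l ≠ ∞) (hG : ∀ l : ℝ, stieltjesG A l ≠ ∞)
    (ρ : Lp H 2 μ →L[ℂ] Lp H 2 μ) {l : ℝ} (hl : 0 < l) {Ω : Set X} (hΩ : MeasurableSet Ω)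
    (hμ : μ Ω ≠ ∞) :
    hsSq (chi Ω hΩ * spectralProj A l * opSqrt ρ)
      ≤ formNorm (sandwichForm A ρ) * stieltjesG A l * μ Ω := by
  have hfin := hP.isFiniteMeasure
  -- Passing to the adjoint puts `χ_Ω` next to the basis vectors, so that the scalar measures of
  -- `χ_Ω e_i` appear.
  have hadj : ContinuousLinearMap.adjoint (chi Ω hΩ * spectralProj A l * opSqrt ρ)
      = opSqrt ρ * spectralProj A l * chi Ω hΩ := by
    rw [adjoint_mul, adjoint_mul, adjoint_opSqrt, adjoint_chi, mul_assoc,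
      (spectralProj_isPositive hP l).isSelfAdjoint.adjoint_eq]
  have hν : ∀ s, 0 ≤ s → ∑' i, scalarMeasure (spectralFamily A)
      (chi Ω hΩ (stdBasis (Lp H 2 μ) i)) (Ioc 0 s) ≤ spectralDensity A s * μ Ω := by
    intro s hs
    have h1 := densityMeasure_spectralProj hP s hΩ
    rw [max_eq_left hs] at h1
    rw [← h1]
    exact densityMeasure_le_density_mul _ hΩ hμ
  rw [← hsSq_adjoint, hadj, hsSq, formTrace]
  simp only [mul_apply_eq_comp]
  calc ∑' i, ‖opSqrt ρ (spectralProj A l (chi Ω hΩ (stdBasis (Lp H 2 μ) i)))‖ₑ ^ 2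
      ≤ ∑' i, formNorm (sandwichForm A ρ) * ∫⁻ t in Ioc 0 l, (ENNReal.ofReal t)⁻¹
          ∂(scalarMeasure (spectralFamily A) (chi Ω hΩ (stdBasis (Lp H 2 μ) i))) := by
        refine ENNReal.tsum_le_tsum fun i => ?_
        have := enorm_opSqrt_proj_sq_le hP ρ hl (chi Ω hΩ (stdBasis (Lp H 2 μ) i))
        simpa only [spectralProj_apply, max_eq_left hl.le] using this
    _ = formNorm (sandwichForm A ρ) * (ENNReal.ofReal l⁻¹ * ∑' i, scalarMeasure (spectralFamily A)
          (chi Ω hΩ (stdBasis (Lp H 2 μ) i)) (Ioc 0 l) + ∑' i, ∫⁻ s in Ioc 0 l,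
          ENNReal.ofReal (s ^ 2)⁻¹ * scalarMeasure (spectralFamily A)
          (chi Ω hΩ (stdBasis (Lp H 2 μ) i)) (Ioc 0 s)) := by
        rw [ENNReal.tsum_mul_left]
        congr 1
        rw [← ENNReal.tsum_mul_left, ← ENNReal.tsum_add]
        exact tsum_congr fun i => lintegral_inv_eq _ l
    _ ≤ formNorm (sandwichForm A ρ) * (ENNReal.ofReal l⁻¹ * (spectralDensity A l * μ Ω)
          + ∫⁻ s in Ioc 0 l, (ENNReal.ofReal (s ^ 2)⁻¹ * spectralDensity A s) * μ Ω) := by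
        gcongr
        · exact hν l hl.le
        · refine (ENNReal_tsum_lintegral_le _ fun i => ?_).trans ?_
          · exact Measurable.mul (by fun_prop) (measurable_scalarMeasure_Ioc _ _)
          · refine setLIntegral_mono' measurableSet_Ioc fun s hs => ?_
            rw [ENNReal.tsum_mul_left, mul_assoc]
            gcongr
            exact hν s hs.1.le
    _ = formNorm (sandwichForm A ρ) * ((ENNReal.ofReal l⁻¹ * spectralDensity A l
          + ∫⁻ s in Ioc 0 l, ENNReal.ofReal (s ^ 2)⁻¹ * spectralDensity A s) * μ Ω) := by
        rw [lintegral_mul_const' _ _ hμ, add_mul, mul_assoc]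
    _ ≤ formNorm (sandwichForm A ρ) * (stieltjesG A l * μ Ω) := by
        gcongr
        exact low_density_le_stieltjesG hP hF hG hl
    _ = _ := by rw [← mul_assoc]

end DensityBounds

/-! ## The main inequality -/

lemma enorm_add_sq_le {E : Type*} [NormedAddCommGroup E] (a b : E) :
    ‖a + b‖ₑ ^ 2 ≤ 2 * ‖a‖ₑ ^ 2 + 2 * ‖b‖ₑ ^ 2 := by
  have h : ‖a + b‖ ^ 2 ≤ 2 * ‖a‖ ^ 2 + 2 * ‖b‖ ^ 2 := by
    have h1 := norm_add_le a b
    nlinarith [norm_nonneg (a + b), sq_nonneg (‖a‖ - ‖b‖)]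
  have h2 := ENNReal.ofReal_le_ofReal h
  rwa [ENNReal.ofReal_add (by positivity) (by positivity), ENNReal.ofReal_mul zero_le_two,
    ENNReal.ofReal_mul zero_le_two, ENNReal.ofReal_pow (norm_nonneg _),
    ENNReal.ofReal_pow (norm_nonneg _), ENNReal.ofReal_pow (norm_nonneg _), ofReal_norm, ofReal_norm,
    ofReal_norm, ENNReal.ofReal_ofNat] at h2

/-- Layer cake formula for functions with values in `[0, ∞]`. -/
lemma lintegral_eq_lintegral_meas_ofReal_lt {X : Type*} [MeasurableSpace X] (ν : Measure X)
    [SFinite ν] {g : X → ℝ≥0∞} (hg : Measurable g) :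
    ∫⁻ x, g x ∂ν = ∫⁻ l in Ioi (0 : ℝ), ν {x | ENNReal.ofReal l < g x} := by
  have hvol : ∀ c : ℝ≥0∞, volume ({l : ℝ | ENNReal.ofReal l < c} ∩ Ioi 0) = c := by
    intro c
    rcases eq_or_ne c ∞ with rfl | hc
    · simp
    · have h1 : {l : ℝ | ENNReal.ofReal l < c} ∩ Ioi 0 = Ioo 0 c.toReal := by
        ext l
        simp only [mem_inter_iff, mem_ofPred_eq, mem_Ioi, mem_Ioo]
        constructor
        · rintro ⟨h1, h2⟩
          exact ⟨h2, (ENNReal.ofReal_lt_iff_lt_toReal h2.le hc).1 h1⟩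
        · rintro ⟨h1, h2⟩
          exact ⟨(ENNReal.ofReal_lt_iff_lt_toReal h1.le hc).2 h2, h1⟩
      rw [h1, Real.volume_Ioo, sub_zero, ENNReal.ofReal_toReal hc]
  have hm : MeasurableSet {p : X × ℝ | ENNReal.ofReal p.2 < g p.1} :=
    measurableSet_lt (by fun_prop) (hg.comp measurable_fst)
  have h1 : ∀ x, g x = ∫⁻ l in Ioi (0 : ℝ),
      {p : X × ℝ | ENNReal.ofReal p.2 < g p.1}.indicator (fun _ => 1) (x, l) := by
    intro x
    have hml : MeasurableSet {l : ℝ | ENNReal.ofReal l < g x} :=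
      measurableSet_lt (by fun_prop) measurable_const
    have h2 : ∀ l : ℝ, {p : X × ℝ | ENNReal.ofReal p.2 < g p.1}.indicator (fun _ => (1 : ℝ≥0∞)) (x, l)
        = {l : ℝ | ENNReal.ofReal l < g x}.indicator 1 l := fun l => by
      simp [indicator]
    simp only [h2]
    rw [lintegral_indicator_one hml, Measure.restrict_apply hml, hvol]
  calc ∫⁻ x, g x ∂ν = ∫⁻ x, ∫⁻ l in Ioi (0 : ℝ),
        {p : X × ℝ | ENNReal.ofReal p.2 < g p.1}.indicator (fun _ => 1) (x, l) ∂volume ∂ν :=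
        lintegral_congr h1
    _ = ∫⁻ l in Ioi (0 : ℝ), ∫⁻ x,
        {p : X × ℝ | ENNReal.ofReal p.2 < g p.1}.indicator (fun _ => 1) (x, l) ∂ν :=
        lintegral_lintegral_swap (f := fun x l =>
          {p : X × ℝ | ENNReal.ofReal p.2 < g p.1}.indicator (fun _ => (1 : ℝ≥0∞)) (x, l))
          (measurable_const.indicator hm).aemeasurable
    _ = _ := by
        refine lintegral_congr fun l => ?_
        have hml : MeasurableSet {x | ENNReal.ofReal l < g x} := measurableSet_lt measurable_const hg
        rw [← lintegral_indicator_one hml]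
        exact lintegral_congr fun x => by simp [indicator]

/-- Exchange of a sum and an integral, when only countably many terms do not vanish. -/
lemma lintegral_tsum_of_countable_support {ι α : Type*} [MeasurableSpace α] (m : Measure α)
    {F : ι → α → ℝ≥0∞} (hF : ∀ i, AEMeasurable (F i) m) {s : Set ι} (hs : s.Countable)
    (h0 : ∀ i ∉ s, F i = 0) : ∫⁻ a, ∑' i, F i a ∂m = ∑' i, ∫⁻ a, F i a ∂m := by
  have : Countable s := hs
  have h1 : ∀ a, ∑' i, F i a = ∑' i : s, F i a := fun a =>
    (tsum_subtype_eq_of_support_subset fun i hi => by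
      by_contra hc
      exact hi (congrFun (h0 i hc) a)).symm
  have h2 : ∑' i, ∫⁻ a, F i a ∂m = ∑' i : s, ∫⁻ a, F i a ∂m :=
    (tsum_subtype_eq_of_support_subset (f := fun i => ∫⁻ a, F i a ∂m) fun i hi => by
      by_contra hc
      refine hi ?_
      simp [h0 i hc]).symm
  simp only [h1, h2]
  exact lintegral_tsum fun i => hF i

section MainInequality

variable {X : Type*} [MeasurableSpace X] {μ : Measure X}
variable {H : Type*} [NormedAddCommGroup H] [InnerProductSpace ℂ H] [CompleteSpace H]
variable {A : Lp H 2 μ →ₗ.[ℂ] Lp H 2 μ} {ρ : Lp H 2 μ →L[ℂ] Lp H 2 μ}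

/-- The mass `τ(ρ^{1/2} χ_A(]l, ∞[) ρ^{1/2})` of the high energy part of `ρ`. -/
def highMass (A : Lp H 2 μ →ₗ.[ℂ] Lp H 2 μ) (ρ : Lp H 2 μ →L[ℂ] Lp H 2 μ) (l : ℝ) : ℝ≥0∞ :=
  ∑' i, scalarMeasure (spectralFamily A) (opSqrt ρ (stdBasis (Lp H 2 μ) i)) (Ioi l)

/-- Layer cake formula for `t` under each scalar measure, which is carried by the positive half
line. Finite energy leaves only countably many nonzero terms, which permits exchanging sum and
integral. -/
lemma lintegral_highMass (hP : IsSpectralFamily (spectralFamily A))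
    (hneg : ∀ t < 0, spectralFamily A t = 0) (hE : formTrace (sandwichForm A ρ) ≠ ∞) :
    ∫⁻ l in Ioi (0 : ℝ), highMass A ρ l = formTrace (sandwichForm A ρ) := by
  have henergy : ∀ u, ∫⁻ l in Ioi (0 : ℝ), scalarMeasure (spectralFamily A) u (Ioi l) = energy A u := by
    intro u
    exact (lintegral_eq_lintegral_meas_lt _ (hP.scalarMeasure_Iio_zero hneg u) aemeasurable_id).symm
  have hmeas : ∀ i, Measurable fun l : ℝ =>
      scalarMeasure (spectralFamily A) (opSqrt ρ (stdBasis (Lp H 2 μ) i)) (Ioi l) := fun i =>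
    Antitone.measurable fun s t h => measure_mono (Ioi_subset_Ioi h)
  have hcount : (Function.support fun i => sandwichForm A ρ (stdBasis (Lp H 2 μ) i)).Countable :=
    Summable.countable_support_ennreal hE
  let F : basisIndex (Lp H 2 μ) → ℝ → ℝ≥0∞ := fun i => (Ioi (0 : ℝ)).indicator fun l =>
      scalarMeasure (spectralFamily A) (opSqrt ρ (stdBasis (Lp H 2 μ) i)) (Ioi l)
  have hF0 : ∀ i ∉ Function.support fun i => sandwichForm A ρ (stdBasis (Lp H 2 μ) i), F i = 0 := by
    intro i hi
    have h1 : energy A (opSqrt ρ (stdBasis (Lp H 2 μ) i)) = 0 := Function.notMem_support.1 hi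
    rw [energy, lintegral_eq_zero_iff (by fun_prop)] at h1
    ext l
    by_cases hl : l ∈ Ioi (0 : ℝ)
    · simp only [F, indicator_of_mem hl, Pi.zero_apply]
      refine measure_mono_null ?_ (ae_iff.1 h1)
      intro t ht
      have : 0 < t := lt_trans hl ht
      simp [this]
    · simp only [F, indicator_of_notMem hl, Pi.zero_apply]
  calc ∫⁻ l in Ioi (0 : ℝ), highMass A ρ l = ∫⁻ l, ∑' i, F i l := by
        rw [← lintegral_indicator measurableSet_Ioi]
        refine lintegral_congr fun l => ?_
        by_cases hl : l ∈ Ioi (0 : ℝ)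
        · simp only [F, indicator_of_mem hl]
          rfl
        · simp only [F, indicator_of_notMem hl, tsum_zero]
    _ = ∑' i, ∫⁻ l, F i l := lintegral_tsum_of_countable_support _
        (fun i => ((hmeas i).indicator measurableSet_Ioi).aemeasurable) hcount hF0
    _ = _ := by
        refine tsum_congr fun i => ?_
        rw [lintegral_indicator measurableSet_Ioi, henergy]
        rfl

lemma highMass_ne_top (hE : formTrace (sandwichForm A ρ) ≠ ∞) : highMass A ρ 1 ≠ ∞ := by
  refine ne_top_of_le_ne_top hE (ENNReal.tsum_le_tsum fun i => ?_)
  rw [sandwichForm, energy, ← lintegral_indicator_one measurableSet_Ioi]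
  refine lintegral_mono fun t => ?_
  by_cases h : t ∈ Ioi (1 : ℝ)
  · rw [indicator_of_mem h, Pi.one_apply, ← ENNReal.ofReal_one]
    exact ENNReal.ofReal_le_ofReal (le_of_lt h)
  · rw [indicator_of_notMem h]
    exact zero_le

/-- Split `ρ^{1/2} = Π_l ρ^{1/2} + (1 - P_l) ρ^{1/2}`, which holds because `P_0 ρ^{1/2} = 0`, and
drop the contraction `χ_Ω` in the second term. -/
lemma densityMeasure_le_add (hP : IsSpectralFamily (spectralFamily A))
    (hr : ∀ f, spectralFamily A 0 (opSqrt ρ f) = 0) {l : ℝ} (hl : 0 < l) {Ω : Set X}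
    (hΩ : MeasurableSet Ω) :
    densityMeasure ρ Ω ≤ 2 * hsSq (chi Ω hΩ * spectralProj A l * opSqrt ρ) + 2 * highMass A ρ l := by
  rw [densityMeasure_eq_hsSq ρ hΩ, hsSq, hsSq, formTrace, formTrace, highMass, ← ENNReal.tsum_mul_left,
    ← ENNReal.tsum_mul_left, ← ENNReal.tsum_add]
  refine ENNReal.tsum_le_tsum fun i => ?_
  simp only [mul_apply_eq_comp]
  obtain ⟨u, hu⟩ : ∃ u, u = opSqrt ρ (stdBasis (Lp H 2 μ) i) := ⟨_, rfl⟩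
  have h0 : spectralFamily A 0 u = 0 := by rw [hu, hr]
  have h1 : spectralProj A l u = spectralFamily A l u := by
    rw [spectralProj_apply, h0, sub_zero, max_eq_left hl.le]
  have h2 : chi Ω hΩ u = chi Ω hΩ (spectralProj A l u) + chi Ω hΩ (u - spectralFamily A l u) := by
    rw [← map_add, h1, add_sub_cancel]
  rw [← hu, hP.scalarMeasure_Ioi, h2, ENNReal.ofReal_pow (norm_nonneg _), ofReal_norm]
  refine (enorm_add_sq_le _ _).trans ?_
  gcongr
  exact enorm_le_iff_norm_le.2 (norm_chi_le Ω hΩ _)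

variable [SigmaFinite μ]

/-- The splitting at `l = 1` bounds `ν_ρ` on sets of finite `μ`-measure. This justifies the
Radon–Nikodym formula and the layer cake formula for `ν_ρ`. -/
lemma sigmaFinite_densityMeasure (hP : IsSpectralFamily (spectralFamily A))
    (hF : ∀ l : ℝ, spectralDensity A l ≠ ∞) (hG : ∀ l : ℝ, stieltjesG A l ≠ ∞)
    (hr : ∀ f, spectralFamily A 0 (opSqrt ρ f) = 0) (hE : formTrace (sandwichForm A ρ) ≠ ∞) :
    SigmaFinite (densityMeasure ρ) := by
  refine ⟨⟨⟨spanningSets μ, fun _ => trivial, fun n => ?_, iUnion_spanningSets μ⟩⟩⟩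
  have hμ := (measure_spanningSets_lt_top μ n).ne
  have he : formNorm (sandwichForm A ρ) ≠ ∞ := ne_top_of_le_ne_top hE (formNorm_le_formTrace hP ρ)
  refine lt_of_le_of_lt (densityMeasure_le_add hP hr one_pos (measurableSet_spanningSets μ n)) ?_
  refine ENNReal.add_lt_top.2 ⟨ENNReal.mul_lt_top (by simp) ?_,
    ENNReal.mul_lt_top (by simp) (highMass_ne_top hE).lt_top⟩
  exact (hsSq_low_le hP hF hG ρ one_pos _ hμ).trans_lt
    (ENNReal.mul_lt_top (ENNReal.mul_lt_top he.lt_top (hG 1).lt_top) hμ.lt_top)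

lemma invG_mono (A : Lp H 2 μ →ₗ.[ℂ] Lp H 2 μ) : Monotone (invG A) := fun _ _ h =>
  iSup_mono fun _ => iSup_mono fun _ => iSup_mono' fun h1 => ⟨h1.trans h, le_rfl⟩

lemma stieltjesG_mono (A : Lp H 2 μ →ₗ.[ℂ] Lp H 2 μ) : Monotone (stieltjesG A) := fun _ _ h =>
  lintegral_mono_set (Icc_subset_Icc_right h)

/-- The only property of `G⁻¹` that the layer cake argument needs; monotonicity of `G` suffices. -/
lemma stieltjesG_le_of_lt_invG {l : ℝ} {y : ℝ≥0∞} (h : ENNReal.ofReal l < invG A y) :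
    stieltjesG A l ≤ y := by
  obtain ⟨m, h1⟩ := lt_iSup_iff.1 h
  obtain ⟨h0, h2⟩ := lt_iSup_iff.1 h1
  obtain ⟨h3, h4⟩ := lt_iSup_iff.1 h2
  refine (stieltjesG_mono A ?_).trans h3
  exact (ENNReal.ofReal_lt_ofReal_iff'.1 h4).1.le

/-- On this set, intersected with sets of finite `μ`-measure, the low energy contribution is at most
half of `ν_ρ` and is absorbed; the two factors `2` then give the constant `4`. -/
lemma densityMeasure_le_highMass (hP : IsSpectralFamily (spectralFamily A))
    (hF : ∀ l : ℝ, spectralDensity A l ≠ ∞) (hG : ∀ l : ℝ, stieltjesG A l ≠ ∞)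
    (hr : ∀ f, spectralFamily A 0 (opSqrt ρ f) = 0) (hE : formTrace (sandwichForm A ρ) ≠ ∞)
    {l : ℝ} (hl : 0 < l) :
    densityMeasure ρ {x | 4 * formNorm (sandwichForm A ρ) * stieltjesG A l ≤ densityFun ρ x}
      ≤ 4 * highMass A ρ l := by
  have hσ := sigmaFinite_densityMeasure hP hF hG hr hE
  have hd : Measurable (densityFun ρ) := Measure.measurable_rnDeriv _ _
  obtain ⟨e, he⟩ : ∃ e, e = formNorm (sandwichForm A ρ) := ⟨_, rfl⟩
  obtain ⟨Ω, hΩdef⟩ : ∃ Ω, Ω = {x | 4 * e * stieltjesG A l ≤ densityFun ρ x} := ⟨_, rfl⟩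
  have hΩ : MeasurableSet Ω := hΩdef ▸ measurableSet_le measurable_const hd
  rw [← he, ← hΩdef]
  rcases eq_or_ne (highMass A ρ l) ∞ with hh | hh
  · rw [hh, ENNReal.mul_top (by simp)]
    exact le_top
  have key : ∀ n, densityMeasure ρ (Ω ∩ spanningSets μ n) ≤ 4 * highMass A ρ l := by
    intro n
    have hm := hΩ.inter (measurableSet_spanningSets μ n)
    have hμ : μ (Ω ∩ spanningSets μ n) ≠ ∞ := ne_top_of_le_ne_top
      (measure_spanningSets_lt_top μ n).ne (measure_mono inter_subset_right)
    have hlow := hsSq_low_le hP hF hG ρ hl hm hμ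
    have h1 := densityMeasure_le_add hP hr hl hm
    have h2 : 4 * e * stieltjesG A l * μ (Ω ∩ spanningSets μ n)
        ≤ densityMeasure ρ (Ω ∩ spanningSets μ n) := by
      rw [← Measure.setLIntegral_rnDeriv (densityMeasure_absolutelyContinuous ρ), ← setLIntegral_const]
      refine setLIntegral_mono' hm fun x hx => ?_
      have := hx.1
      rw [hΩdef] at this
      exact this
    rw [← he] at hlow
    obtain ⟨N, hN⟩ : ∃ N, N = densityMeasure ρ (Ω ∩ spanningSets μ n) := ⟨_, rfl⟩
    have hNtop : N ≠ ∞ := by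
      rw [hN]
      refine ne_top_of_le_ne_top ?_ h1
      have he' : e ≠ ∞ := he ▸ ne_top_of_le_ne_top hE (formNorm_le_formTrace hP ρ)
      refine ENNReal.add_ne_top.2 ⟨?_, ?_⟩
      · refine ENNReal.mul_ne_top (by simp) (ne_top_of_le_ne_top ?_ hlow)
        exact ENNReal.mul_ne_top (ENNReal.mul_ne_top he' (hG l)) hμ
      · exact ENNReal.mul_ne_top (by simp) hh
    rw [← hN] at h1 h2 ⊢
    -- Doubling the splitting gives the low energy term `4 e G(l) μ(Ω)`, which is at most `N` by the
    -- choice of `Ω`; finiteness of `N` allows its cancellation.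
    have h3 : N + N ≤ N + 4 * highMass A ρ l := by
      calc N + N = 2 * N := (two_mul N).symm
        _ ≤ 2 * (2 * hsSq (chi _ hm * spectralProj A l * opSqrt ρ) + 2 * highMass A ρ l) := by gcongr
        _ ≤ 2 * (2 * (e * stieltjesG A l * μ (Ω ∩ spanningSets μ n)) + 2 * highMass A ρ l) := by
            gcongr
        _ = 4 * e * stieltjesG A l * μ (Ω ∩ spanningSets μ n) + 4 * highMass A ρ l := by ring
        _ ≤ _ := by gcongr
    exact (ENNReal.add_le_add_iff_left hNtop).1 h3
  have hU : Ω = ⋃ n, Ω ∩ spanningSets μ n := by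
    rw [← inter_iUnion, iUnion_spanningSets, inter_univ]
  rw [hU, Monotone.measure_iUnion fun m n h => inter_subset_inter_right _ (monotone_spanningSets μ h)]
  exact iSup_le key

theorem lintegral_invG_le (hP : IsSpectralFamily (spectralFamily A))
    (hneg : ∀ t < 0, spectralFamily A t = 0)
    (hF : ∀ l : ℝ, spectralDensity A l ≠ ∞) (hG : ∀ l : ℝ, stieltjesG A l ≠ ∞)
    (hr : ∀ f, spectralFamily A 0 (opSqrt ρ f) = 0) :
    ∫⁻ x, invG A (densityFun ρ x / (4 * formNorm (sandwichForm A ρ))) ∂(densityMeasure ρ)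
      ≤ 4 * formTrace (sandwichForm A ρ) := by
  rcases eq_or_ne (formTrace (sandwichForm A ρ)) ∞ with hE | hE
  · rw [hE, ENNReal.mul_top (by simp)]
    exact le_top
  have hσ := sigmaFinite_densityMeasure hP hF hG hr hE
  have hd : Measurable (densityFun ρ) := Measure.measurable_rnDeriv _ _
  have hg : Measurable fun x => invG A (densityFun ρ x / (4 * formNorm (sandwichForm A ρ))) :=
    (invG_mono A).measurable.comp (hd.div_const _)
  rw [lintegral_eq_lintegral_meas_ofReal_lt _ hg,
    ← lintegral_highMass hP hneg hE, ← lintegral_const_mul' _ _ (by simp)]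
  refine setLIntegral_mono' measurableSet_Ioi fun l hl => ?_
  refine (measure_mono fun x hx => ?_).trans (densityMeasure_le_highMass hP hF hG hr hE hl)
  -- Also valid when the norm is `0` or `∞`, with the conventions of division in `[0, ∞]`.
  have := ENNReal.mul_le_of_le_div (stieltjesG_le_of_lt_invG hx)
  rwa [mul_comm] at this

end MainInequality

/-! ## The trace of `A^{1/2} ρ A^{1/2}` -/

lemma tsum_iSup_of_monotone {ι : Type*} {f : ι → ℕ → ℝ≥0∞} (hf : ∀ i, Monotone (f i)) :
    ∑' i, ⨆ n, f i n = ⨆ n, ∑' i, f i n := by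
  simp only [ENNReal.tsum_eq_iSup_sum]
  rw [iSup_comm]
  exact iSup_congr fun s => ENNReal.finsetSum_iSup_of_monotone hf

section Trace

variable {E : Type*} [NormedAddCommGroup E] [InnerProductSpace ℂ E] [CompleteSpace E]
variable {A : E →ₗ.[ℂ] E}

/-- Parseval for `T (v i)`, then Bessel's inequality for the vectors `T* e_j` and the family `v`. -/
lemma sum_enorm_sq_le_hsSq (T : E →L[ℂ] E) {n : ℕ} {v : Fin n → E} (hv : Orthonormal ℂ v) :
    ∑ i, ‖T (v i)‖ₑ ^ 2 ≤ hsSq T := by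
  rw [← hsSq_adjoint, hsSq, formTrace]
  calc ∑ i, ‖T (v i)‖ₑ ^ 2 = ∑ i, ∑' j, ‖inner ℂ (stdBasis E j) (T (v i))‖ₑ ^ 2 :=
        Finset.sum_congr rfl fun i _ => enorm_sq_eq_tsum (stdBasis E) _
    _ = ∑' j, ∑ i, ‖inner ℂ (stdBasis E j) (T (v i))‖ₑ ^ 2 :=
        (Summable.tsum_finsetSum fun _ _ => ENNReal.summable).symm
    _ ≤ _ := by
        refine ENNReal.tsum_le_tsum fun j => ?_
        have h := hv.sum_inner_products_le (s := Finset.univ)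
          (ContinuousLinearMap.adjoint T (stdBasis E j))
        have h1 := ENNReal.ofReal_le_ofReal h
        rw [ENNReal.ofReal_sum_of_nonneg fun _ _ => by positivity,
          ENNReal.ofReal_pow (norm_nonneg _), ofReal_norm] at h1
        refine le_trans (le_of_eq (Finset.sum_congr rfl fun i _ => ?_)) h1
        rw [ENNReal.ofReal_pow (norm_nonneg _), ofReal_norm, ContinuousLinearMap.adjoint_inner_right,
          enorm_inner_comm]

lemma sqrtOp_eq (hP : IsSpectralFamily (spectralFamily A)) :
    sqrtOp A = spectralIntegral (spectralFamily A) Real.sqrt := by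
  have hm := Real.continuous_sqrt.measurable
  have h : ∃ S : E →ₗ.[ℂ] E, IsSpectralIntegral (spectralFamily A) Real.sqrt S :=
    ⟨_, hP.isSpectralIntegral hm⟩
  rw [sqrtOp, funCalc, dif_pos h]
  exact ((hP.isSpectralIntegral hm).unique h.choose_spec (hP.dense_spectralIntegral hm)).symm

lemma IsSpectralFamily.adjoint_calc {P : ℝ → E →L[ℂ] E} (hP : IsSpectralFamily P) {φ : ℝ → ℝ}
    (hφ : IsBddMeas φ) : ContinuousLinearMap.adjoint (borelCalc P φ) = borelCalc P φ := by
  symm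
  rw [ContinuousLinearMap.eq_adjoint_iff]
  exact fun x y => hP.calc_symm hφ x y

lemma tsum_energy_eq_iSup (hP : IsSpectralFamily (spectralFamily A)) (T : E →L[ℂ] E) :
    ∑' i, energy A (T (stdBasis E i))
      = ⨆ n, hsSq (borelCalc (spectralFamily A) (trunc Real.sqrt n) * T) := by
  simp only [energy_eq_iSup hP]
  exact tsum_iSup_of_monotone fun i => hP.monotone_enorm_sq_trunc Real.continuous_sqrt.measurable _

lemma hsSq_calc_opSqrt (hP : IsSpectralFamily (spectralFamily A)) (ρ : E →L[ℂ] E) (n : ℕ) :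
    hsSq (borelCalc (spectralFamily A) (trunc Real.sqrt n) * opSqrt ρ)
      = hsSq (opSqrt ρ * borelCalc (spectralFamily A) (trunc Real.sqrt n)) := by
  rw [← hsSq_adjoint, adjoint_mul, adjoint_opSqrt,
    hP.adjoint_calc (isBddMeas_trunc Real.continuous_sqrt.measurable n)]

/-- Monotone convergence and invariance of the Hilbert–Schmidt norm under adjoints. Both trace
identities start from this formula. -/
lemma formTrace_sandwichForm (hP : IsSpectralFamily (spectralFamily A)) (ρ : E →L[ℂ] E) :
    formTrace (sandwichForm A ρ)
      = ⨆ n, hsSq (opSqrt ρ * borelCalc (spectralFamily A) (trunc Real.sqrt n)) := by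
  simp only [← hsSq_calc_opSqrt hP]
  exact tsum_energy_eq_iSup hP (opSqrt ρ)

lemma sandwichTrace_le (hP : IsSpectralFamily (spectralFamily A)) (ρ : E →L[ℂ] E) :
    sandwichTrace (sqrtOp A) ρ ≤ formTrace (sandwichForm A ρ) := by
  rw [sqrtOp_eq hP, formTrace_sandwichForm hP]
  refine iSup_le fun n => iSup_le fun v => iSup_le fun hv => ?_
  have hlim : Tendsto (fun m => ∑ i, ‖opSqrt ρ (borelCalc (spectralFamily A) (trunc Real.sqrt m)
      (v i : E))‖ₑ ^ 2) atTop (𝓝 (∑ i, ‖opSqrt ρ (spectralIntegral (spectralFamily A) Real.sqrt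
      (v i))‖ₑ ^ 2)) := by
    refine tendsto_finsetSum _ fun i _ => ENNReal.Tendsto.pow (Tendsto.enorm ?_)
    exact ((opSqrt ρ).continuous.tendsto _).comp (IsSpectralFamily.tendsto_spectralIntegral (v i))
  refine le_of_tendsto' hlim fun m => ?_
  exact (sum_enorm_sq_le_hsSq (opSqrt ρ * borelCalc (spectralFamily A) (trunc Real.sqrt m)) hv).trans
    (le_iSup (fun m => hsSq (opSqrt ρ * borelCalc (spectralFamily A) (trunc Real.sqrt m))) m)

/-- The Hilbert--Schmidt norm may be computed in a Hilbert basis of a subspace containing the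
range of the adjoint. -/
lemma hsSq_eq_tsum_of_mem {K : Submodule ℂ E} [CompleteSpace K] {ι : Type*} (b : HilbertBasis ι ℂ K)
    (T : E →L[ℂ] E) (hT : ∀ f, ContinuousLinearMap.adjoint T f ∈ K) :
    hsSq T = ∑' k, ‖T (b k : E)‖ₑ ^ 2 := by
  rw [← hsSq_adjoint, hsSq, formTrace]
  calc ∑' i, ‖ContinuousLinearMap.adjoint T (stdBasis E i)‖ₑ ^ 2
      = ∑' i, ∑' k, ‖inner ℂ (stdBasis E i) (T (b k : E))‖ₑ ^ 2 := by
        refine tsum_congr fun i => ?_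
        have h := enorm_sq_eq_tsum b ⟨_, hT (stdBasis E i)⟩
        have h1 : ‖(⟨_, hT (stdBasis E i)⟩ : K)‖ₑ
            = ‖ContinuousLinearMap.adjoint T (stdBasis E i)‖ₑ := rfl
        rw [h1] at h
        rw [h]
        refine tsum_congr fun k => ?_
        rw [Submodule.coe_inner, ContinuousLinearMap.adjoint_inner_right, enorm_inner_comm]
    _ = ∑' k, ∑' i, ‖inner ℂ (stdBasis E i) (T (b k : E))‖ₑ ^ 2 := ENNReal.tsum_comm
    _ = _ := tsum_congr fun k => (enorm_sq_eq_tsum (stdBasis E) _).symm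

/-- The spectral subspace `K` of `{√t ≤ n}` lies in the domain of `A^{1/2}`, which there equals its
truncation. The adjoint of `ρ^{1/2}` times the truncation has range in `K`, so finite parts of a
Hilbert basis of `K` exhaust the Hilbert–Schmidt norm. -/
lemma le_sandwichTrace (hP : IsSpectralFamily (spectralFamily A)) (ρ : E →L[ℂ] E) :
    formTrace (sandwichForm A ρ) ≤ sandwichTrace (sqrtOp A) ρ := by
  have hm := Real.continuous_sqrt.measurable
  rw [sqrtOp_eq hP, formTrace_sandwichForm hP]
  refine iSup_le fun n => ?_
  let K : Submodule ℂ E := (1 - borelCalc (spectralFamily A) (truncOne Real.sqrt n)).ker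
  have hK : ∀ f, f ∈ K ↔ borelCalc (spectralFamily A) (truncOne Real.sqrt n) f = f := by
    intro f
    change (1 - borelCalc (spectralFamily A) (truncOne Real.sqrt n)) f = 0 ↔ _
    rw [sub_apply, one_apply_eq_self, sub_eq_zero, eq_comm]
  have hKc : IsClosed (K : Set E) := (1 - borelCalc (spectralFamily A) (truncOne Real.sqrt n)).isClosed_ker
  have : CompleteSpace K := hKc.completeSpace_coe
  obtain ⟨w, b, -⟩ := exists_hilbertBasis ℂ K
  rw [hsSq_eq_tsum_of_mem b, ENNReal.tsum_eq_iSup_sum]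
  · refine iSup_le fun s => ?_
    have hS : ∀ k, ∃ h : (b k : E) ∈ (spectralIntegral (spectralFamily A) Real.sqrt).domain,
        spectralIntegral (spectralFamily A) Real.sqrt ⟨b k, h⟩
          = borelCalc (spectralFamily A) (trunc Real.sqrt n) (b k) := by
      intro k
      have h := hP.spectralIntegral_truncOne hm n (b k : E)
      have hb := (hK _).1 (b k).2
      obtain ⟨h1, h2⟩ := h
      refine ⟨hb ▸ h1, ?_⟩
      rw [← h2]
      congr 1
      exact Subtype.ext hb.symm
    choose hd hS using hS
    let v : Fin s.card → (spectralIntegral (spectralFamily A) Real.sqrt).domain := fun i =>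
      ⟨b (s.equivFin.symm i), hd _⟩
    have hv : Orthonormal ℂ fun i => (v i : E) := by
      have h1 : Orthonormal ℂ fun k => (b k : E) := b.orthonormal.comp_linearIsometry K.subtypeₗᵢ
      exact h1.comp (fun i => (s.equivFin.symm i : w))
        (Subtype.val_injective.comp s.equivFin.symm.injective)
    refine le_trans (le_of_eq ?_) (le_iSup_of_le s.card (le_iSup₂_of_le v hv le_rfl))
    rw [← Finset.sum_coe_sort s, ← Equiv.sum_comp s.equivFin.symm]
    refine Finset.sum_congr rfl fun i _ => ?_
    rw [mul_apply_eq_comp, hS]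
  · intro f
    rw [adjoint_mul, hP.adjoint_calc (isBddMeas_trunc hm n), mul_apply_eq_comp, hK,
      hP.calc_calc (isBddMeas_truncOne hm n) (isBddMeas_trunc hm n)]
    congr 2
    ext t
    rcases le_or_gt |√t| n with h | h
    · rw [truncOne_of_le h, one_mul]
    · rw [trunc_of_lt h, mul_zero]

end Trace

/-! ## Traces of products of Hilbert--Schmidt operators -/

section TraceClass

variable {E : Type*} [NormedAddCommGroup E] [InnerProductSpace ℂ E] [CompleteSpace E]

lemma hsSq_mul_ne_top_left (B : E →L[ℂ] E) {T : E →L[ℂ] E} (hT : hsSq T ≠ ∞) : hsSq (B * T) ≠ ∞ := by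
  refine ne_top_of_le_ne_top (b := ‖B‖ₑ ^ 2 * hsSq T)
    (ENNReal.mul_ne_top (ENNReal.pow_ne_top enorm_ne_top) hT) ?_
  rw [hsSq, hsSq, formTrace, formTrace, ← ENNReal.tsum_mul_left]
  refine ENNReal.tsum_le_tsum fun i => ?_
  rw [mul_apply_eq_comp, ← mul_pow]
  gcongr
  exact B.le_opENorm _

lemma hsSq_mul_ne_top_right (B : E →L[ℂ] E) {T : E →L[ℂ] E} (hT : hsSq T ≠ ∞) : hsSq (T * B) ≠ ∞ := by
  rw [← hsSq_adjoint, adjoint_mul]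
  exact hsSq_mul_ne_top_left _ (by rwa [hsSq_adjoint])

lemma summable_norm_sq {ι F : Type*} [NormedAddCommGroup F] {x : ι → F} (h : ∑' i, ‖x i‖ₑ ^ 2 ≠ ∞) :
    Summable fun i => ‖x i‖ ^ 2 := by
  refine (ENNReal.summable_toReal h).congr fun i => ?_
  rw [ENNReal.toReal_pow, toReal_enorm]

lemma summable_norm_mul {ι F G : Type*} [NormedAddCommGroup F] [NormedAddCommGroup G] {x : ι → F}
    {y : ι → G} (hx : ∑' i, ‖x i‖ₑ ^ 2 ≠ ∞) (hy : ∑' i, ‖y i‖ₑ ^ 2 ≠ ∞) :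
    Summable fun i => ‖x i‖ * ‖y i‖ := by
  refine Summable.of_nonneg_of_le (fun i => by positivity) (fun i => ?_)
    ((summable_norm_sq hx).add (summable_norm_sq hy))
  nlinarith [sq_nonneg (‖x i‖ - ‖y i‖), sq_nonneg (‖x i‖), sq_nonneg (‖y i‖)]

lemma tsum_tsum_inner_ne_top {X : E →L[ℂ] E} (hX : hsSq X ≠ ∞) :
    ∑' p : basisIndex E × basisIndex E,
      ‖inner ℂ (stdBasis E p.2) (X (stdBasis E p.1))‖ₑ ^ 2 ≠ ∞ := by
  rw [ENNReal.tsum_prod (f := fun i j => ‖inner ℂ (stdBasis E j) (X (stdBasis E i))‖ₑ ^ 2)]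
  simp only [← enorm_sq_eq_tsum (stdBasis E)]
  exact hX

/-- The trace of an operator, as the sum of its diagonal entries. -/
def diagSum (T : E →L[ℂ] E) : ℂ := ∑' i, inner ℂ (stdBasis E i) (T (stdBasis E i))

lemma summable_diag_mul {X Y : E →L[ℂ] E} (hX : hsSq X ≠ ∞) (hY : hsSq Y ≠ ∞) :
    Summable fun i => inner ℂ (stdBasis E i) ((X * Y) (stdBasis E i)) := by
  have hX' : hsSq (ContinuousLinearMap.adjoint X) ≠ ∞ := by rwa [hsSq_adjoint]
  refine Summable.of_norm_bounded (summable_norm_mul hX' hY) fun i => ?_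
  rw [mul_apply_eq_comp, ← ContinuousLinearMap.adjoint_inner_left]
  exact norm_inner_le_norm _ _

lemma diagSum_mul_eq {X Y : E →L[ℂ] E} : diagSum (X * Y) = ∑' i, ∑' j,
    inner ℂ (stdBasis E i) (X (stdBasis E j)) * inner ℂ (stdBasis E j) (Y (stdBasis E i)) := by
  refine tsum_congr fun i => ?_
  rw [mul_apply_eq_comp, ← ContinuousLinearMap.adjoint_inner_left,
    ← (stdBasis E).tsum_inner_mul_inner]
  refine tsum_congr fun j => ?_
  rw [ContinuousLinearMap.adjoint_inner_left]

/-- Both sides are iterated sums of one double series, absolutely summable because the matrix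
entries of `X` and `Y` are square summable. -/
lemma diagSum_mul_comm {X Y : E →L[ℂ] E} (hX : hsSq X ≠ ∞) (hY : hsSq Y ≠ ∞) :
    diagSum (X * Y) = diagSum (Y * X) := by
  rw [diagSum_mul_eq, diagSum_mul_eq]
  have h : Summable (Function.uncurry fun i j : basisIndex E =>
      inner ℂ (stdBasis E i) (X (stdBasis E j)) * inner ℂ (stdBasis E j) (Y (stdBasis E i))) := by
    have hX' := tsum_tsum_inner_ne_top hX
    rw [← (Equiv.prodComm _ _).tsum_eq] at hX'
    refine Summable.of_norm_bounded (summable_norm_mul hX' (tsum_tsum_inner_ne_top hY)) fun p => ?_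
    rw [Function.uncurry, norm_mul]
    rfl
  rw [← h.tsum_comm]
  exact tsum_congr fun i => tsum_congr fun j => mul_comm _ _

/-! ## Approximate inverses -/

/-- Take `D_n = (r + ε)⁻¹` with `ε = 1 / (n + 1)`: on the spectrum `x / (x + ε) ≤ 1` and `|x² / (x +
ε) - x| = ε x / (x + ε) ≤ ε`. -/
lemma exists_approx_inverse {r : E →L[ℂ] E} (hr : 0 ≤ r) : ∃ D : ℕ → E →L[ℂ] E,
    (∀ n, ContinuousLinearMap.adjoint (D n) = D n) ∧ (∀ n, D n * r = r * D n) ∧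
    (∀ n f, ‖r (D n f)‖ ≤ ‖f‖) ∧ ∀ f, Tendsto (fun n => r (D n (r f))) atTop (𝓝 (r f)) := by
  have hsa : IsSelfAdjoint r := IsSelfAdjoint.of_nonneg hr
  have hε : ∀ n : ℕ, (0 : ℝ) < 1 / ((n : ℝ) + 1) := fun n => Nat.one_div_pos_of_nat
  have hpos : ∀ (n : ℕ) (x : ℝ), 0 < max x 0 + 1 / ((n : ℝ) + 1) := fun n x =>
    add_pos_of_nonneg_of_pos (le_max_right _ _) (hε n)
  -- The maximum with `0` changes nothing on the spectrum of `r` and makes the function continuous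
  -- on the whole line.
  let g : ℕ → ℝ → ℝ := fun n x => (max x 0 + 1 / ((n : ℝ) + 1))⁻¹
  have hg : ∀ n, Continuous (g n) := fun n =>
    Continuous.inv₀ (by fun_prop) fun x => (hpos n x).ne'
  have hrD : ∀ n, cfc (fun x => x * g n x) r = r * cfc (g n) r := fun n => by
    rw [cfc_mul (fun x => x) (g n) r continuous_id.continuousOn (hg n).continuousOn, cfc_id' ℝ r]
  have hDr : ∀ n, cfc (g n) r * r = r * cfc (g n) r := fun n => by
    have := cfc_commute_cfc (g n) (fun x => x) r
    rw [cfc_id' ℝ r] at this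
    exact this.eq
  have hnorm : ∀ n f, ‖(r * cfc (g n) r) f‖ ≤ ‖f‖ := by
    intro n f
    have h1 : ‖cfc (fun x => x * g n x) r‖ ≤ 1 := by
      refine norm_cfc_le zero_le_one fun x hx => ?_
      have hx0 := spectrum_nonneg_of_nonneg hr hx
      have h2 := hpos n x
      rw [Real.norm_of_nonneg (mul_nonneg hx0 (inv_nonneg.2 h2.le))]
      refine (mul_inv_le_iff₀ h2).2 ?_
      rw [one_mul]
      exact (le_max_left _ _).trans (le_add_of_nonneg_right (hε n).le)
    rw [← hrD]
    exact (ContinuousLinearMap.le_of_opNorm_le _ h1 f).trans (one_mul _).le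
  have hdiff : ∀ n, ‖r * cfc (g n) r * r - r‖ ≤ 1 / ((n : ℝ) + 1) := by
    intro n
    have hc : Continuous fun x => x * g n x := continuous_id.mul (hg n)
    have h0 : r * cfc (g n) r * r - r = cfc (fun x => x * g n x * x - x) r := by
      rw [cfc_sub (fun x => x * g n x * x) (fun x => x) r (hc.mul continuous_id).continuousOn
        continuous_id.continuousOn, cfc_mul (fun x => x * g n x) (fun x => x) r hc.continuousOn
        continuous_id.continuousOn, hrD, cfc_id' ℝ r]
    rw [h0]
    refine norm_cfc_le (hε n).le fun x hx => ?_
    have hx0 := spectrum_nonneg_of_nonneg hr hx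
    have h2 := hpos n x
    have h3 : x * g n x * x - x = -(1 / ((n : ℝ) + 1) * (x / (x + 1 / ((n : ℝ) + 1)))) := by
      simp only [g]
      rw [max_eq_left hx0] at h2 ⊢
      have := h2.ne'
      rw [div_eq_mul_inv x]
      linear_combination x * (mul_inv_cancel₀ this)
    rw [max_eq_left hx0] at h2
    rw [h3, norm_neg, Real.norm_of_nonneg (mul_nonneg (hε n).le (div_nonneg hx0 h2.le))]
    exact mul_le_of_le_one_right (hε n).le
      ((div_le_one h2).2 (le_add_of_nonneg_right (hε n).le))
  refine ⟨fun n => cfc (g n) r, fun n => ?_, hDr, fun n f => hnorm n f, fun f => ?_⟩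
  · exact (cfc_predicate (g n) r).adjoint_eq
  · rw [tendsto_iff_norm_sub_tendsto_zero]
    have hb : ∀ n : ℕ, ‖r (cfc (g n) r (r f)) - r f‖ ≤ 1 / ((n : ℝ) + 1) * ‖f‖ := fun n =>
      ContinuousLinearMap.le_of_opNorm_le _ (hdiff n) f
    have hl := (tendsto_one_div_add_atTop_nhds_zero_nat (𝕜 := ℝ)).mul_const ‖f‖
    rw [zero_mul] at hl
    exact squeeze_zero (fun n => norm_nonneg _) hb hl

end TraceClass

/-! ## The trace of `A ρ` -/

section TraceFormula

variable {E : Type*} [NormedAddCommGroup E] [InnerProductSpace ℂ E] [CompleteSpace E]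
variable {A : E →ₗ.[ℂ] E} {ρ : E →L[ℂ] E}

/-- The projection onto the closure of the range of a self-adjoint operator. -/
def supportProj (r : E →L[ℂ] E) : E →L[ℂ] E := (r.kerᗮ).starProjection

lemma apply_supportProj (r : E →L[ℂ] E) (f : E) : r (supportProj r f) = r f := by
  have h : f - supportProj r f ∈ r.kerᗮᗮ := (r.kerᗮ).sub_starProjection_mem_orthogonal f
  have : CompleteSpace r.ker := r.isClosed_ker.completeSpace_coe
  rw [Submodule.orthogonal_orthogonal] at h
  have h1 : r (f - supportProj r f) = 0 := h
  rw [map_sub, sub_eq_zero] at h1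
  exact h1.symm

lemma supportProj_supportProj (r : E →L[ℂ] E) (f : E) :
    supportProj r (supportProj r f) = supportProj r f :=
  Submodule.starProjection_eq_self_iff.2 ((r.kerᗮ).starProjection_apply_mem f)

/-- The operators `r D_n` kill `ker r`, converge on the range of `r` to the identity, and are
contractions; density of the range in the orthogonal complement of the kernel concludes. -/
lemma tendsto_supportProj {r : E →L[ℂ] E} (hr : ContinuousLinearMap.adjoint r = r)
    {D : ℕ → E →L[ℂ] E} (hDr : ∀ n, D n * r = r * D n) (hD : ∀ n f, ‖r (D n f)‖ ≤ ‖f‖)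
    (hlim : ∀ f, Tendsto (fun n => r (D n (r f))) atTop (𝓝 (r f))) (f : E) :
    Tendsto (fun n => r (D n f)) atTop (𝓝 (supportProj r f)) := by
  have h1 : ∀ n, r (D n f) = r (D n (supportProj r f)) := by
    intro n
    have h : ∀ g, r (D n g) = D n (r g) := fun g => (congrArg (fun T : E →L[ℂ] E => T g) (hDr n)).symm
    rw [h, h, apply_supportProj]
  simp only [h1]
  obtain ⟨b, hb⟩ : ∃ b, b = supportProj r f := ⟨_, rfl⟩
  have hmem : b ∈ closure (r.range : Set E) := by
    have h : b ∈ r.kerᗮ := hb ▸ (r.kerᗮ).starProjection_apply_mem f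
    rw [ContinuousLinearMap.orthogonal_ker, hr] at h
    exact h
  rw [← hb, Metric.tendsto_atTop]
  intro δ hδ
  obtain ⟨c, ⟨g, hg⟩, hc⟩ := Metric.mem_closure_iff.1 hmem (δ / 3) (by positivity)
  have hg' : r g = c := hg
  obtain ⟨N, hN⟩ := Metric.tendsto_atTop.1 (hlim g) (δ / 3) (by positivity)
  refine ⟨N, fun n hn => ?_⟩
  have h2 := hN n hn
  have h3 := hD n (b - r g)
  rw [map_sub, map_sub] at h3
  rw [← hg', dist_eq_norm] at hc
  rw [dist_eq_norm] at h2 ⊢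
  have h4 : r (D n b) - b = (r (D n b) - r (D n (r g))) + (r (D n (r g)) - r g) - (b - r g) := by abel
  rw [h4]
  have h5 := norm_sub_le ((r (D n b) - r (D n (r g))) + (r (D n (r g)) - r g)) (b - r g)
  have h6 := norm_add_le (r (D n b) - r (D n (r g))) (r (D n (r g)) - r g)
  linarith

lemma tendsto_supportProj_sq {r : E →L[ℂ] E} (hr : ContinuousLinearMap.adjoint r = r)
    {D : ℕ → E →L[ℂ] E} (hDr : ∀ n, D n * r = r * D n) (hD : ∀ n f, ‖r (D n f)‖ ≤ ‖f‖)
    (hlim : ∀ f, Tendsto (fun n => r (D n (r f))) atTop (𝓝 (r f))) (f : E) :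
    Tendsto (fun n => r (D n (r (D n f)))) atTop (𝓝 (supportProj r f)) := by
  have h1 := tendsto_iff_norm_sub_tendsto_zero.1 (tendsto_supportProj hr hDr hD hlim f)
  have h2 := tendsto_iff_norm_sub_tendsto_zero.1 (tendsto_supportProj hr hDr hD hlim (supportProj r f))
  rw [supportProj_supportProj] at h2
  rw [tendsto_iff_norm_sub_tendsto_zero]
  refine squeeze_zero (fun n => norm_nonneg _) (fun n => ?_) (by simpa using h1.add h2)
  have h3 := hD n (r (D n f) - supportProj r f)
  rw [map_sub, map_sub] at h3
  refine le_trans ?_ (add_le_add_left h3 _)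
  refine le_trans (le_of_eq ?_) (norm_add_le _ _)
  congr 1
  abel

lemma inner_eq_energy (hP : IsSpectralFamily (spectralFamily A))
    (hPA : IsSpectralIntegral (spectralFamily A) id A) (hneg : ∀ t < 0, spectralFamily A t = 0)
    (f : A.domain) :
    energy A f ≠ ∞ ∧ inner ℂ (f : E) (A f) = ((energy A f).toReal : ℂ) := by
  have hae := hP.scalarMeasure_Iio_zero hneg f
  have hint : Integrable (fun t : ℝ => t) (scalarMeasure (spectralFamily A) f) :=
    hP.integrable_of_sq measurable_id ((hPA.mem_domain_iff f).1 f.2)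
  have h : energy A f = ENNReal.ofReal (∫ t, t ∂(scalarMeasure (spectralFamily A) f)) := by
    rw [energy, ofReal_integral_eq_lintegral_ofReal hint hae]
  rw [hPA.inner_eq, h, ENNReal.toReal_ofReal (integral_nonneg_of_ae hae)]
  exact ⟨ENNReal.ofReal_ne_top, rfl⟩

/-- With `r = ρ^{1/2}`, the regularized operator `D_n ρ U V D_n = D_n ρ A ρ D_n` has the energies of
`ρ D_n e_i` as diagonal entries. Its trace is evaluated in the limit in two ways: by cyclicity it
tends to the trace of `U V`, and as a Hilbert–Schmidt norm it tends to the trace of `r A r`. -/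
theorem formTrace_eq_diagSum (hP : IsSpectralFamily (spectralFamily A))
    (hPA : IsSpectralIntegral (spectralFamily A) id A) (hneg : ∀ t < 0, spectralFamily A t = 0)
    (hρ : ρ.IsPositive) {U V : E →L[ℂ] E} (hU : hsSq U ≠ ∞) (hV : hsSq V ≠ ∞)
    (hT : ∀ f, ∃ h : ρ f ∈ A.domain, A ⟨ρ f, h⟩ = (U * V) f) :
    formTrace (sandwichForm A ρ) ≠ ∞ ∧
      diagSum (U * V) = ((formTrace (sandwichForm A ρ)).toReal : ℂ) := by
  have hr0 : 0 ≤ opSqrt ρ := CFC.sqrt_nonneg ρ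
  have hrr := opSqrt_mul_self ρ hρ
  have hradj := adjoint_opSqrt ρ
  obtain ⟨D, hDadj, hDr, hD, hlim⟩ := exists_approx_inverse hr0
  obtain ⟨r, hr⟩ : ∃ r, r = opSqrt ρ := ⟨_, rfl⟩
  rw [← hr] at hrr hradj hDr hD hlim
  have hρr : ∀ f, ρ f = r (r f) := fun f => (congrArg (fun T : E →L[ℂ] E => T f) hrr).symm
  have hcomm : ∀ n f, D n (r f) = r (D n f) := fun n f =>
    congrArg (fun T : E →L[ℂ] E => T f) (hDr n)
  have hρsymm : ∀ f g, inner ℂ (ρ f) g = inner ℂ f (ρ g) := fun f g => by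
    rw [hρr, hρr, hr, inner_opSqrt, inner_opSqrt]
  have hDsymm : ∀ n f g, inner ℂ (D n f) g = inner ℂ f (D n g) := fun n f g => by
    rw [← ContinuousLinearMap.adjoint_inner_left, hDadj]
  let X : ℕ → E →L[ℂ] E := fun n => D n * ρ * U
  let Y : ℕ → E →L[ℂ] E := fun n => V * D n
  have hX : ∀ n, hsSq (X n) ≠ ∞ := fun n => hsSq_mul_ne_top_left _ hU
  have hY : ∀ n, hsSq (Y n) ≠ ∞ := fun n => hsSq_mul_ne_top_right _ hV
  have hdiag : ∀ n f, energy A (ρ (D n f)) ≠ ∞ ∧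
      inner ℂ f ((X n * Y n) f) = ((energy A (ρ (D n f))).toReal : ℂ) := by
    intro n f
    obtain ⟨h1, h2⟩ := hT (D n f)
    have h3 := inner_eq_energy hP hPA hneg ⟨ρ (D n f), h1⟩
    refine ⟨h3.1, ?_⟩
    rw [← h3.2, h2]
    simp only [X, Y, mul_apply_eq_comp]
    rw [hρsymm, hDsymm]
  have hL : ∀ n, ((∑' i, energy A (ρ (D n (stdBasis E i)))) ≠ ∞) ∧
      diagSum (X n * Y n) = ((∑' i, energy A (ρ (D n (stdBasis E i)))).toReal : ℂ) := by
    intro n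
    have hs := summable_diag_mul (hX n) (hY n)
    simp only [hdiag n _] at hs
    have hs' := Complex.summable_ofReal.1 hs
    have h1 : ∑' i, energy A (ρ (D n (stdBasis E i)))
        = ENNReal.ofReal (∑' i, (energy A (ρ (D n (stdBasis E i)))).toReal) := by
      rw [ENNReal.ofReal_tsum_of_nonneg (fun i => ENNReal.toReal_nonneg) hs']
      exact tsum_congr fun i => (ENNReal.ofReal_toReal (hdiag n _).1).symm
    refine ⟨h1 ▸ ENNReal.ofReal_ne_top, ?_⟩
    rw [h1, ENNReal.toReal_ofReal (tsum_nonneg fun i => ENNReal.toReal_nonneg), Complex.ofReal_tsum]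
    exact tsum_congr fun i => (hdiag n _).2
  have hlimdiag : Tendsto (fun n => diagSum (X n * Y n)) atTop (𝓝 (diagSum (U * V))) := by
    have hV' : hsSq (ContinuousLinearMap.adjoint V) ≠ ∞ := by rwa [hsSq_adjoint]
    -- The support projection `Q` of `r` may be inserted, since `ρ Q = ρ` gives `U V Q = U V`;
    -- cyclicity moves it between `V` and `U`.
    have hq : diagSum (U * V) = ∑' i, inner ℂ (ContinuousLinearMap.adjoint V (stdBasis E i))
        (supportProj r (U (stdBasis E i))) := by
      have h1 : U * V = U * (V * supportProj r) := by
        ext f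
        obtain ⟨h1, h2⟩ := hT f
        obtain ⟨h3, h4⟩ := hT (supportProj r f)
        simp only [mul_apply_eq_comp] at h2 h4 ⊢
        rw [← h2, ← h4]
        congr 2
        rw [hρr, hρr, apply_supportProj]
      rw [h1, diagSum_mul_comm hU (hsSq_mul_ne_top_right _ hV)]
      refine tsum_congr fun i => ?_
      simp only [mul_apply_eq_comp]
      rw [ContinuousLinearMap.adjoint_inner_left]
    -- Cyclicity collects `D_n D_n ρ = (r D_n)²` between `V` and `U`; these contractions tend
    -- strongly to the support projection, so dominated convergence applies to the sum.
    have hx : ∀ n, diagSum (X n * Y n) = ∑' i, inner ℂ (ContinuousLinearMap.adjoint V (stdBasis E i))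
        (r (D n (r (D n (U (stdBasis E i)))))) := by
      intro n
      rw [diagSum_mul_comm (hX n) (hY n)]
      refine tsum_congr fun i => ?_
      simp only [X, Y, mul_apply_eq_comp]
      rw [ContinuousLinearMap.adjoint_inner_left, hρr, hcomm, hcomm, hcomm, hcomm]
    simp only [hx, hq]
    refine tendsto_tsum_of_dominated_convergence (summable_norm_mul hV' hU) (fun i => ?_)
      (Eventually.of_forall fun n i => ?_)
    · exact tendsto_const_nhds.inner (tendsto_supportProj_sq hradj hDr hD hlim _)
    · refine (norm_inner_le_norm _ _).trans ?_
      gcongr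
      exact (hD n _).trans (hD n _)
  have hlimre : Tendsto (fun n => ((∑' i, energy A (ρ (D n (stdBasis E i)))).toReal)) atTop
      (𝓝 (diagSum (U * V)).re) := by
    refine ((Complex.continuous_re.tendsto _).comp hlimdiag).congr fun n => ?_
    rw [Function.comp_apply, (hL n).2, Complex.ofReal_re]
  have him : (diagSum (U * V)).im = 0 := by
    refine tendsto_nhds_unique ((Complex.continuous_im.tendsto _).comp hlimdiag)
      (tendsto_const_nhds.congr fun n => ?_)
    rw [Function.comp_apply, (hL n).2, Complex.ofReal_im]
  have hlimL : Tendsto (fun n => ∑' i, energy A (ρ (D n (stdBasis E i)))) atTop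
      (𝓝 (ENNReal.ofReal (diagSum (U * V)).re)) :=
    (ENNReal.tendsto_ofReal hlimre).congr fun n => ENNReal.ofReal_toReal (hL n).1
  -- The adjoint moves the regularization to the left as the contraction `r D_n` applied to `r`
  -- times the truncated `A^{1/2}`.
  have hreg : ∀ n, ∑' i, energy A (ρ (D n (stdBasis E i))) = ⨆ m, hsSq ((r * D n) *
      (r * borelCalc (spectralFamily A) (trunc Real.sqrt m))) := by
    intro n
    rw [← show ∑' i, energy A ((ρ * D n) (stdBasis E i)) = ∑' i, energy A (ρ (D n (stdBasis E i)))
      from rfl, tsum_energy_eq_iSup hP]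
    refine iSup_congr fun m => ?_
    rw [← hsSq_adjoint, adjoint_mul, adjoint_mul, hDadj, ← hrr, adjoint_mul, hradj,
      hP.adjoint_calc (isBddMeas_trunc Real.continuous_sqrt.measurable m), ← hDr]
    simp only [mul_assoc]
  have hE : formTrace (sandwichForm A ρ) = ENNReal.ofReal (diagSum (U * V)).re := by
    rw [formTrace_sandwichForm hP, ← hr]
    -- One inequality is lower semicontinuity on finite sums, since `r D_n r → r` strongly; the
    -- other holds for each `n` because `r D_n` is a contraction.
    refine le_antisymm (iSup_le fun m => ?_) (le_of_tendsto' hlimL fun n => ?_)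
    · rw [hsSq, formTrace, ENNReal.tsum_eq_iSup_sum]
      refine iSup_le fun s => ?_
      have h1 : Tendsto (fun n => ∑ i ∈ s, ‖(r * D n * (r * borelCalc (spectralFamily A)
          (trunc Real.sqrt m))) (stdBasis E i)‖ₑ ^ 2) atTop (𝓝 (∑ i ∈ s, ‖(r * borelCalc
          (spectralFamily A) (trunc Real.sqrt m)) (stdBasis E i)‖ₑ ^ 2)) := by
        refine tendsto_finsetSum _ fun i _ => ENNReal.Tendsto.pow (Tendsto.enorm ?_)
        exact hlim _
      refine le_of_tendsto_of_tendsto' h1 hlimL fun n => ?_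
      rw [hreg n]
      exact (ENNReal.sum_le_tsum s).trans (le_iSup (fun m => hsSq ((r * D n) *
        (r * borelCalc (spectralFamily A) (trunc Real.sqrt m)))) m)
    · rw [hreg n]
      exact iSup_mono fun m => hsSq_mul_le (fun f => hD n f) _
  refine ⟨hE ▸ ENNReal.ofReal_ne_top, ?_⟩
  rw [hE, ENNReal.toReal_ofReal (ge_of_tendsto' hlimre fun n => ENNReal.toReal_nonneg)]
  exact Complex.ext rfl him

end TraceFormula

end MixedState

end

/-! ### The theorem -/

theorem mainTheorem2 {X : Type*} [MeasurableSpace X] (μ : Measure X) [SigmaFinite μ]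
    {H : Type*} [NormedAddCommGroup H] [InnerProductSpace ℂ H] [CompleteSpace H]
    (A : Lp H 2 μ →ₗ.[ℂ] Lp H 2 μ) (hA : IsSelfAdjoint A)
    (hpos : ∀ f : A.domain, 0 ≤ (inner ℂ (f : Lp H 2 μ) (A f)).re)
    (hF : ∀ l : ℝ, MixedState.spectralDensity A l ≠ ∞)
    (hG : ∀ l : ℝ, MixedState.stieltjesG A l ≠ ∞)
    (ρ : Lp H 2 μ →L[ℂ] Lp H 2 μ) (hρ : ρ.IsPositive)
    (hker : ∀ f : A.domain, A f = 0 → ρ (f : Lp H 2 μ) = 0) :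
    -- the inequality, where `𝓔(ρ) = τ(ρ^{1/2} A ρ^{1/2})`
    ∫⁻ x, MixedState.invG A
        (MixedState.densityFun ρ x / (4 * MixedState.formNorm (MixedState.sandwichForm A ρ)))
        ∂(MixedState.densityMeasure ρ)
      ≤ 4 * MixedState.formTrace (MixedState.sandwichForm A ρ) ∧
    -- `τ(ρ^{1/2} A ρ^{1/2}) = τ(A^{1/2} ρ A^{1/2})`
    MixedState.formTrace (MixedState.sandwichForm A ρ)
      = MixedState.sandwichTrace (MixedState.sqrtOp A) ρ ∧
    -- `τ(ρ^{1/2} A ρ^{1/2}) = τ(A ρ)`, whenever `A ρ` is trace class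
    (∀ T : Lp H 2 μ →L[ℂ] Lp H 2 μ,
      (∀ f, ∃ h : ρ f ∈ A.domain, A ⟨ρ f, h⟩ = T f) → MixedState.IsTraceClass T →
      MixedState.formTrace (MixedState.sandwichForm A ρ) ≠ ∞ ∧
      HasSum (fun i => inner ℂ (MixedState.stdBasis (Lp H 2 μ) i)
          (T (MixedState.stdBasis (Lp H 2 μ) i)))
        ((MixedState.formTrace (MixedState.sandwichForm A ρ)).toReal : ℂ)) := by
  obtain ⟨hP, hPA⟩ := MixedState.isSpectralFamily_spectralFamily hA hpos
  have hneg : ∀ t < 0, MixedState.spectralFamily A t = 0 := fun t ht =>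
    MixedState.proj_eq_zero_of_neg hP hPA hpos ht
  refine ⟨MixedState.lintegral_invG_le hP hneg hF hG
    (MixedState.proj_zero_opSqrt hA hP hPA hpos hρ hker),
    le_antisymm (MixedState.le_sandwichTrace hP ρ) (MixedState.sandwichTrace_le hP ρ), ?_⟩
  rintro T hT ⟨U, V, hU, hV, rfl⟩
  obtain ⟨h1, h2⟩ := MixedState.formTrace_eq_diagSum hP hPA hneg hρ hU hV hT
  refine ⟨h1, ?_⟩
  rw [← h2]
  exact (MixedState.summable_diag_mul hU hV).hasSum
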